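/- **Setting.** Let $d\in\{2,3\}$ and let $\Omega_1\subset\subset\Omega_2\subset\subset\Omega_3\subset\subset\Omega$ be smooth connected bounded open subsets of $\mathbb R^d$. Let $k\ge 0$, let $A:\Omega\to\mathbb R^{d\times d}$ be bounded and measurable with $\frac1\Lambda|\xi|^2\le\langle A(x)\xi,\xi\rangle\le\Lambda|\xi|^2$ for all $\xi\in\mathbb R^d$ and a.e. $x\in\Omega$ (for some $0<\Lambda<\infty$), and let $\Sigma:\Omega\to\mathbb R$ be measurable with $0<\operatorname{ess\,inf}_\Omega\Sigma\le\operatorname{ess\,sup}_\Omega\Sigma<\infty$. Functions $f,U,V,W$ are complex valued, equations are understood in the weak sense, and boundary values in the sense of traces and of weak conormal derivatives. "Diffeomorphism" means $C^1$-diffeomorphism. For a diffeomorphism $\mathcal F$, with $x=\mathcal F^{-1}(y)$ and $J(x)=|\det D\mathcal F(x)|$, put $$\mathcal F_*B(y)=\frac{D\mathcal F(x)B(x)D\mathcal F(x)^T}{J(x)}\ \text{ (matrices)},\qquad \mathcal F_*h(y)=\frac{h(x)}{J(x)}\ \text{ (scalars)}.$$ **Reflecting complementary media.** The media $(A,\Sigma)$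 in $\Omega_3\setminus\Omega_2$ and $(-A,-\Sigma)$ in $\Omega_2\setminus\Omega_1$ are reflecting complementary, by means of $F$ and $G$, if for some $x_1\in\Omega_1$, $x_2\in\Omega_3$ and some smooth open set $\Omega_4\supset\Omega_3$: $F:\Omega_2\setminus\{x_1\}\to\Omega_4\setminus\overline{\Omega_2}$ is a diffeomorphism which restricts to a diffeomorphism $\Omega_2\setminus\overline{\Omega_1}\to\Omega_3\setminus\overline{\Omega_2}$; $F_*A=A$ and $F_*\Sigma=\Sigma$ a.e. in $\Omega_3\setminus\overline{\Omega_2}$; $F(x)=x$ on $\partial\Omega_2$; $G:\Omega_4\setminus\overline{\Omega_3}\to\Omega_3\setminus\{x_2\}$ is a diffeomorphism with $G(x)=x$ on $\partial\Omega_3$; and $G\circ F:\Omega_1\to\Omega_3$ is a diffeomorphism if one sets $G\circ F(x_1)=x_2$. (In the two boundary conditions $F$ and $G$ are extended as diffeomorphisms to neighbourhoods of $\partial\Omega_2$ and $\partial\Omega_3$.) If $k=0$ the condition on $\Sigma$ is dropped. Given such $F,G$, let $\hat A=A$, $\hat\Sigma=\Sigma$, $\hat f=f$ in $\Omega\setminus\Omega_3$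 and $\hat A=G_*F_*A$, $\hat\Sigma=G_*F_*\Sigma$, $\hat f=G_*F_*f$ in $\Omega_3$. Assume that the problem $\operatorname{div}(A\nabla v)+k^2\Sigma v=0$ in $\Omega\setminus\overline{\Omega_2}$, $v=0$ on $\partial\Omega\cup\partial\Omega_2$, has only the zero solution in $H^1(\Omega\setminus\overline{\Omega_2})$, and that the problem $\operatorname{div}(\hat A\nabla v)+k^2\hat\Sigma v=0$ in $\Omega$, $v=0$ on $\partial\Omega$, has only the zero solution in $H^1(\Omega)$. **Compatibility.** A function $f\in L^2(\Omega)$ is compatible with the system if there are $U,V\in H^1(\Omega_3\setminus\overline{\Omega_2})$ with $$\operatorname{div}(A\nabla U)+k^2\Sigma U=F_*f-f\ \text{ in }\Omega_3\setminus\overline{\Omega_2},\qquad U=0,\ A\nabla U\cdot\eta=0\ \text{ on }\partial\Omega_2,$$ $$\operatorname{div}(A\nabla V)+k^2\Sigma V=f\ \text{ in }\Omega_3\setminus\overline{\Omega_2},\qquad V=W|_{\rm ext},\ A\nabla V\cdot\eta=A\nabla W\cdot\eta|_{\rm ext}\ \text{ on }\partial\Omega_3,\tag{1}$$ where $W\in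 H^1(\Omega\setminus\partial\Omega_3)$ is the unique solution of $$\operatorname{div}(\hat A\nabla W)+k^2\hat\Sigma W=\hat f\ \text{ in }\Omega\setminus\partial\Omega_3,\quad W=0\ \text{ on }\partial\Omega,\quad [W]=-U,\ [\hat A\nabla W\cdot\eta]=-A\nabla U\cdot\eta\ \text{ on }\partial\Omega_3.\tag{2}$$ Here $\eta$ is the unit normal on $\partial\Omega_3$ exterior to $\Omega_3$ (and a unit normal on $\partial\Omega_2$), "ext" means the value from outside $\Omega_3$, and $[\cdot]$ is the exterior minus the interior value. **Statement.** Suppose that the media are reflecting complementary by means of $F$ and $G$, that $$G_*F_*A=A\quad\text{and}\quad G_*F_*\Sigma=\Sigma\quad\text{a.e. in }\Omega_3\setminus\overline{\Omega_2}$$ (the latter only if $k\ne0$), and that $f\in L^2(\Omega)$ vanishes a.e. in $\Omega_3$. Then $f$ is compatible with the system. More precisely, the problem $\operatorname{div}(\hat A\nabla W)+k^2\hat\Sigma W=f$ in $\Omega$, $W=0$ on $\partial\Omega$, has a unique solution $W\in H^1(\Omega)$, this $W$ solves (2) with $U=0$ (and $U=0$ solves the problem for $U$), and $V=W|_{\Omega_3\setminus\overline{\Omega_2}}$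 solves the Cauchy problem (1). Moreover, all these assumptions on the media hold in the following example: $d=2$, $k=0$, $A=I$, $\Sigma=1$, $0<r_1<r_2$, $r_3=r_2^2/r_1<R$, $\Omega_i=B_{r_i}$ $(i=1,2,3)$, $\Omega=B_R$, $\Omega_4=\mathbb R^2$, $x_1=x_2=0$, $F(x)=r_2^2x/|x|^2$, $G(x)=r_3^2x/|x|^2$. Hence every $f\in L^2(B_R)$ which vanishes a.e. in $B_{r_3}$ is compatible in that example. -/

import Mathlib

open MeasureTheory Set
open scoped ENNReal ContDiff

noncomputable section

namespace NIM

/-- `ℝ^d` with the Euclidean norm. -/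
abbrev E (d : ℕ) := EuclideanSpace ℝ (Fin d)

/-! ### Smooth domains, diffeomorphisms, push-forwards -/

/-- Open sets with smooth boundary: near each boundary point the set is the sublevel set `{ρ < 0}`
of a smooth function with non-vanishing differential. -/
def IsSmoothOpen {d : ℕ} (D : Set (E d)) : Prop :=
  IsOpen D ∧ ∀ x ∈ frontier D, ∃ N : Set (E d), ∃ ρ : E d → ℝ, IsOpen N ∧ x ∈ N ∧
    ContDiffOn ℝ ∞ ρ N ∧ fderiv ℝ ρ x ≠ 0 ∧ D ∩ N = {y ∈ N | ρ y < 0}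

/-- `F` restricts to a (`C¹`-)diffeomorphism from the open set `D` onto the open set `D'`. -/
def IsDiffeo {d : ℕ} (F : E d → E d) (D D' : Set (E d)) : Prop :=
  IsOpen D ∧ IsOpen D' ∧ BijOn F D D' ∧ ContDiffOn ℝ 1 F D ∧
    ContDiffOn ℝ 1 (Function.invFunOn F D) D'

/-- `F(x) = x` on `S ⊆ ∂D`, for a map `F` given on `D`: some diffeomorphism between neighbourhoods
of `S` extends `F` and is the identity on `S`. -/
def FixesBoundary {d : ℕ} (F : E d → E d) (D S : Set (E d)) : Prop :=
  ∃ F' : E d → E d, ∃ N N' : Set (E d), S ⊆ N ∧ IsDiffeo F' N N' ∧ EqOn F' F (N ∩ D) ∧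
    ∀ x ∈ S, F' x = x

/-- The Jacobian matrix `DF(x)`. -/
def jac {d : ℕ} (F : E d → E d) (x : E d) : Matrix (Fin d) (Fin d) ℝ :=
  Matrix.of fun i j => (fderiv ℝ F x (EuclideanSpace.single j 1)) i

/-- `F_* B (y) = DF(x) B(x) DF(x)ᵀ / |det DF(x)|`, `x = F⁻¹(y)`, for `F` a bijection defined
on `D`. -/
def pushMat {d : ℕ} (F : E d → E d) (D : Set (E d)) (B : E d → Matrix (Fin d) (Fin d) ℝ) :
    E d → Matrix (Fin d) (Fin d) ℝ := fun y =>
  let x := Function.invFunOn F D y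
  (|(jac F x).det|)⁻¹ • (jac F x * B x * (jac F x).transpose)

/-- `F_* h (y) = h(x) / |det DF(x)|`, `x = F⁻¹(y)`, for `F` a bijection defined on `D`. -/
def pushFun {d : ℕ} {V : Type} [SMul ℝ V] (F : E d → E d) (D : Set (E d)) (h : E d → V) :
    E d → V := fun y =>
  let x := Function.invFunOn F D y
  (|(jac F x).det|)⁻¹ • h x

/-! ### Sobolev functions, weak solutions, boundary values -/

/-- The partial derivative `∂ᵢ φ (x)`. -/
def pd {d : ℕ} (i : Fin d) (φ : E d → ℝ) (x : E d) : ℝ :=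
  fderiv ℝ φ x (EuclideanSpace.single i 1)

/-- `φ ∈ C_c^∞(D)`, extended by zero. -/
def IsTest {d : ℕ} (D : Set (E d)) (φ : E d → ℝ) : Prop :=
  ContDiff ℝ ∞ φ ∧ HasCompactSupport φ ∧ tsupport φ ⊆ D

/-- Green's formula for the trace of `u` on the boundary of `D` from inside `D` (`g` is the weak
gradient of `u`): `∫_D (u ∂ᵢφ + gᵢ φ)`, which is `∫_{∂D} u φ νᵢ` with `ν` the unit normal exterior
to `D`. The trace of `u` on a part `S` of `∂D`, open and closed in `∂D`, is determined by these
numbers for all `i` and all `φ` supported in a neighbourhood of `S` which meets no other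
part of `∂D`. -/
def bdryTrace {d : ℕ} (D : Set (E d)) (u : E d → ℂ) (g : E d → Fin d → ℂ) (i : Fin d)
    (φ : E d → ℝ) : ℂ :=
  ∫ x in D, (u x * (pd i φ x : ℂ) + g x i * (φ x : ℂ))

/-- `u ∈ H¹(D)` with weak gradient `∇u = g`. -/
def IsH1 {d : ℕ} (D : Set (E d)) (u : E d → ℂ) (g : E d → Fin d → ℂ) : Prop :=
  MemLp u 2 (volume.restrict D) ∧ (∀ i, MemLp (fun x => g x i) 2 (volume.restrict D)) ∧
    ∀ i, ∀ φ : E d → ℝ, IsTest D φ → bdryTrace D u g i φ = 0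

/-- The conormal derivative `B∇u·ν` on the boundary of `D`, in the weak (Green) sense, for a
solution `u` of `div (B∇u) + k²σu = h` in `D`: the number
`∫_D (B∇u·∇φ + (h - k²σu) φ)`, which is `∫_{∂D} (B∇u·ν) φ`, `ν` the unit normal exterior
to `D`. -/
def bdryFlux {d : ℕ} (D : Set (E d)) (k : ℝ) (B : E d → Matrix (Fin d) (Fin d) ℝ) (σ : E d → ℝ)
    (h : E d → ℂ) (u : E d → ℂ) (g : E d → Fin d → ℂ) (φ : E d → ℝ) : ℂ :=
  ∫ x in D, ((∑ i, (∑ j, (B x i j : ℂ) * g x j) * (pd i φ x : ℂ))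
    + (h x - (k : ℂ) ^ 2 * (σ x : ℂ) * u x) * (φ x : ℂ))

/-- `div (B∇u) + k²σu = h` in `D`, tested against all `φ ∈ C_c^∞(D)`. -/
def IsWeakSol {d : ℕ} (D : Set (E d)) (k : ℝ) (B : E d → Matrix (Fin d) (Fin d) ℝ) (σ : E d → ℝ)
    (h : E d → ℂ) (u : E d → ℂ) (g : E d → Fin d → ℂ) : Prop :=
  ∀ φ : E d → ℝ, IsTest D φ → bdryFlux D k B σ h u g φ = 0

/-- `u = 0` on `S ⊆ ∂D` for `u ∈ H¹(D)` with `∇u = g`: `u` is a limit in `H¹(D)` of functions in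
`H¹(D)` which vanish near `S`. For `D` bounded and `S = ∂D` this says `u ∈ H¹₀(D)`. -/
def VanishesOn {d : ℕ} (D S : Set (E d)) (u : E d → ℂ) (g : E d → Fin d → ℂ) : Prop :=
  ∀ ε : ℝ≥0∞, 0 < ε → ∃ v : E d → ℂ, ∃ h : E d → Fin d → ℂ, IsH1 D v h ∧
    (∃ N : Set (E d), IsOpen N ∧ S ⊆ N ∧ ∀ᵐ x ∂volume.restrict (D ∩ N), v x = 0) ∧
    eLpNorm (fun x => u x - v x) 2 (volume.restrict D) < ε ∧
    ∀ i, eLpNorm (fun x => g x i - h x i) 2 (volume.restrict D) < ε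

/-! ### The media -/

/-- Domains `Ω₁, Ω₂, Ω₃, Ω`, coefficients `A`, `Σ` (written `sig`) and frequency `k`. -/
structure Medium (d : ℕ) where
  Ω₁ : Set (E d)
  Ω₂ : Set (E d)
  Ω₃ : Set (E d)
  Ω : Set (E d)
  A : E d → Matrix (Fin d) (Fin d) ℝ
  sig : E d → ℝ
  k : ℝ

/-- Standing assumptions on the domains and the coefficients. -/
structure Medium.Standing {d : ℕ} (M : Medium d) : Prop where
  smooth₁ : IsSmoothOpen M.Ω₁
  smooth₂ : IsSmoothOpen M.Ω₂
  smooth₃ : IsSmoothOpen M.Ω₃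
  smooth : IsSmoothOpen M.Ω
  conn₁ : IsConnected M.Ω₁
  conn₂ : IsConnected M.Ω₂
  conn₃ : IsConnected M.Ω₃
  conn : IsConnected M.Ω
  bdd : Bornology.IsBounded M.Ω
  sub₁₂ : closure M.Ω₁ ⊆ M.Ω₂
  sub₂₃ : closure M.Ω₂ ⊆ M.Ω₃
  sub₃ : closure M.Ω₃ ⊆ M.Ω
  meas_A : ∀ i j, AEMeasurable (fun x => M.A x i j) (volume.restrict M.Ω)
  bdd_A : ∃ C : ℝ, ∀ᵐ x ∂volume.restrict M.Ω, ∀ i j, |M.A x i j| ≤ C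
  elliptic : ∃ Λ : ℝ, 0 < Λ ∧ ∀ᵐ x ∂volume.restrict M.Ω, ∀ ξ : Fin d → ℝ,
    Λ⁻¹ * (ξ ⬝ᵥ ξ) ≤ (M.A x).mulVec ξ ⬝ᵥ ξ ∧ (M.A x).mulVec ξ ⬝ᵥ ξ ≤ Λ * (ξ ⬝ᵥ ξ)
  meas_sig : AEMeasurable M.sig (volume.restrict M.Ω)
  bdd_sig : ∃ c C : ℝ, 0 < c ∧ ∀ᵐ x ∂volume.restrict M.Ω, c ≤ M.sig x ∧ M.sig x ≤ C
  k_nonneg : 0 ≤ M.k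

/-- The data of the two reflections: `F` on `Ω₂ \ {x₁}`, `G` on `Ω₄ \ closure Ω₃`. -/
structure Reflections (d : ℕ) where
  Ω₄ : Set (E d)
  x₁ : E d
  x₂ : E d
  F : E d → E d
  G : E d → E d

variable {d : ℕ}

/-- `F_* A`. -/
def pushFA (M : Medium d) (R : Reflections d) : E d → Matrix (Fin d) (Fin d) ℝ :=
  pushMat R.F (M.Ω₂ \ {R.x₁}) M.A

/-- `F_* h` for a scalar function `h`. -/
def pushF {V : Type} [SMul ℝ V] (M : Medium d) (R : Reflections d) (h : E d → V) : E d → V :=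
  pushFun R.F (M.Ω₂ \ {R.x₁}) h

/-- `G_* F_* A`. -/
def pushGFA (M : Medium d) (R : Reflections d) : E d → Matrix (Fin d) (Fin d) ℝ :=
  pushMat R.G (R.Ω₄ \ closure M.Ω₃) (pushFA M R)

/-- `G_* F_* h` for a scalar function `h`. -/
def pushGF {V : Type} [SMul ℝ V] (M : Medium d) (R : Reflections d) (h : E d → V) : E d → V :=
  pushFun R.G (R.Ω₄ \ closure M.Ω₃) (pushF M R h)

/-- The media `(A, Σ)` in `Ω₃ \ Ω₂` and `(-A, -Σ)` in `Ω₂ \ Ω₁` are reflecting complementary, by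
means of `F` and `G`. The condition on `Σ` is void in the quasistatic case `k = 0`. -/
structure ReflectingComplementary (M : Medium d) (R : Reflections d) : Prop where
  F_diffeo : IsDiffeo R.F (M.Ω₂ \ closure M.Ω₁) (M.Ω₃ \ closure M.Ω₂)
  push_A : ∀ᵐ x ∂volume.restrict (M.Ω₃ \ closure M.Ω₂), pushFA M R x = M.A x
  push_sig : M.k ≠ 0 →
    ∀ᵐ x ∂volume.restrict (M.Ω₃ \ closure M.Ω₂), pushF M R M.sig x = M.sig x
  F_fix : FixesBoundary R.F (M.Ω₂ \ {R.x₁}) (frontier M.Ω₂)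
  x₁_mem : R.x₁ ∈ M.Ω₁
  smooth₄ : IsSmoothOpen R.Ω₄
  sub₃₄ : M.Ω₃ ⊆ R.Ω₄
  F_ext : IsDiffeo R.F (M.Ω₂ \ {R.x₁}) (R.Ω₄ \ closure M.Ω₂)
  x₂_mem : R.x₂ ∈ M.Ω₃
  G_diffeo : IsDiffeo R.G (R.Ω₄ \ closure M.Ω₃) (M.Ω₃ \ {R.x₂})
  G_fix : FixesBoundary R.G (R.Ω₄ \ closure M.Ω₃) (frontier M.Ω₃)
  GF_diffeo : IsDiffeo (Function.update (R.G ∘ R.F) R.x₁ R.x₂) M.Ω₁ M.Ω₃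

open Classical in
/-- `Â = A` outside `Ω₃`, `G_* F_* A` in `Ω₃`. -/
def hatA (M : Medium d) (R : Reflections d) : E d → Matrix (Fin d) (Fin d) ℝ := fun x =>
  if x ∈ M.Ω₃ then pushGFA M R x else M.A x

open Classical in
/-- `ĥ = h` outside `Ω₃`, `G_* F_* h` in `Ω₃` (for `h = Σ` and `h = f`). -/
def hat {V : Type} [SMul ℝ V] (M : Medium d) (R : Reflections d) (h : E d → V) : E d → V :=
  fun x => if x ∈ M.Ω₃ then pushGF M R h x else h x

/-- The standing well-posedness assumption: the two homogeneous Dirichlet problems, in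
`Ω \ closure Ω₂` for `(A, Σ)` and in `Ω` for `(Â, Σ̂)`, have only the zero solution in `H¹`. -/
def WellPosed (M : Medium d) (R : Reflections d) : Prop :=
  (∀ v g, IsH1 (M.Ω \ closure M.Ω₂) v g →
    IsWeakSol (M.Ω \ closure M.Ω₂) M.k M.A M.sig 0 v g →
    VanishesOn (M.Ω \ closure M.Ω₂) (frontier M.Ω ∪ frontier M.Ω₂) v g →
    ∀ᵐ x ∂volume.restrict (M.Ω \ closure M.Ω₂), v x = 0) ∧
  (∀ v g, IsH1 M.Ω v g →
    IsWeakSol M.Ω M.k (hatA M R) (hat M R M.sig) 0 v g →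
    VanishesOn M.Ω (frontier M.Ω) v g →
    ∀ᵐ x ∂volume.restrict M.Ω, v x = 0)

/-- `G_* F_* A = A` and `G_* F_* Σ = Σ` in `Ω₃ \ closure Ω₂`; the condition on `Σ` is void
if `k = 0`. -/
def DoublyInvariant (M : Medium d) (R : Reflections d) : Prop :=
  (∀ᵐ x ∂volume.restrict (M.Ω₃ \ closure M.Ω₂), pushGFA M R x = M.A x) ∧
  (M.k ≠ 0 → ∀ᵐ x ∂volume.restrict (M.Ω₃ \ closure M.Ω₂), pushGF M R M.sig x = M.sig x)

/-! ### The compatibility condition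

Functions `φ ∈ C_c^∞(Ω₃)` see only the part `∂Ω₂` of the boundary of `Ω₃ \ closure Ω₂`, and
functions `φ ∈ C_c^∞(Ω \ closure Ω₂)` see only `∂Ω₃`, from both sides. -/

/-- The right-hand side `F_* f - f`. -/
def rhsU (M : Medium d) (R : Reflections d) (f : E d → ℂ) : E d → ℂ := fun x =>
  pushF M R f x - f x

/-- The Cauchy problem for `U ∈ H¹(Ω₃ \ closure Ω₂)`: `div (A∇U) + k²ΣU = F_* f - f`, with
`U = 0` and `A∇U·η = 0` on `∂Ω₂`. -/
structure SolvesU (M : Medium d) (R : Reflections d) (f : E d → ℂ)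
    (U : E d → ℂ) (gU : E d → Fin d → ℂ) : Prop where
  h1 : IsH1 (M.Ω₃ \ closure M.Ω₂) U gU
  eqn : IsWeakSol (M.Ω₃ \ closure M.Ω₂) M.k M.A M.sig (rhsU M R f) U gU
  dirichlet : ∀ i φ, IsTest M.Ω₃ φ → bdryTrace (M.Ω₃ \ closure M.Ω₂) U gU i φ = 0
  neumann : ∀ φ, IsTest M.Ω₃ φ →
    bdryFlux (M.Ω₃ \ closure M.Ω₂) M.k M.A M.sig (rhsU M R f) U gU φ = 0

/-- The transmission problem for `W ∈ H¹(Ω \ ∂Ω₃)`: `div (Â∇W) + k²Σ̂W = f̂` in `Ω \ ∂Ω₃`, `W = 0`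
on `∂Ω`, `[W] = -U` and `[Â∇W·η] = -A∇U·η` on `∂Ω₃`. Here `η` is the normal exterior to `Ω₃` and
`[·]` is the exterior value minus the interior value; the normal exterior to `Ω \ closure Ω₃` on
`∂Ω₃` is `-η`. -/
structure SolvesW (M : Medium d) (R : Reflections d) (f : E d → ℂ)
    (U : E d → ℂ) (gU : E d → Fin d → ℂ) (W : E d → ℂ) (gW : E d → Fin d → ℂ) : Prop where
  h1 : IsH1 (M.Ω \ frontier M.Ω₃) W gW
  eqn : IsWeakSol (M.Ω \ frontier M.Ω₃) M.k (hatA M R) (hat M R M.sig) (hat M R f) W gW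
  dirichlet : VanishesOn (M.Ω \ frontier M.Ω₃) (frontier M.Ω) W gW
  jump : ∀ i φ, IsTest (M.Ω \ closure M.Ω₂) φ →
    -bdryTrace (M.Ω \ closure M.Ω₃) W gW i φ - bdryTrace M.Ω₃ W gW i φ
      = -bdryTrace (M.Ω₃ \ closure M.Ω₂) U gU i φ
  flux_jump : ∀ φ, IsTest (M.Ω \ closure M.Ω₂) φ →
    -bdryFlux (M.Ω \ closure M.Ω₃) M.k (hatA M R) (hat M R M.sig) (hat M R f) W gW φ
        - bdryFlux M.Ω₃ M.k (hatA M R) (hat M R M.sig) (hat M R f) W gW φ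
      = -bdryFlux (M.Ω₃ \ closure M.Ω₂) M.k M.A M.sig (rhsU M R f) U gU φ

/-- The Cauchy problem for `V ∈ H¹(Ω₃ \ closure Ω₂)`: `div (A∇V) + k²ΣV = f`, with `V = W` and
`A∇V·η = A∇W·η` on `∂Ω₃`, where `W` is taken from outside `Ω₃`. -/
structure SolvesV (M : Medium d) (f : E d → ℂ)
    (W : E d → ℂ) (gW : E d → Fin d → ℂ) (V : E d → ℂ) (gV : E d → Fin d → ℂ) : Prop where
  h1 : IsH1 (M.Ω₃ \ closure M.Ω₂) V gV
  eqn : IsWeakSol (M.Ω₃ \ closure M.Ω₂) M.k M.A M.sig f V gV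
  dirichlet : ∀ i φ, IsTest (M.Ω \ closure M.Ω₂) φ →
    bdryTrace (M.Ω₃ \ closure M.Ω₂) V gV i φ = -bdryTrace (M.Ω \ closure M.Ω₃) W gW i φ
  neumann : ∀ φ, IsTest (M.Ω \ closure M.Ω₂) φ →
    bdryFlux (M.Ω₃ \ closure M.Ω₂) M.k M.A M.sig f V gV φ
      = -bdryFlux (M.Ω \ closure M.Ω₃) M.k M.A M.sig f W gW φ

/-- `f` is compatible with the system: there are solutions `U` and `V` of the two Cauchy problems,
where `W` is the unique solution of the transmission problem. -/
def Compatible (M : Medium d) (R : Reflections d) (f : E d → ℂ) : Prop :=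
  ∃ U gU V gV W gW, SolvesU M R f U gU ∧ SolvesW M R f U gU W gW ∧
    (∀ W' gW', SolvesW M R f U gU W' gW' → ∀ᵐ x ∂volume.restrict (M.Ω \ frontier M.Ω₃),
      W' x = W x) ∧
    SolvesV M f W gW V gV

/-! ### The two-dimensional annulus -/

/-- The inversion (Kelvin transform) in the circle of radius `r` centred at `0`. -/
def kelvin (r : ℝ) : E 2 → E 2 := fun x => (r ^ 2 / ‖x‖ ^ 2) • x

/-- `Ωᵢ = B_{rᵢ}` with `r₃ = r₂²/r₁`, `Ω = B_ρ`, `A = I`, `Σ = 1`, `k = 0`. -/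
def annulusMedium (r₁ r₂ ρ : ℝ) : Medium 2 where
  Ω₁ := Metric.ball 0 r₁
  Ω₂ := Metric.ball 0 r₂
  Ω₃ := Metric.ball 0 (r₂ ^ 2 / r₁)
  Ω := Metric.ball 0 ρ
  A := fun _ => 1
  sig := fun _ => 1
  k := 0

/-- `Ω₄ = ℝ²`, `F` and `G` the Kelvin transforms with respect to `∂B_{r₂}` and `∂B_{r₃}`. -/
def annulusReflections (r₁ r₂ : ℝ) : Reflections 2 where
  Ω₄ := univ
  x₁ := 0
  x₂ := 0
  F := kelvin r₂
  G := kelvin (r₂ ^ 2 / r₁)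

end NIM

end

noncomputable section

namespace NIM

variable {d : ℕ}

/-! ### Test functions -/

/-! The push-forwards `F_*` and `G_*F_*` evaluate `f` only at points of `Ω₃`, where `f` vanishes.
Hence `F_* f - f = 0` in the shell `Ω₃ \ closure Ω₂`, and `f̂ = f` almost everywhere
(`rhsU_ae_eq_zero`, `hat_ae_eq`). So `U = 0` is admissible, the transmission problem has no jumps,
and it is just the Dirichlet problem for `(Â, Σ̂)` in all of `Ω`. Its solution `W` has the same
trace and flux on both sides of `∂Ω₃`. Double invariance says that the equation for `W` in the shell
is the one with coefficients `(A, Σ)`, so `W` itself continues its exterior Cauchy data into the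
shell: `V = W` (`solvesV_of_isWeakSol`). Conversely, a solution of the jump-free transmission
problem solves the equation across `∂Ω₃` (`SolvesW.isWeakSol`), which gives uniqueness of `W`.

Existence of `W` follows from uniqueness by the Fredholm alternative (`exists_isWeakSol`), with
compactness from Rellich's theorem (`isCompactOperator_toFunL`). This needs `Â` bounded and
elliptic, which is not automatic: `G ∘ F` is a diffeomorphism of the open set `Ω₁` onto `Ω₃`, and
its Jacobian may degenerate at the boundary. On the compact set `closure Ω₂ ⊆ Ω₃` the Jacobian is
under control, and on the remaining shell `Â = A` by double invariance (`coeff_hat`).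

In the annulus, the derivative of a Kelvin transform is a multiple of a reflection. In the plane
such maps preserve the identity matrix under push-forward, so `Â = I` almost everywhere and both
homogeneous problems are Dirichlet problems for the Laplacian, settled by the energy identity
(`ae_eq_zero_of_laplace`). Since `VanishesOn` approximates by `H¹` functions vanishing near the
boundary and not by test functions, weak equations must first be extended to such functions, by
convolution (`integral_eq_zero_of_compact_support`). -/

lemma IsTest.mono {D D' : Set (E d)} {φ : E d → ℝ} (h : IsTest D φ) (hD : D ⊆ D') :
    IsTest D' φ :=
  ⟨h.1, h.2.1, h.2.2.trans hD⟩

lemma IsTest.mul_left {D : Set (E d)} {φ χ : E d → ℝ} (h : IsTest D φ) (hχ : ContDiff ℝ ∞ χ) :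
    IsTest D (fun x => χ x * φ x) :=
  ⟨hχ.mul h.1, h.2.1.mul_left, (closure_mono fun x hx => by
    simp only [Function.mem_support] at hx ⊢; exact right_ne_zero_of_mul hx).trans h.2.2⟩

lemma IsTest.mul_left_of_eq_zero {D N : Set (E d)} {φ χ : E d → ℝ} (h : IsTest D φ)
    (hχ : ContDiff ℝ ∞ χ) (hN : IsOpen N) (h0 : ∀ x ∈ N, χ x = 0) :
    IsTest (D \ N) (fun x => χ x * φ x) := by
  refine ⟨hχ.mul h.1, h.2.1.mul_left, fun x hx => ⟨(h.mul_left hχ).2.2 hx, fun hxN => ?_⟩⟩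
  rw [tsupport, mem_closure_iff] at hx
  obtain ⟨y, hyN, hy⟩ := hx N hN hxN
  exact hy (by simp [h0 y hyN])

lemma IsTest.mul_left_of_tsupport {D D' : Set (E d)} {φ χ : E d → ℝ} (h : IsTest D φ)
    (hχ : ContDiff ℝ ∞ χ) (hD : tsupport χ ⊆ D') :
    IsTest (D ∩ D') (fun x => χ x * φ x) := by
  refine ⟨hχ.mul h.1, h.2.1.mul_left, fun x hx => ⟨(h.mul_left hχ).2.2 hx, hD ?_⟩⟩
  refine closure_mono (fun y hy => ?_) hx
  simp only [Function.mem_support] at hy ⊢; exact left_ne_zero_of_mul hy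

/-- The value 1 is taken on a whole neighbourhood of `K`, so that `1 - χ` times a test function is
supported away from `K` and the derivatives of `χ` vanish on `K`. -/
lemma exists_cutoff {K O : Set (E d)} (hK : IsCompact K) (hO : IsOpen O) (hKO : K ⊆ O) :
    ∃ χ : E d → ℝ, IsTest O χ ∧ (∃ N, IsOpen N ∧ K ⊆ N ∧ ∀ x ∈ N, χ x = 1) ∧
      ∀ x, χ x ∈ Icc (0 : ℝ) 1 := by
  obtain ⟨L, hL, hKL, hLO⟩ := exists_compact_between hK hO hKO
  obtain ⟨f, hf1, hf0, hf⟩ := exists_contMDiffMap_one_nhds_of_subset_interior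
    (modelWithCornersSelf ℝ (E d)) (n := ⊤) hK.isClosed hKL
  have hsub : tsupport f ⊆ L := closure_minimal (fun x hx => by
    by_contra h; exact hx (hf0 x h)) hL.isClosed
  rw [Filter.Eventually, mem_nhdsSet_iff_exists] at hf1
  obtain ⟨N, hN, hKN, hN1⟩ := hf1
  exact ⟨f, ⟨f.contMDiff.contDiff, hL.of_isClosed_subset (isClosed_tsupport _) hsub,
    hsub.trans hLO⟩, ⟨N, hN, hKN, fun x hx => hN1 hx⟩, hf⟩

lemma IsTest.continuous {D : Set (E d)} {φ : E d → ℝ} (h : IsTest D φ) : Continuous φ :=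
  h.1.continuous

lemma contDiff_pd {φ : E d → ℝ} (h : ContDiff ℝ ∞ φ) (i : Fin d) : ContDiff ℝ ∞ (pd i φ) :=
  (h.fderiv_right (m := ∞) (by simp)).clm_apply contDiff_const

lemma tsupport_pd_subset {φ : E d → ℝ} (i : Fin d) : tsupport (pd i φ) ⊆ tsupport φ := by
  refine (closure_mono fun x hx => ?_).trans (tsupport_fderiv_subset ℝ)
  simp only [Function.mem_support, pd] at hx ⊢
  exact fun h => hx (by simp [h])

lemma IsTest.pd {D : Set (E d)} {φ : E d → ℝ} (h : IsTest D φ) (i : Fin d) : IsTest D (pd i φ) :=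
  ⟨contDiff_pd h.1 i, h.2.1.of_isClosed_subset (isClosed_tsupport _) (tsupport_pd_subset i),
    (tsupport_pd_subset i).trans h.2.2⟩

lemma IsTest.eq_zero {D : Set (E d)} {φ : E d → ℝ} (h : IsTest D φ) {x : E d} (hx : x ∉ D) :
    φ x = 0 :=
  image_eq_zero_of_notMem_tsupport fun h' => hx (h.2.2 h')

lemma pd_add {φ ψ : E d → ℝ} (hφ : ContDiff ℝ ∞ φ) (hψ : ContDiff ℝ ∞ ψ) (i : Fin d) (x : E d) :
    pd i (fun x => φ x + ψ x) x = pd i φ x + pd i ψ x := by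
  simp only [pd]
  rw [fderiv_fun_add (hφ.differentiable (by simp) x) (hψ.differentiable (by simp) x)]
  rfl

lemma pd_mul {φ ψ : E d → ℝ} (hφ : ContDiff ℝ ∞ φ) (hψ : ContDiff ℝ ∞ ψ) (i : Fin d) (x : E d) :
    pd i (fun x => φ x * ψ x) x = φ x * pd i ψ x + ψ x * pd i φ x := by
  simp only [pd]
  rw [fderiv_fun_mul (hφ.differentiable (by simp) x) (hψ.differentiable (by simp) x)]
  rfl

lemma IsTest.memLp {D : Set (E d)} {φ : E d → ℝ} (h : IsTest D φ) (p : ℝ≥0∞) (μ : Measure (E d))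
    [IsFiniteMeasureOnCompacts μ] :
    MemLp (fun x => (φ x : ℂ)) p μ :=
  (Complex.continuous_ofReal.comp h.continuous).memLp_of_hasCompactSupport
    (h.2.1.comp_left (g := fun t : ℝ => (t : ℂ)) rfl)

/-! ### Weak divergence pairings -/

/-- `∫_D (p·∇φ + s φ)`. -/
def green (D : Set (E d)) (p : E d → Fin d → ℂ) (s : E d → ℂ) (φ : E d → ℝ) : ℂ :=
  ∫ x in D, ((∑ i, p x i * (pd i φ x : ℂ)) + s x * (φ x : ℂ))

/-- The field `(p, s)` is square integrable in `D`. -/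
def IsL2 (D : Set (E d)) (p : E d → Fin d → ℂ) (s : E d → ℂ) : Prop :=
  (∀ i, MemLp (fun x => p x i) 2 (volume.restrict D)) ∧ MemLp s 2 (volume.restrict D)

/-- Trace and flux are one and the same functional, linear in the field `(p, s)`: the trace is the
case `p = u eᵢ`, `s = gᵢ`. Additivity, splitting and gluing therefore need to be proved only once,
for `green`. -/
lemma bdryTrace_eq_green (D : Set (E d)) (u : E d → ℂ) (g : E d → Fin d → ℂ) (i : Fin d)
    (φ : E d → ℝ) :
    bdryTrace D u g i φ = green D (fun x j => if j = i then u x else 0) (fun x => g x i) φ := by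
  simp [bdryTrace, green]

lemma bdryFlux_eq_green (D : Set (E d)) (k : ℝ) (B : E d → Matrix (Fin d) (Fin d) ℝ) (σ : E d → ℝ)
    (h : E d → ℂ) (u : E d → ℂ) (g : E d → Fin d → ℂ) (φ : E d → ℝ) :
    bdryFlux D k B σ h u g φ = green D (fun x i => ∑ j, (B x i j : ℂ) * g x j)
      (fun x => h x - (k : ℂ) ^ 2 * (σ x : ℂ) * u x) φ := rfl

lemma IsL2.mono {D D' : Set (E d)} {p : E d → Fin d → ℂ} {s : E d → ℂ} (h : IsL2 D' p s)
    (hD : D ⊆ D') : IsL2 D p s :=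
  ⟨fun i => (h.1 i).mono_measure (Measure.restrict_mono_set _ hD),
    h.2.mono_measure (Measure.restrict_mono_set _ hD)⟩

lemma IsL2.integrableOn {D O : Set (E d)} {p : E d → Fin d → ℂ} {s : E d → ℂ} {φ : E d → ℝ}
    (h : IsL2 D p s) (hφ : IsTest O φ) :
    IntegrableOn (fun x => (∑ i, p x i * (pd i φ x : ℂ)) + s x * (φ x : ℂ)) D := by
  refine Integrable.add (integrable_finsetSum _ fun i _ => ?_) ?_
  · exact (h.1 i).integrable_mul ((hφ.pd i).memLp 2 _)
  · exact h.2.integrable_mul (hφ.memLp 2 _)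

lemma green_add_test {D O O' : Set (E d)} {p : E d → Fin d → ℂ} {s : E d → ℂ} {φ ψ : E d → ℝ}
    (h : IsL2 D p s) (hφ : IsTest O φ) (hψ : IsTest O' ψ) :
    green D p s (fun x => φ x + ψ x) = green D p s φ + green D p s ψ := by
  rw [green, green, green, ← integral_add (h.integrableOn hφ) (h.integrableOn hψ)]
  congr 1; ext x
  simp only [pd_add hφ.1 hψ.1, Complex.ofReal_add, mul_add, Finset.sum_add_distrib]
  ring

lemma green_add {D O : Set (E d)} {p q : E d → Fin d → ℂ} {s t : E d → ℂ} {φ : E d → ℝ}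
    (h : IsL2 D p s) (h' : IsL2 D q t) (hφ : IsTest O φ) :
    green D (fun x i => p x i + q x i) (fun x => s x + t x) φ
      = green D p s φ + green D q t φ := by
  rw [green, green, green, ← integral_add (h.integrableOn hφ) (h'.integrableOn hφ)]
  congr 1; ext x
  simp only [add_mul, Finset.sum_add_distrib]
  ring

lemma green_sub {D O : Set (E d)} {p q : E d → Fin d → ℂ} {s t : E d → ℂ} {φ : E d → ℝ}
    (h : IsL2 D p s) (h' : IsL2 D q t) (hφ : IsTest O φ) :
    green D (fun x i => p x i - q x i) (fun x => s x - t x) φ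
      = green D p s φ - green D q t φ := by
  rw [green, green, green, ← integral_sub (h.integrableOn hφ) (h'.integrableOn hφ)]
  congr 1; ext x
  simp only [sub_mul, Finset.sum_sub_distrib]
  ring

lemma green_congr {D : Set (E d)} {p q : E d → Fin d → ℂ} {s t : E d → ℂ} {φ : E d → ℝ}
    (h : ∀ᵐ x ∂volume.restrict D, (∀ i, p x i = q x i) ∧ s x = t x) :
    green D p s φ = green D q t φ := by
  refine integral_congr_ae ?_
  filter_upwards [h] with x hx
  simp [hx.1, hx.2]

lemma green_congr_set {D D' : Set (E d)} {p : E d → Fin d → ℂ} {s : E d → ℂ} {φ : E d → ℝ}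
    (h : D =ᵐ[volume] D') : green D p s φ = green D' p s φ :=
  setIntegral_congr_set h

lemma green_union {D D' O : Set (E d)} {p : E d → Fin d → ℂ} {s : E d → ℂ} {φ : E d → ℝ}
    (hd : Disjoint D D') (hD' : MeasurableSet D') (h : IsL2 (D ∪ D') p s) (hφ : IsTest O φ) :
    green (D ∪ D') p s φ = green D p s φ + green D' p s φ :=
  setIntegral_union hd hD' ((h.integrableOn hφ).mono_set subset_union_left)
    ((h.integrableOn hφ).mono_set subset_union_right)

/-- A test function sees only the part of the domain that meets its support. This restricts
equations to subdomains, and lets functions supported off `closure Ω₂` ignore `∂Ω₂`. -/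
lemma green_eq_of_subset {D D' O : Set (E d)} {p : E d → Fin d → ℂ} {s : E d → ℂ} {φ : E d → ℝ}
    (hφ : IsTest O φ) (hD' : MeasurableSet D') (hD : D ⊆ D') (hO : D' ∩ O ⊆ D) :
    green D p s φ = green D' p s φ := by
  refine (setIntegral_eq_of_subset_of_forall_sdiff_eq_zero hD' hD fun x hx => ?_).symm
  have hxO : x ∉ O := fun h => hx.2 (hO ⟨hx.1, h⟩)
  simp [hφ.eq_zero hxO, (hφ.pd _).eq_zero hxO]

/-- The product rule moves a cutoff from the test function to the field. -/
lemma green_mul_test {D : Set (E d)} {p : E d → Fin d → ℂ} {s : E d → ℂ} {φ χ : E d → ℝ}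
    (hχ : ContDiff ℝ ∞ χ) (hφ : ContDiff ℝ ∞ φ) :
    green D p s (fun x => χ x * φ x) = green D (fun x i => χ x * p x i)
      (fun x => χ x * s x + ∑ i, p x i * pd i χ x) φ := by
  simp only [green, pd_mul hχ hφ]
  congr 1; ext x
  push_cast
  simp only [mul_add, Finset.sum_add_distrib, add_mul, Finset.sum_mul]
  have h1 : ∀ i, p x i * ((χ x : ℂ) * pd i φ x) = χ x * p x i * pd i φ x := fun i => by ring
  have h2 : ∀ i, p x i * ((φ x : ℂ) * pd i χ x) = p x i * pd i χ x * φ x := fun i => by ring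
  simp only [h1, h2]
  ring

/-! ### Sobolev functions -/

lemma IsH1.isL2 {D : Set (E d)} {u : E d → ℂ} {g : E d → Fin d → ℂ} (h : IsH1 D u g) (i : Fin d) :
    IsL2 D (fun x j => if j = i then u x else 0) (fun x => g x i) := by
  refine ⟨fun j => ?_, h.2.1 i⟩
  by_cases hj : j = i
  · simpa [hj] using h.1
  · simp [hj]

lemma IsH1.mono {D D' : Set (E d)} {u : E d → ℂ} {g : E d → Fin d → ℂ} (h : IsH1 D' u g)
    (hD' : MeasurableSet D') (hD : D ⊆ D') : IsH1 D u g := by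
  refine ⟨h.1.mono_measure (Measure.restrict_mono_set _ hD),
    fun i => (h.2.1 i).mono_measure (Measure.restrict_mono_set _ hD), fun i φ hφ => ?_⟩
  rw [bdryTrace_eq_green, green_eq_of_subset hφ hD' hD inter_subset_right, ← bdryTrace_eq_green]
  exact h.2.2 i φ (hφ.mono hD)

lemma IsWeakSol.mono {D D' : Set (E d)} {k : ℝ} {B : E d → Matrix (Fin d) (Fin d) ℝ} {σ : E d → ℝ}
    {h : E d → ℂ} {u : E d → ℂ} {g : E d → Fin d → ℂ} (hu : IsWeakSol D' k B σ h u g)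
    (hD' : MeasurableSet D') (hD : D ⊆ D') : IsWeakSol D k B σ h u g := by
  intro φ hφ
  rw [bdryFlux_eq_green, green_eq_of_subset hφ hD' hD inter_subset_right, ← bdryFlux_eq_green]
  exact hu φ (hφ.mono hD)

lemma IsH1.add {D : Set (E d)} {u v : E d → ℂ} {g h : E d → Fin d → ℂ} (hu : IsH1 D u g)
    (hv : IsH1 D v h) : IsH1 D (fun x => u x + v x) (fun x i => g x i + h x i) := by
  refine ⟨hu.1.add hv.1, fun i => (hu.2.1 i).add (hv.2.1 i), fun i φ hφ => ?_⟩
  have := green_add (hu.isL2 i) (hv.isL2 i) hφ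
  rw [← bdryTrace_eq_green, ← bdryTrace_eq_green, hu.2.2 i φ hφ, hv.2.2 i φ hφ, add_zero] at this
  rw [bdryTrace_eq_green]
  refine Eq.trans (congrArg (fun p => green D p _ φ) ?_) this
  ext x j; split_ifs <;> simp

lemma IsH1.sub {D : Set (E d)} {u v : E d → ℂ} {g h : E d → Fin d → ℂ} (hu : IsH1 D u g)
    (hv : IsH1 D v h) : IsH1 D (fun x => u x - v x) (fun x i => g x i - h x i) := by
  refine ⟨hu.1.sub hv.1, fun i => (hu.2.1 i).sub (hv.2.1 i), fun i φ hφ => ?_⟩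
  have := green_sub (hu.isL2 i) (hv.isL2 i) hφ
  rw [← bdryTrace_eq_green, ← bdryTrace_eq_green, hu.2.2 i φ hφ, hv.2.2 i φ hφ, sub_zero] at this
  rw [bdryTrace_eq_green]
  refine Eq.trans (congrArg (fun p => green D p _ φ) ?_) this
  ext x j; split_ifs <;> simp

lemma bddMul_memLp {μ : Measure (E d)} {c : E d → ℂ} {u : E d → ℂ} (hc : AEStronglyMeasurable c μ)
    {C : ℝ} (hC : ∀ᵐ x ∂μ, ‖c x‖ ≤ C) (hu : MemLp u 2 μ) : MemLp (fun x => c x * u x) 2 μ := by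
  refine (hu.const_mul (C : ℂ)).of_le (hc.mul hu.1) ?_
  filter_upwards [hC] with x hx
  have : (0 : ℝ) ≤ C := (norm_nonneg _).trans hx
  simp only [norm_mul, Complex.norm_real, Real.norm_eq_abs, abs_of_nonneg this]
  gcongr

lemma IsTest.bounded {O : Set (E d)} {φ : E d → ℝ} (h : IsTest O φ) :
    ∃ C : ℝ, 0 ≤ C ∧ ∀ x, |φ x| ≤ C := by
  obtain ⟨C, hC⟩ := h.continuous.bounded_above_of_compact_support h.2.1
  exact ⟨C, (norm_nonneg _).trans (hC 0), hC⟩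

/-- A function that is `H¹` only off a null set, such as an interface where it may jump, becomes
`H¹` across it after multiplication by a smooth factor that removes the interface from the support
of every test function; this is the content of `ht`. -/
lemma IsH1.mul_extend {D D' : Set (E d)} {w : E d → ℂ} {q : E d → Fin d → ℂ} {ζ : E d → ℝ} {C : ℝ}
    (hw : IsH1 D w q) (hD : D =ᵐ[volume] D') (hζ : ContDiff ℝ ∞ ζ)
    (hC : ∀ x, |ζ x| ≤ C) (hC' : ∀ i x, |pd i ζ x| ≤ C)
    (ht : ∀ φ, IsTest D' φ → IsTest D (fun x => ζ x * φ x)) :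
    IsH1 D' (fun x => ζ x * w x) (fun x i => ζ x * q x i + w x * pd i ζ x) := by
  have hμ : volume.restrict D' = volume.restrict D := Measure.restrict_congr_set hD.symm
  have h1 : MemLp (fun x => ζ x * w x) 2 (volume.restrict D') := hμ ▸
    bddMul_memLp (Complex.continuous_ofReal.comp hζ.continuous).aestronglyMeasurable
      (.of_forall fun x => by simpa using hC x) hw.1
  refine ⟨h1, fun i => ?_, fun i φ hφ => ?_⟩
  · rw [hμ]
    refine (bddMul_memLp (Complex.continuous_ofReal.comp hζ.continuous).aestronglyMeasurable
      (.of_forall fun x => by simpa using hC x) (hw.2.1 i)).add ?_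
    simp_rw [mul_comm (w _)]
    exact bddMul_memLp
      (Complex.continuous_ofReal.comp (contDiff_pd hζ i).continuous).aestronglyMeasurable
      (.of_forall fun x => by simpa using hC' i x) hw.1
  · have := hw.2.2 i _ (ht φ hφ)
    rw [bdryTrace_eq_green, green_mul_test hζ hφ.1, green_congr_set hD] at this
    rw [bdryTrace_eq_green]
    refine Eq.trans (green_congr (.of_forall fun x => ⟨fun j => ?_, ?_⟩)) this
    · split_ifs <;> simp
    · simp

end NIM

end

noncomputable section

namespace NIM

variable {d : ℕ}

/-! ### Compactness: translation estimate and averages -/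

lemma lintegral_sq_le {α : Type*} [MeasurableSpace α] (μ : Measure α) {F : α → ℝ≥0∞}
    (hF : AEMeasurable F μ) : (∫⁻ x, F x ∂μ) ^ 2 ≤ μ univ * ∫⁻ x, F x ^ 2 ∂μ := by
  have h := ENNReal.lintegral_mul_le_Lp_mul_Lq μ Real.HolderConjugate.two_two
    (aemeasurable_const (b := (1 : ℝ≥0∞))) hF
  simp only [Pi.mul_apply, one_mul, ENNReal.one_rpow, lintegral_const] at h
  have h2 : ∀ a : ℝ≥0∞, (a ^ (1 / 2 : ℝ)) ^ 2 = a := fun a => by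
    rw [← ENNReal.rpow_natCast, ← ENNReal.rpow_mul]; norm_num
  calc (∫⁻ x, F x ∂μ) ^ 2 ≤ _ := pow_le_pow_left' h 2
    _ = _ := by rw [mul_pow, h2, h2]; simp

/-- The difference is the integral of the derivative along the segment from `x` to `x + h`.
Cauchy–Schwarz in the parameter, Tonelli and translation invariance of the volume give the bound. -/
lemma lintegral_translate_sub_sq_le {φ : E d → ℂ} (hφ : ContDiff ℝ 1 φ) (h : E d) :
    ∫⁻ x, ‖φ x - φ (x + h)‖ₑ ^ 2 ≤ ‖h‖ₑ ^ 2 * ∫⁻ x, ‖fderiv ℝ φ x‖ₑ ^ 2 := by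
  have hcont : Continuous (fderiv ℝ φ) := hφ.continuous_fderiv (by simp)
  have key : ∀ x, ‖φ x - φ (x + h)‖ₑ ^ 2 ≤
      ∫⁻ t in Ioc (0 : ℝ) 1, ‖h‖ₑ ^ 2 * ‖fderiv ℝ φ (x + t • h)‖ₑ ^ 2 := by
    intro x
    have hc : Continuous fun t : ℝ => fderiv ℝ φ (x + t • h) := hcont.comp (by fun_prop)
    have hd : ∀ t ∈ uIcc (0 : ℝ) 1,
        HasDerivAt (fun t : ℝ => φ (x + t • h)) (fderiv ℝ φ (x + t • h) h) t := by
      intro t _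
      have h1 : HasDerivAt (fun t : ℝ => x + t • h) h t := by
        simpa using ((hasDerivAt_id t).smul_const h).const_add x
      exact ((hφ.differentiable (by simp) _).hasFDerivAt).comp_hasDerivAt t h1
    have hint := intervalIntegral.integral_eq_sub_of_hasDerivAt hd
      ((hc.clm_apply continuous_const).intervalIntegrable _ _)
    simp only [one_smul, zero_smul, add_zero] at hint
    rw [intervalIntegral.integral_of_le zero_le_one] at hint
    have hle : ‖φ x - φ (x + h)‖ₑ ≤ ∫⁻ t in Ioc (0 : ℝ) 1, ‖h‖ₑ * ‖fderiv ℝ φ (x + t • h)‖ₑ := by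
      rw [← enorm_neg, neg_sub, ← hint]
      refine (enorm_integral_le_lintegral_enorm _).trans (lintegral_mono fun t => ?_)
      rw [mul_comm]
      exact (fderiv ℝ φ (x + t • h)).le_opENorm h
    calc ‖φ x - φ (x + h)‖ₑ ^ 2 ≤ _ := pow_le_pow_left' hle 2
      _ ≤ _ := lintegral_sq_le _ (by fun_prop)
      _ = _ := by simp [mul_pow]
  calc ∫⁻ x, ‖φ x - φ (x + h)‖ₑ ^ 2
      ≤ ∫⁻ x, ∫⁻ t in Ioc (0 : ℝ) 1, ‖h‖ₑ ^ 2 * ‖fderiv ℝ φ (x + t • h)‖ₑ ^ 2 := lintegral_mono key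
    _ = ∫⁻ t in Ioc (0 : ℝ) 1, ∫⁻ x, ‖h‖ₑ ^ 2 * ‖fderiv ℝ φ (x + t • h)‖ₑ ^ 2 := by
        refine lintegral_lintegral_swap (Continuous.aemeasurable ?_)
        refine ENNReal.continuous_const_mul (by simp) |>.comp ?_
        refine (ENNReal.continuous_pow 2).comp (continuous_enorm.comp (hcont.comp ?_))
        fun_prop
    _ = ∫⁻ t in Ioc (0 : ℝ) 1, ‖h‖ₑ ^ 2 * ∫⁻ x, ‖fderiv ℝ φ x‖ₑ ^ 2 := by
        refine lintegral_congr fun t => ?_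
        rw [lintegral_add_right_eq_self (fun x => ‖h‖ₑ ^ 2 * ‖fderiv ℝ φ x‖ₑ ^ 2),
          lintegral_const_mul' _ _ (by simp)]
    _ = _ := by simp

/-- Cauchy–Schwarz bounds the left side by a mean of squared differences over `B(p x, δ) ⊆ B(x,
2δ)`, and the translation estimate applies to each shift `|h| < 2δ`. The factor `2 ^ d` is the ratio
of the volumes of the two balls. The centre is `p x` rather than `x` so that later only finitely
many averages occur. -/
lemma lintegral_sub_average_sq_le {φ : E d → ℂ} (hφ : ContDiff ℝ 1 φ) (hc : HasCompactSupport φ)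
    {Ω : Set (E d)} {p : E d → E d} {δ : ℝ} (hδ : 0 < δ) (hp : ∀ x ∈ Ω, dist (p x) x < δ)
    (hΩ : MeasurableSet Ω) :
    ∫⁻ x in Ω, ‖φ x - ⨍ y in Metric.ball (p x) δ, φ y‖ₑ ^ 2
      ≤ ENNReal.ofReal (2 ^ d * (2 * δ) ^ 2) * ∫⁻ x, ‖fderiv ℝ φ x‖ₑ ^ 2 := by
  set b : ℝ≥0∞ := volume (Metric.ball (0 : E d) δ) with hb
  have hb0 : b ≠ 0 := (Metric.measure_ball_pos _ _ hδ).ne'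
  have hbt : b ≠ ⊤ := measure_ball_lt_top.ne
  have hφi : Integrable φ := hφ.continuous.integrable_of_hasCompactSupport hc
  have key : ∀ x ∈ Ω, ‖φ x - ⨍ y in Metric.ball (p x) δ, φ y‖ₑ ^ 2 ≤
      b⁻¹ * ∫⁻ h in Metric.ball (0 : E d) (2 * δ), ‖φ x - φ (x + h)‖ₑ ^ 2 := by
    intro x hx
    have hvol : volume (Metric.ball (p x) δ) = b := Measure.addHaar_ball_center _ _ _
    have hbr : (volume.restrict (Metric.ball (p x) δ)).real univ ≠ 0 := by
      simp [measureReal_def, hvol, hb0, hbt, ENNReal.toReal_eq_zero_iff]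
    have h1 : φ x - ⨍ y in Metric.ball (p x) δ, φ y
        = ⨍ y in Metric.ball (p x) δ, (φ x - φ y) := by
      have : IsFiniteMeasure (volume.restrict (Metric.ball (p x) δ)) :=
        ⟨by simp [hvol, hbt.lt_top]⟩
      rw [average_eq, average_eq, integral_sub (integrable_const _) hφi.restrict, integral_const,
        smul_sub, smul_smul, inv_mul_cancel₀ hbr, one_smul]
    have h2 : ‖φ x - ⨍ y in Metric.ball (p x) δ, φ y‖ₑ
        ≤ b⁻¹ * ∫⁻ y in Metric.ball (p x) δ, ‖φ x - φ y‖ₑ := by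
      rw [h1, average_eq, enorm_smul]
      gcongr
      · rw [enorm_inv hbr, measureReal_def, Measure.restrict_apply_univ, hvol,
          Real.enorm_eq_ofReal ENNReal.toReal_nonneg, ENNReal.ofReal_toReal hbt]
      · exact enorm_integral_le_lintegral_enorm _
    calc ‖φ x - ⨍ y in Metric.ball (p x) δ, φ y‖ₑ ^ 2 ≤ _ := pow_le_pow_left' h2 2
      _ = b⁻¹ ^ 2 * (∫⁻ y in Metric.ball (p x) δ, ‖φ x - φ y‖ₑ) ^ 2 := by rw [mul_pow]
      _ ≤ b⁻¹ ^ 2 * (b * ∫⁻ y in Metric.ball (p x) δ, ‖φ x - φ y‖ₑ ^ 2) := by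
          gcongr
          refine (lintegral_sq_le _ ?_).trans_eq (by simp [hvol])
          exact ((continuous_const.sub hφ.continuous).enorm).aemeasurable
      _ = b⁻¹ * ∫⁻ y in Metric.ball (p x) δ, ‖φ x - φ y‖ₑ ^ 2 := by
          rw [← mul_assoc, pow_two, mul_assoc b⁻¹, ENNReal.inv_mul_cancel hb0 hbt, mul_one]
      _ ≤ b⁻¹ * ∫⁻ y in Metric.ball x (2 * δ), ‖φ x - φ y‖ₑ ^ 2 := by
          gcongr
          refine Metric.ball_subset_ball' ?_
          linarith [hp x hx]
      _ = _ := by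
          congr 1
          have := (measurePreserving_add_left (volume : Measure (E d)) x).setLIntegral_comp_preimage
            (f := fun y => ‖φ x - φ y‖ₑ ^ 2) (s := Metric.ball x (2 * δ)) measurableSet_ball
            (((continuous_const.sub hφ.continuous).enorm).measurable.pow_const 2)
          rw [← this]
          simp
  have hm : Continuous fun z : E d × E d => ‖φ z.1 - φ (z.1 + z.2)‖ₑ ^ 2 := by
    refine (ENNReal.continuous_pow 2).comp (continuous_enorm.comp ?_)
    have := hφ.continuous
    fun_prop
  calc ∫⁻ x in Ω, ‖φ x - ⨍ y in Metric.ball (p x) δ, φ y‖ₑ ^ 2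
      ≤ ∫⁻ x in Ω, b⁻¹ * ∫⁻ h in Metric.ball (0 : E d) (2 * δ), ‖φ x - φ (x + h)‖ₑ ^ 2 :=
        setLIntegral_mono' hΩ key
    _ ≤ ∫⁻ x, b⁻¹ * ∫⁻ h in Metric.ball (0 : E d) (2 * δ), ‖φ x - φ (x + h)‖ₑ ^ 2 :=
        setLIntegral_le_lintegral _ _
    _ = b⁻¹ * ∫⁻ x, ∫⁻ h in Metric.ball (0 : E d) (2 * δ), ‖φ x - φ (x + h)‖ₑ ^ 2 :=
        lintegral_const_mul' _ _ (ENNReal.inv_ne_top.2 hb0)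
    _ = b⁻¹ * ∫⁻ h in Metric.ball (0 : E d) (2 * δ), ∫⁻ x, ‖φ x - φ (x + h)‖ₑ ^ 2 := by
        rw [lintegral_lintegral_swap hm.aemeasurable]
    _ ≤ b⁻¹ * ∫⁻ h in Metric.ball (0 : E d) (2 * δ),
          ENNReal.ofReal (2 * δ) ^ 2 * ∫⁻ x, ‖fderiv ℝ φ x‖ₑ ^ 2 := by
        refine mul_le_mul_right (setLIntegral_mono' measurableSet_ball fun h hh => ?_) _
        refine (lintegral_translate_sub_sq_le hφ h).trans ?_
        gcongr
        rw [← ofReal_norm]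
        refine ENNReal.ofReal_le_ofReal ?_
        rw [mem_ball_zero_iff] at hh
        exact hh.le
    _ = _ := by
        have e : ENNReal.ofReal (2 ^ d * (2 * δ) ^ 2)
            = ENNReal.ofReal (2 ^ d) * ENNReal.ofReal (2 * δ) ^ 2 := by
          rw [ENNReal.ofReal_mul (by positivity), ENNReal.ofReal_pow (p := 2 * δ) (by positivity)]
        rw [setLIntegral_const, Measure.addHaar_ball_mul_of_pos _ _ zero_lt_two, ← hb, e]
        simp only [finrank_euclideanSpace, Fintype.card_fin]
        rw [show ∀ a c e f : ℝ≥0∞, a * (c * e * (f * b)) = (a * b) * (f * c * e) by intros; ring,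
          ENNReal.inv_mul_cancel hb0 hbt, one_mul]

end NIM

end

/-! ### Finite-rank approximation by averages over a finite net. -/

noncomputable section

namespace NIM

variable {d : ℕ}

/-- Total boundedness: finitely many terms of a dense sequence form a `δ`-net of `Ω`, and the
nearest-point map to them is a simple function, hence measurable. -/
lemma exists_simpleFunc_dist_lt {Ω : Set (E d)} (hΩ : Bornology.IsBounded Ω) {δ : ℝ} (hδ : 0 < δ) :
    ∃ p : SimpleFunc (E d) (E d), ∀ x ∈ Ω, dist (p x) x < δ := by
  obtain ⟨t, ht⟩ := hΩ.isCompact_closure.elim_finite_subcover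
    (fun n : ℕ => Metric.ball (TopologicalSpace.denseSeq (E d) n) δ) (fun _ => Metric.isOpen_ball)
    (fun x _ => by
      obtain ⟨n, hn⟩ := (TopologicalSpace.denseRange_denseSeq (E d)).exists_dist_lt x hδ
      exact mem_iUnion.2 ⟨n, hn⟩)
  refine ⟨SimpleFunc.nearestPt (TopologicalSpace.denseSeq (E d)) (t.sup id), fun x hx => ?_⟩
  obtain ⟨n, hn, hxn⟩ := mem_iUnion₂.1 (ht (subset_closure hx))
  have h1 := SimpleFunc.edist_nearestPt_le (TopologicalSpace.denseSeq (E d)) x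
    (Finset.le_sup (f := id) hn)
  rw [edist_dist, edist_dist, ENNReal.ofReal_le_ofReal_iff dist_nonneg] at h1
  refine h1.trans_lt ?_
  rw [dist_comm]; exact hxn

lemma eLpNorm_two_sq {α F : Type*} [MeasurableSpace α] [NormedAddCommGroup F] (μ : Measure α)
    (f : α → F) : eLpNorm f 2 μ ^ 2 = ∫⁻ x, ‖f x‖ₑ ^ 2 ∂μ := by
  rw [eLpNorm_eq_lintegral_rpow_enorm_toReal (by simp) (by simp), ← ENNReal.rpow_natCast,
    ← ENNReal.rpow_mul]
  simp

lemma memLp_simple_comp {μ : Measure (E d)} [IsFiniteMeasure μ] (p : SimpleFunc (E d) (E d))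
    (F : p.range → ℂ) : MemLp (fun x => F ⟨p x, p.mem_range_self x⟩) 2 μ := by
  have hm : Measurable fun x => (⟨p x, p.mem_range_self x⟩ : p.range) := p.measurable.subtype_mk
  refine MemLp.of_bound ((measurable_of_finite F).comp hm).aestronglyMeasurable
    (∑ q, ‖F q‖) (.of_forall fun x => ?_)
  exact Finset.single_le_sum (f := fun q => ‖F q‖) (fun _ _ => norm_nonneg _) (Finset.mem_univ _)

/-- Composition of functions on the finite range of a simple function with it, in `L²`. -/
def simpleCompLp {μ : Measure (E d)} [IsFiniteMeasure μ] (p : SimpleFunc (E d) (E d)) :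
    (p.range → ℂ) →ₗ[ℂ] Lp ℂ 2 μ where
  toFun F := (memLp_simple_comp p F).toLp
  map_add' _ _ := rfl
  map_smul' _ _ := rfl

/-- `P` replaces a function by its averages over balls centred at the finitely many net points. It
factors through a finite-dimensional space, hence is compact, and it is defined on all of `L²`,
although it is close to the identity only where the gradient is controlled. -/
lemma exists_compact_approx {Ω : Set (E d)} (hb : Bornology.IsBounded Ω) (hΩ : MeasurableSet Ω)
    {ε : ℝ} (hε : 0 < ε) :
    ∃ P : Lp ℂ 2 (volume.restrict Ω) →L[ℂ] Lp ℂ 2 (volume.restrict Ω), IsCompactOperator P ∧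
      ∀ (φ : E d → ℂ) (u : Lp ℂ 2 (volume.restrict Ω)), ContDiff ℝ 1 φ → HasCompactSupport φ →
        (∀ x ∉ Ω, φ x = 0) → u =ᵐ[volume.restrict Ω] φ →
        ‖u - P u‖ₑ ^ 2 ≤ ENNReal.ofReal ε ^ 2 * ∫⁻ x, ‖fderiv ℝ φ x‖ₑ ^ 2 := by
  -- With this radius the constant `2 ^ d * (2 * δ) ^ 2` of the averaging estimate is `ε ^ 2 / 2 ^
  -- d`.
  set δ : ℝ := ε / (2 * 2 ^ d) with hδdef
  have hδ : 0 < δ := by positivity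
  have hδε : 2 ^ d * (2 * δ) ^ 2 ≤ ε ^ 2 := by
    have h1 : (1 : ℝ) ≤ 2 ^ d := one_le_pow₀ (by norm_num)
    have : 2 ^ d * (2 * δ) ^ 2 = ε ^ 2 / 2 ^ d := by rw [hδdef]; field_simp
    rw [this]
    exact div_le_self (by positivity) h1
  have : IsFiniteMeasure (volume.restrict Ω) := ⟨by simpa using hb.measure_lt_top⟩
  obtain ⟨p, hp⟩ := exists_simpleFunc_dist_lt hb hδ
  -- The averages are normalised by the volume of the full ball, even where it leaves `Ω`; for
  -- functions vanishing off `Ω` they are the true averages over the ball.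
  let c : Lp ℂ 2 (volume.restrict Ω) →L[ℂ] (p.range → ℂ) := ContinuousLinearMap.pi fun q =>
    (((volume.restrict (Metric.ball q.1 δ)).real univ)⁻¹ : ℂ) •
      innerSL ℂ (indicatorConstLp 2 (μ := volume.restrict Ω)
        (measurableSet_ball (x := q.1) (ε := δ)) (measure_ne_top _ _) (1 : ℂ))
  have hc : ∀ u q, c u q = (((volume.restrict (Metric.ball q.1 δ)).real univ)⁻¹ : ℂ) *
      ∫ x in Metric.ball q.1 δ, u x ∂(volume.restrict Ω) := fun u q => by
    simp only [c, ContinuousLinearMap.coe_pi', smul_apply, innerSL_apply_apply,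
      smul_eq_mul]
    rw [L2.inner_indicatorConstLp_one]
  refine ⟨(LinearMap.toContinuousLinearMap (simpleCompLp p)).comp c,
    (isCompactOperator_of_locallyCompactSpace_rng
    (LinearMap.toContinuousLinearMap (simpleCompLp p))).comp_clm c, ?_⟩
  intro φ u hφ hφc hφ0 hu
  have hcu : ∀ q, c u q = ⨍ y in Metric.ball q.1 δ, φ y := by
    intro q
    rw [hc, average_eq, Complex.real_smul, Complex.ofReal_inv]
    congr 1
    rw [integral_congr_ae (ae_restrict_of_ae hu), Measure.restrict_restrict measurableSet_ball,
      setIntegral_eq_of_subset_of_forall_sdiff_eq_zero measurableSet_ball inter_subset_left]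
    intro x hx
    exact hφ0 x fun h => hx.2 ⟨hx.1, h⟩
  have hPu : (simpleCompLp (μ := volume.restrict Ω) p (c u)) =ᵐ[volume.restrict Ω]
      fun x => ⨍ y in Metric.ball (p x) δ, φ y := by
    refine (memLp_simple_comp p (c u)).coeFn_toLp.trans (.of_forall fun x => ?_)
    exact hcu _
  rw [Lp.enorm_def, eLpNorm_two_sq]
  calc ∫⁻ x in Ω, ‖(u - simpleCompLp (μ := volume.restrict Ω) p (c u) : Lp ℂ 2 _) x‖ₑ ^ 2
      = ∫⁻ x in Ω, ‖φ x - ⨍ y in Metric.ball (p x) δ, φ y‖ₑ ^ 2 := by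
        refine lintegral_congr_ae ?_
        filter_upwards [Lp.coeFn_sub u (simpleCompLp p (c u)), hu, hPu] with x h1 h2 h3
        rw [h1, Pi.sub_apply, h2, h3]
    _ ≤ _ := lintegral_sub_average_sq_le hφ hφc hδ hp hΩ
    _ ≤ _ := by
        gcongr
        rw [← ENNReal.ofReal_pow hε.le]
        exact ENNReal.ofReal_le_ofReal hδε

end NIM

end

noncomputable section

namespace NIM

variable {d : ℕ}

/-! ### The space `H¹₀` -/

/-- Square integrable functions with `1 + d` components: a function and its gradient. -/
abbrev Jet (Ω : Set (E d)) := PiLp 2 fun _ : Option (Fin d) => Lp ℂ 2 (volume.restrict Ω)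

/-- A function and its gradient. -/
def jetOf (φ : E d → ℂ) : Option (Fin d) → E d → ℂ
  | none => φ
  | some i => fun x => fderiv ℝ φ x (EuclideanSpace.single i 1)

lemma jetOf_add {φ ψ : E d → ℂ} (hφ : ContDiff ℝ ∞ φ) (hψ : ContDiff ℝ ∞ ψ) (a : Option (Fin d)) :
    jetOf (φ + ψ) a = jetOf φ a + jetOf ψ a := by
  cases a with
  | none => rfl
  | some i =>
    ext x
    simp only [jetOf, Pi.add_apply]
    rw [fderiv_add (hφ.differentiable (by simp) x) (hψ.differentiable (by simp) x)]
    rfl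

lemma jetOf_smul {φ : E d → ℂ} (hφ : ContDiff ℝ ∞ φ) (c : ℂ) (a : Option (Fin d)) :
    jetOf (c • φ) a = c • jetOf φ a := by
  cases a with
  | none => rfl
  | some i =>
    ext x
    simp only [jetOf, Pi.smul_apply]
    rw [fderiv_const_smul (hφ.differentiable (by simp) x)]
    rfl

lemma contDiff_jetOf {φ : E d → ℂ} (hφ : ContDiff ℝ ∞ φ) (a : Option (Fin d)) :
    ContDiff ℝ ∞ (jetOf φ a) := by
  cases a with
  | none => exact hφ
  | some i => exact (hφ.fderiv_right (m := ∞) (by simp)).clm_apply contDiff_const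

lemma tsupport_jetOf_subset (φ : E d → ℂ) (a : Option (Fin d)) :
    tsupport (jetOf φ a) ⊆ tsupport φ := by
  cases a with
  | none => exact subset_rfl
  | some i =>
    refine (closure_mono fun x hx => ?_).trans (tsupport_fderiv_subset ℝ)
    simp only [Function.mem_support, jetOf] at hx ⊢
    exact fun h => hx (by simp [h])

lemma memLp_jetOf {φ : E d → ℂ} (hφ : ContDiff ℝ ∞ φ) (hc : HasCompactSupport φ)
    (a : Option (Fin d)) (μ : Measure (E d)) [IsFiniteMeasureOnCompacts μ] :
    MemLp (jetOf φ a) 2 μ :=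
  (contDiff_jetOf hφ a).continuous.memLp_of_hasCompactSupport
    (hc.of_isClosed_subset (isClosed_tsupport _) (tsupport_jetOf_subset φ a))

/-- The jets of complex test functions. -/
def testJets (Ω : Set (E d)) : Submodule ℂ (Jet Ω) where
  carrier := {z | ∃ φ : E d → ℂ, ContDiff ℝ ∞ φ ∧ HasCompactSupport φ ∧ tsupport φ ⊆ Ω ∧
    ∀ a, z a =ᵐ[volume.restrict Ω] jetOf φ a}
  add_mem' := by
    rintro z w ⟨φ, h1, h2, h3, h4⟩ ⟨ψ, k1, k2, k3, k4⟩
    refine ⟨φ + ψ, h1.add k1, h2.add k2, (tsupport_add φ ψ).trans (union_subset h3 k3), fun a => ?_⟩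
    rw [jetOf_add h1 k1]
    exact (Lp.coeFn_add (z a) (w a)).trans ((h4 a).add (k4 a))
  zero_mem' := by
    refine ⟨0, contDiff_const, HasCompactSupport.zero, by simp [tsupport], fun a => ?_⟩
    refine (Lp.coeFn_zero ℂ 2 (volume.restrict Ω)).trans (.of_forall fun x => ?_)
    cases a <;> simp [jetOf]
  smul_mem' := by
    rintro c z ⟨φ, h1, h2, h3, h4⟩
    refine ⟨c • φ, contDiff_const.smul h1, h2.smul_left (f := fun _ => c), ?_, fun a => ?_⟩
    · exact (closure_mono (Function.support_const_smul_subset c φ)).trans h3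
    · rw [jetOf_smul h1]
      exact (Lp.coeFn_smul c (z a)).trans ((h4 a).const_smul c)

/-- `H¹₀(Ω)`, as a space of jets. -/
def sobolevZero (Ω : Set (E d)) : Submodule ℂ (Jet Ω) := (testJets Ω).topologicalClosure

instance (Ω : Set (E d)) : CompleteSpace (sobolevZero Ω) :=
  (Submodule.isClosed_topologicalClosure _).completeSpace_coe

/-- Closed conditions pass from jets of test functions to all of `H¹₀` by density. -/
lemma sobolevZero_induction {Ω : Set (E d)} {P : Jet Ω → Prop} (hP : IsClosed {z | P z})
    (h : ∀ z ∈ testJets Ω, P z) {z : Jet Ω} (hz : z ∈ sobolevZero Ω) : P z :=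
  closure_minimal (s := (testJets Ω : Set (Jet Ω))) h hP hz

lemma IsTest.ofReal {Ω : Set (E d)} {φ : E d → ℝ} (h : IsTest Ω φ) :
    ContDiff ℝ ∞ (fun x => (φ x : ℂ)) ∧ HasCompactSupport (fun x => (φ x : ℂ)) ∧
      tsupport (fun x => (φ x : ℂ)) ⊆ Ω := by
  refine ⟨Complex.ofRealCLM.contDiff.comp h.1, h.2.1.comp_left (g := fun t : ℝ => (t : ℂ)) rfl, ?_⟩
  refine (closure_mono fun x hx => ?_).trans h.2.2
  simpa using hx

lemma jetOf_ofReal {φ : E d → ℝ} (h : ContDiff ℝ ∞ φ) (i : Fin d) :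
    jetOf (fun x => (φ x : ℂ)) (some i) = fun x => (pd i φ x : ℂ) := by
  ext x
  simp only [jetOf, pd]
  have := Complex.ofRealCLM.hasFDerivAt.comp x (h.differentiable (by simp) x).hasFDerivAt
  have h2 : fderiv ℝ (fun x => (φ x : ℂ)) x = Complex.ofRealCLM.comp (fderiv ℝ φ x) := this.fderiv
  rw [h2]; rfl

/-- The jet of a real test function. -/
def testJet {Ω : Set (E d)} {φ : E d → ℝ} (h : IsTest Ω φ) : Jet Ω :=
  WithLp.toLp 2 fun a => (memLp_jetOf h.ofReal.1 h.ofReal.2.1 a (volume.restrict Ω)).toLp _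

lemma testJet_ae {Ω : Set (E d)} {φ : E d → ℝ} (h : IsTest Ω φ) (a : Option (Fin d)) :
    testJet h a =ᵐ[volume.restrict Ω] jetOf (fun x => (φ x : ℂ)) a :=
  (memLp_jetOf h.ofReal.1 h.ofReal.2.1 a (volume.restrict Ω)).coeFn_toLp

lemma testJet_none {Ω : Set (E d)} {φ : E d → ℝ} (h : IsTest Ω φ) :
    testJet h none =ᵐ[volume.restrict Ω] fun x => (φ x : ℂ) :=
  testJet_ae h none

lemma testJet_some {Ω : Set (E d)} {φ : E d → ℝ} (h : IsTest Ω φ) (i : Fin d) :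
    testJet h (some i) =ᵐ[volume.restrict Ω] fun x => (pd i φ x : ℂ) := by
  have := testJet_ae h (some i)
  rwa [jetOf_ofReal h.1] at this

lemma testJet_mem {Ω : Set (E d)} {φ : E d → ℝ} (h : IsTest Ω φ) :
    testJet h ∈ sobolevZero Ω :=
  Submodule.le_topologicalClosure _
    ⟨_, h.ofReal.1, h.ofReal.2.1, h.ofReal.2.2, testJet_ae h⟩

/-- As `φ` is real, the conjugation in the inner product disappears; thus Hilbert space identities
become the bilinear pairings of `bdryTrace` and `bdryFlux`. -/
lemma inner_testJet_none {Ω : Set (E d)} {φ : E d → ℝ} (h : IsTest Ω φ)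
    (u : Lp ℂ 2 (volume.restrict Ω)) :
    inner ℂ (testJet h none) u = ∫ x in Ω, u x * (φ x : ℂ) := by
  rw [L2.inner_def]
  refine integral_congr_ae ?_
  filter_upwards [testJet_none h] with x hx
  simp [hx]

lemma inner_testJet_some {Ω : Set (E d)} {φ : E d → ℝ} (h : IsTest Ω φ) (i : Fin d)
    (u : Lp ℂ 2 (volume.restrict Ω)) :
    inner ℂ (testJet h (some i)) u = ∫ x in Ω, u x * (pd i φ x : ℂ) := by
  rw [L2.inner_def]
  refine integral_congr_ae ?_
  filter_upwards [testJet_some h i] with x hx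
  simp [hx]

lemma bdryTrace_eq_inner {Ω : Set (E d)} {φ : E d → ℝ} (h : IsTest Ω φ) (i : Fin d)
    (u : Lp ℂ 2 (volume.restrict Ω)) (g : E d → Fin d → ℂ) (gi : Lp ℂ 2 (volume.restrict Ω))
    (hg : ∀ x, g x i = gi x) :
    bdryTrace Ω u g i φ = inner ℂ (testJet h (some i)) u + inner ℂ (testJet h none) gi := by
  rw [inner_testJet_some, inner_testJet_none, ← integral_add]
  · simp only [bdryTrace, hg]
  · exact (Lp.memLp u).integrable_mul ((h.pd i).memLp 2 _)
  · exact (Lp.memLp gi).integrable_mul (h.memLp 2 _)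

/-- Integration by parts holds for smooth functions, and both sides are continuous in the jet for a
fixed test function. -/
lemma isH1_of_mem_sobolevZero {Ω : Set (E d)} {z : Jet Ω} (hz : z ∈ sobolevZero Ω) :
    IsH1 Ω (z none) (fun x i => z (some i) x) := by
  refine ⟨Lp.memLp _, fun i => Lp.memLp (z (some i)), fun i φ hφ => ?_⟩
  rw [bdryTrace_eq_inner hφ i (z none) _ (z (some i)) fun _ => rfl]
  refine sobolevZero_induction (P := fun z : Jet Ω =>
    inner ℂ (testJet hφ (some i)) (z none) + inner ℂ (testJet hφ none) (z (some i)) = 0)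
    ?_ ?_ hz
  · refine isClosed_eq ?_ continuous_const
    exact (continuous_const.inner (PiLp.continuous_apply 2 _ _)).add
      (continuous_const.inner (PiLp.continuous_apply 2 _ _))
  · rintro z ⟨ψ, h1, h2, h3, h4⟩
    rw [← bdryTrace_eq_inner hφ i (z none) (fun x i => z (some i) x) (z (some i)) fun _ => rfl]
    have h5 : bdryTrace Ω (z none) (fun x i => z (some i) x) i φ
        = ∫ x in Ω, (ψ x * (pd i φ x : ℂ) + jetOf ψ (some i) x * (φ x : ℂ)) := by
      refine integral_congr_ae ?_
      filter_upwards [h4 none, h4 (some i)] with x hx hx'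
      rw [hx, hx']; rfl
    rw [h5, setIntegral_eq_integral_of_forall_compl_eq_zero]
    · have hi1 : Integrable fun x => ψ x * (pd i φ x : ℂ) :=
        (memLp_jetOf h1 h2 none volume).integrable_mul ((hφ.pd i).memLp 2 _)
      have hi2 : Integrable fun x => jetOf ψ (some i) x * (φ x : ℂ) :=
        (memLp_jetOf h1 h2 (some i) volume).integrable_mul (hφ.memLp 2 _)
      rw [integral_add hi1 hi2]
      have h6 : ∀ x, (pd i φ x : ℂ)
          = fderiv ℝ (fun x => (φ x : ℂ)) x (EuclideanSpace.single i 1) := fun x =>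
        (congrFun (jetOf_ofReal hφ.1 i) x).symm
      have := integral_mul_fderiv_eq_neg_fderiv_mul_of_integrable (μ := volume) (f := ψ)
        (g := fun x => (φ x : ℂ)) (v := EuclideanSpace.single i 1) hi2
        (by simpa only [h6] using hi1)
        ((memLp_jetOf h1 h2 none volume).integrable_mul (hφ.memLp 2 _))
        (fun x _ => h1.differentiable (by simp) x)
        (fun x _ => hφ.ofReal.1.differentiable (by simp) x)
      simp only [h6]
      rw [this]
      exact neg_add_cancel _
    · intro x hx
      simp [hφ.eq_zero hx, (hφ.pd i).eq_zero hx]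

/-- The approximating test functions vanish off their compact support, whose complement is a
neighbourhood of `∂Ω`. Existence needs only this inclusion between the two notions of zero boundary
values. -/
lemma vanishesOn_of_mem_sobolevZero {Ω : Set (E d)} (hΩ : IsOpen Ω) {z : Jet Ω}
    (hz : z ∈ sobolevZero Ω) :
    VanishesOn Ω (frontier Ω) (z none) (fun x i => z (some i) x) := by
  intro ε hε
  obtain ⟨w, hw, hzw⟩ := EMetric.mem_closure_iff.1 (show z ∈ closure (testJets Ω : Set (Jet Ω))
    from hz) ε hε
  have hc : ∀ a, eLpNorm (fun x => z a x - w a x) 2 (volume.restrict Ω) < ε := by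
    intro a
    have h1 : ‖(z - w) a‖ₑ ≤ ‖z - w‖ₑ := by
      rw [enorm_le_iff_norm_le]; exact PiLp.norm_apply_le (z - w) a
    refine lt_of_le_of_lt (le_trans (le_of_eq ?_) h1) (by rwa [← edist_eq_enorm_sub])
    rw [Lp.enorm_def]
    exact eLpNorm_congr_ae (Lp.coeFn_sub (z a) (w a)).symm
  refine ⟨w none, fun x i => w (some i) x,
    isH1_of_mem_sobolevZero (Submodule.le_topologicalClosure _ hw), ?_, hc none, fun i => hc _⟩
  obtain ⟨φ, -, h2, h3, h4⟩ := hw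
  refine ⟨(tsupport φ)ᶜ, (isClosed_tsupport φ).isOpen_compl, fun x hx hx' => ?_, ?_⟩
  · rw [frontier, hΩ.interior_eq] at hx
    exact hx.2 (h3 hx')
  · have h5 : ∀ᵐ x ∂volume.restrict (Ω ∩ (tsupport φ)ᶜ), w none x = φ x :=
      ae_mono (Measure.restrict_mono_set _ inter_subset_left) (h4 none)
    filter_upwards [h5, ae_restrict_mem
      (hΩ.inter (isClosed_tsupport φ).isOpen_compl).measurableSet] with x hx hx'
    rw [hx, image_eq_zero_of_notMem_tsupport hx'.2]

end NIM

end

noncomputable section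

namespace NIM

variable {d : ℕ}

/-! ### Rellich's theorem and the Fredholm alternative -/

/-- The embedding of `H¹₀` into `L²`. -/
def toFunL (Ω : Set (E d)) : sobolevZero Ω →L[ℂ] Lp ℂ 2 (volume.restrict Ω) :=
  (PiLp.proj 2 (fun _ : Option (Fin d) => Lp ℂ 2 (volume.restrict Ω)) none).comp
    (sobolevZero Ω).subtypeL

/-- The partial derivative `∂ᵢ : H¹₀ → L²`. -/
def toPartialL (Ω : Set (E d)) (i : Fin d) : sobolevZero Ω →L[ℂ] Lp ℂ 2 (volume.restrict Ω) :=
  (PiLp.proj 2 (fun _ : Option (Fin d) => Lp ℂ 2 (volume.restrict Ω)) (some i)).comp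
    (sobolevZero Ω).subtypeL

lemma toFunL_apply {Ω : Set (E d)} (z : sobolevZero Ω) : toFunL Ω z = z.1 none := rfl

lemma toPartialL_apply {Ω : Set (E d)} (i : Fin d) (z : sobolevZero Ω) :
    toPartialL Ω i z = z.1 (some i) := rfl

lemma norm_sq_sobolevZero {Ω : Set (E d)} (z : sobolevZero Ω) :
    ‖z‖ ^ 2 = ‖toFunL Ω z‖ ^ 2 + ∑ i, ‖toPartialL Ω i z‖ ^ 2 := by
  rw [Submodule.coe_norm, PiLp.norm_sq_eq_of_L2, Fintype.sum_option]
  rfl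

lemma norm_clm_le_sum (L : E d →L[ℝ] ℂ) : ‖L‖ ≤ ∑ i, ‖L (EuclideanSpace.single i 1)‖ := by
  refine L.opNorm_le_bound (Finset.sum_nonneg fun _ _ => norm_nonneg _) fun x => ?_
  have hx : x = ∑ i, x i • EuclideanSpace.single i (1 : ℝ) := by
    ext j; simp [Finset.sum_apply, Pi.single_apply]
  conv_lhs => rw [hx]
  rw [map_sum, Finset.sum_mul]
  refine (norm_sum_le _ _).trans (Finset.sum_le_sum fun i _ => ?_)
  rw [map_smul, norm_smul, mul_comm]
  gcongr
  exact PiLp.norm_apply_le x i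

lemma isCompactOperator_of_approx {V W : Type*} [NormedAddCommGroup V] [NormedSpace ℂ V]
    [NormedAddCommGroup W] [NormedSpace ℂ W] [CompleteSpace W] {R : V →L[ℂ] W}
    (h : ∀ ε : ℝ, 0 < ε → ∃ S : V →L[ℂ] W, IsCompactOperator S ∧ ∀ z, ‖R z - S z‖ ≤ ε * ‖z‖) :
    IsCompactOperator R := by
  choose S hS hSε using fun n : ℕ => h _ (Nat.one_div_pos_of_nat (α := ℝ) (n := n))
  refine isCompactOperator_of_tendsto (l := Filter.atTop) (F := S) ?_ (.of_forall hS)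
  rw [tendsto_iff_norm_sub_tendsto_zero]
  refine squeeze_zero (fun _ => norm_nonneg _) (fun n => ?_)
    (tendsto_one_div_add_atTop_nhds_zero_nat (𝕜 := ℝ))
  rw [norm_sub_rev]
  exact ContinuousLinearMap.opNorm_le_bound _ (by positivity) fun z => hSε n z

/-- Rellich's theorem. The embedding is a norm limit of the compact operators `P` composed with it;
zero boundary values make regularity of `∂Ω` unnecessary, since test functions extend by zero. -/
lemma isCompactOperator_toFunL {Ω : Set (E d)} (hΩ : IsOpen Ω) (hb : Bornology.IsBounded Ω) :
    IsCompactOperator (toFunL Ω) := by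
  refine isCompactOperator_of_approx fun ε' hε' => ?_
  -- The factor `d` is lost in bounding the norm of the derivative by the sum of `d` partial
  -- derivatives, each of norm at most `‖z‖`.
  obtain ⟨ε, hε, hεd⟩ : ∃ ε : ℝ, 0 < ε ∧ d * ε ≤ ε' :=
    ⟨ε' / (d + 1), by positivity, by rw [mul_div_assoc', div_le_iff₀ (by positivity)]; nlinarith⟩
  obtain ⟨P, hP, hPε⟩ := exists_compact_approx hb hΩ.measurableSet hε
  refine ⟨P.comp (toFunL Ω), hP.comp_clm (toFunL Ω), fun z => ?_⟩
  refine sobolevZero_induction (P := fun z : Jet Ω => ‖z none - P (z none)‖ ≤ ε' * ‖z‖) ?_ ?_ z.2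
  · refine isClosed_le ?_ (by fun_prop)
    have : Continuous fun z : Jet Ω => z none := PiLp.continuous_apply 2 _ _
    exact (this.sub (P.continuous.comp this)).norm
  · rintro z ⟨φ, h1, h2, h3, h4⟩
    have h5 := hPε φ (z none) (h1.of_le (by norm_cast)) h2
      (fun x hx => image_eq_zero_of_notMem_tsupport fun h => hx (h3 h)) (h4 none)
    have h7 : ∫⁻ x, ‖fderiv ℝ φ x‖ₑ ^ 2 = ∫⁻ x in Ω, ‖fderiv ℝ φ x‖ₑ ^ 2 := by
      rw [← lintegral_indicator hΩ.measurableSet]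
      refine lintegral_congr fun x => ?_
      by_cases hx : x ∈ Ω
      · rw [indicator_of_mem hx]
      · rw [indicator_of_notMem hx, Function.notMem_support.1 fun h =>
          hx (h3 (support_fderiv_subset ℝ h)), ← ofReal_norm, norm_zero]
        simp
    rw [h7, ← eLpNorm_two_sq, ← mul_pow] at h5
    have h6 := (ENNReal.pow_le_pow_left_iff two_ne_zero).1 h5
    have h8 : eLpNorm (fderiv ℝ φ) 2 (volume.restrict Ω) ≤ ENNReal.ofReal (d * ‖z‖) := by
      calc eLpNorm (fderiv ℝ φ) 2 (volume.restrict Ω)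
          ≤ eLpNorm (∑ i : Fin d, fun x => ‖jetOf φ (some i) x‖) 2 (volume.restrict Ω) := by
            refine eLpNorm_mono_real fun x => ?_
            rw [Finset.sum_apply]
            exact norm_clm_le_sum _
        _ ≤ ∑ i : Fin d, eLpNorm (fun x => ‖jetOf φ (some i) x‖) 2 (volume.restrict Ω) :=
            eLpNorm_sum_le (fun i _ => (memLp_jetOf h1 h2 (some i) _).1.norm) one_le_two
        _ ≤ ∑ i : Fin d, ‖z‖ₑ := by
            refine Finset.sum_le_sum fun i _ => ?_
            rw [eLpNorm_norm, ← eLpNorm_congr_ae (h4 (some i)), ← Lp.enorm_def,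
              enorm_le_iff_norm_le]
            exact PiLp.norm_apply_le z (some i)
        _ = _ := by
            rw [Finset.sum_const, Finset.card_univ, Fintype.card_fin, nsmul_eq_mul,
              ENNReal.ofReal_mul (by positivity), ENNReal.ofReal_natCast, ofReal_norm]
    have h9 := h6.trans (mul_le_mul_right h8 _)
    rw [← ENNReal.ofReal_mul (by positivity), ← ofReal_norm,
      ENNReal.ofReal_le_ofReal_iff (by positivity)] at h9
    calc _ ≤ _ := h9
      _ = (d * ε) * ‖z‖ := by ring
      _ ≤ _ := by gcongr

/-- Multiplication by a bounded function, on `L²`. -/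
def mulOp {μ : Measure (E d)} {m : E d → ℂ} (hm : MemLp m ⊤ μ) : Lp ℂ 2 μ →L[ℂ] Lp ℂ 2 μ :=
  (ContinuousLinearMap.mul ℂ ℂ).holderL μ ⊤ 2 2 hm.toLp

lemma mulOp_ae {μ : Measure (E d)} {m : E d → ℂ} (hm : MemLp m ⊤ μ) (u : Lp ℂ 2 μ) :
    mulOp hm u =ᵐ[μ] fun x => m x * u x := by
  refine ((ContinuousLinearMap.mul ℂ ℂ).coeFn_holder (r := 2) hm.toLp u).trans ?_
  filter_upwards [hm.coeFn_toLp] with x hx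
  simp [hx]

/-- The Fredholm alternative for a compact perturbation of a coercive operator. -/
theorem surjective_of_coercive_sub_compact {V : Type*} [NormedAddCommGroup V]
    [InnerProductSpace ℂ V] [CompleteSpace V] {C K : V →L[ℂ] V} {c : ℝ} (hc : 0 < c)
    (hC : ∀ u, c * ‖u‖ ^ 2 ≤ (inner ℂ u (C u)).re) (hK : IsCompactOperator K)
    (hinj : ∀ u, C u - K u = 0 → u = 0) : Function.Surjective fun u => C u - K u := by
  have hu : IsUnit C := by
    refine C.isUnit_of_forall_le_norm_inner_map (c := ⟨c, hc.le⟩) hc fun x => ?_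
    calc ‖x‖ ^ 2 * c = c * ‖x‖ ^ 2 := mul_comm _ _
      _ ≤ _ := hC x
      _ ≤ ‖inner ℂ x (C x)‖ := Complex.re_le_norm _
      _ = _ := norm_inner_symm _ _
  obtain ⟨D, rfl⟩ := hu
  set S : V →L[ℂ] V := ((D⁻¹ : (V →L[ℂ] V)ˣ) : V →L[ℂ] V).comp K with hS
  have hSc : IsCompactOperator S := hK.clm_comp ((D⁻¹ : (V →L[ℂ] V)ˣ) : V →L[ℂ] V)
  have hDD : ∀ u, (D : V →L[ℂ] V) (((D⁻¹ : (V →L[ℂ] V)ˣ) : V →L[ℂ] V) u) = u := fun u =>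
    congrArg (fun L : V →L[ℂ] V => L u) D.mul_inv
  -- `C - K = C (1 - S)` with `S = C⁻¹ K` compact. Either 1 is an eigenvalue of `S`, against
  -- injectivity of `C - K`, or `1 - S` is invertible.
  rcases hSc.hasEigenvalue_or_mem_resolventSet one_ne_zero with h | h
  · obtain ⟨u, hu⟩ := h.exists_hasEigenvector
    have h1 : S u = u := by simpa using hu.apply_eq_smul
    refine absurd (hinj u ?_) hu.2
    have h2 : (D : V →L[ℂ] V) (S u) = K u := hDD (K u)
    rw [h1] at h2
    rw [h2, sub_self]
  · rw [spectrum.mem_resolventSet_iff, map_one, ContinuousLinearMap.isUnit_iff_bijective] at h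
    intro w
    obtain ⟨u, hu⟩ := h.2 (((D⁻¹ : (V →L[ℂ] V)ˣ) : V →L[ℂ] V) w)
    refine ⟨u, ?_⟩
    have h2 := congrArg (D : V →L[ℂ] V) hu
    rw [hDD] at h2
    rw [← h2]
    simp [hS, hDD]

end NIM

end

/-! ### Existence from uniqueness for elliptic Dirichlet problems. -/

noncomputable section

namespace NIM

variable {d : ℕ}

/-- Bounded and measurable, uniformly elliptic coefficients in `D`; `k²σ` is bounded. -/
structure Coeff (D : Set (E d)) (k : ℝ) (B : E d → Matrix (Fin d) (Fin d) ℝ) (σ : E d → ℝ) :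
    Prop where
  memLp_B : ∀ i j, MemLp (fun x => (B x i j : ℂ)) ⊤ (volume.restrict D)
  elliptic : ∃ c : ℝ, 0 < c ∧ ∀ᵐ x ∂volume.restrict D, ∀ ξ : Fin d → ℝ,
    c * (ξ ⬝ᵥ ξ) ≤ (B x).mulVec ξ ⬝ᵥ ξ
  memLp_s : MemLp (fun x => (k : ℂ) ^ 2 * (σ x : ℂ)) ⊤ (volume.restrict D)

lemma memLp_top_mul {μ : Measure (E d)} {m u : E d → ℂ} (hm : MemLp m ⊤ μ) (hu : MemLp u 2 μ) :
    MemLp (fun x => m x * u x) 2 μ :=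
  hu.mul hm

lemma Coeff.isL2 {D : Set (E d)} {k : ℝ} {B : E d → Matrix (Fin d) (Fin d) ℝ} {σ : E d → ℝ}
    (hB : Coeff D k B σ) {h u : E d → ℂ} {g : E d → Fin d → ℂ}
    (hh : MemLp h 2 (volume.restrict D)) (hu : MemLp u 2 (volume.restrict D))
    (hg : ∀ i, MemLp (fun x => g x i) 2 (volume.restrict D)) :
    IsL2 D (fun x i => ∑ j, (B x i j : ℂ) * g x j)
      (fun x => h x - (k : ℂ) ^ 2 * (σ x : ℂ) * u x) :=
  ⟨fun i => memLp_finsetSum _ fun j _ => memLp_top_mul (hB.memLp_B i j) (hg j),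
    hh.sub (memLp_top_mul hB.memLp_s hu)⟩

/-- Real and imaginary parts of `z` decouple in the real part of the form, because `B` is real.
Symmetry of `B` plays no role. -/
lemma re_complex_quadForm_le {B : Matrix (Fin d) (Fin d) ℝ} {c : ℝ}
    (hB : ∀ ξ : Fin d → ℝ, c * (ξ ⬝ᵥ ξ) ≤ B.mulVec ξ ⬝ᵥ ξ) (z : Fin d → ℂ) :
    c * ∑ i, ‖z i‖ ^ 2 ≤ (∑ i, ∑ j, ((B i j : ℂ) * z j) * (starRingEnd ℂ) (z i)).re := by
  have h1 := hB fun i => (z i).re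
  have h2 := hB fun i => (z i).im
  simp only [dotProduct, Matrix.mulVec] at h1 h2
  have h3 : ∑ i, ‖z i‖ ^ 2 = ∑ i, (z i).re * (z i).re + ∑ i, (z i).im * (z i).im := by
    rw [← Finset.sum_add_distrib]
    exact Finset.sum_congr rfl fun i _ => by rw [Complex.sq_norm, Complex.normSq_apply]
  have h4 : (∑ i, ∑ j, ((B i j : ℂ) * z j) * (starRingEnd ℂ) (z i)).re
      = ∑ i, (∑ j, B i j * (z j).re) * (z i).re + ∑ i, (∑ j, B i j * (z j).im) * (z i).im := by
    rw [← Finset.sum_add_distrib, Complex.re_sum]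
    refine Finset.sum_congr rfl fun i _ => ?_
    rw [Complex.re_sum, Finset.sum_mul, Finset.sum_mul, ← Finset.sum_add_distrib]
    refine Finset.sum_congr rfl fun j _ => ?_
    simp
  rw [h3, h4, mul_add]
  exact add_le_add h1 h2

/-- Uniqueness implies existence for a form whose principal part is coercive up to a compact
perturbation. -/
theorem exists_form_eq {V L ι : Type*} [NormedAddCommGroup V] [InnerProductSpace ℂ V]
    [CompleteSpace V] [NormedAddCommGroup L] [InnerProductSpace ℂ L] [CompleteSpace L] [Fintype ι]
    {R : V →L[ℂ] L} {D : ι → V →L[ℂ] L} {M : ι → ι → L →L[ℂ] L} {S : L →L[ℂ] L} {c : ℝ}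
    (hnorm : ∀ u, ‖u‖ ^ 2 = ‖R u‖ ^ 2 + ∑ i, ‖D i u‖ ^ 2) (hR : IsCompactOperator R) (hc : 0 < c)
    (hcoer : ∀ u, c * ∑ i, ‖D i u‖ ^ 2 ≤ (∑ i, ∑ j, inner ℂ (D i u) (M i j (D j u))).re)
    (hinj : ∀ u, (∀ w, ∑ i, ∑ j, inner ℂ (D i w) (M i j (D j u)) = inner ℂ (R w) (S (R u))) →
      R u = 0) (f : L) :
    ∃ u, ∀ w, ∑ i, ∑ j, inner ℂ (D i w) (M i j (D j u))
      = inner ℂ (R w) (S (R u)) - inner ℂ (R w) f := by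
  set P : V →L[ℂ] V := ∑ i, ∑ j, (ContinuousLinearMap.adjoint (D i)).comp ((M i j).comp (D j))
    with hP
  have hinP : ∀ w u, inner ℂ w (P u) = ∑ i, ∑ j, inner ℂ (D i w) (M i j (D j u)) := fun w u => by
    simp only [hP, sum_apply, inner_sum, ContinuousLinearMap.comp_apply,
      ContinuousLinearMap.adjoint_inner_right]
  set R' := ContinuousLinearMap.adjoint R with hR'
  have hinR : ∀ w g, inner ℂ w (R' g) = inner ℂ (R w) g := fun w g =>
    ContinuousLinearMap.adjoint_inner_right _ _ _
  have hK : IsCompactOperator (R'.comp R + R'.comp (S.comp R)) :=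
    (hR.clm_comp R').add (hR.clm_comp (R'.comp S))
  -- The principal part `P` controls gradients only. Adding `R* R` makes it coercive with constant
  -- `min c 1`, and the same compact term is added to `K`, so that `C - K = P - R* S R`.
  have hsurj := surjective_of_coercive_sub_compact (C := R'.comp R + P)
    (K := R'.comp R + R'.comp (S.comp R)) (lt_min hc one_pos) (fun u => ?_) hK (fun u hu => ?_)
  · obtain ⟨u, hu⟩ := hsurj (-R' f)
    refine ⟨u, fun w => ?_⟩
    simp only [add_apply, add_sub_add_left_eq_sub, ContinuousLinearMap.comp_apply] at hu
    have h1 := congrArg (inner ℂ w) hu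
    rw [inner_sub_right, inner_neg_right, hinP, hinR, hinR] at h1
    linear_combination h1
  · rw [add_apply, inner_add_right, hinP, ContinuousLinearMap.comp_apply, hinR, Complex.add_re,
      hnorm, mul_add, inner_self_eq_norm_sq_to_K]
    have h2 : (((‖R u‖ : ℝ) : ℂ) ^ 2).re = ‖R u‖ ^ 2 := by norm_cast
    refine add_le_add ((mul_le_of_le_one_left (by positivity) (min_le_right _ _)).trans h2.ge)
      (le_trans ?_ (hcoer u))
    gcongr
    exact min_le_left _ _
  · simp only [add_apply, add_sub_add_left_eq_sub, ContinuousLinearMap.comp_apply] at hu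
    have h1 : ∀ w, ∑ i, ∑ j, inner ℂ (D i w) (M i j (D j u)) = inner ℂ (R w) (S (R u)) := by
      intro w
      rw [← hinP, sub_eq_zero.1 hu, hinR]
    -- Uniqueness gives only that the function vanishes; coercivity then makes its gradient vanish
    -- as well, hence `u = 0`.
    have h4 := hinj u h1
    have h6 := hcoer u
    rw [h1, h4, map_zero, inner_zero_right, Complex.zero_re] at h6
    have h7 : ‖u‖ ^ 2 ≤ 0 := by
      rw [hnorm, h4, norm_zero]
      nlinarith
    simpa using (pow_eq_zero_iff two_ne_zero).1 (le_antisymm h7 (by positivity))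

section Existence

variable {Ω : Set (E d)} {k : ℝ} {B : E d → Matrix (Fin d) (Fin d) ℝ} {σ : E d → ℝ}

lemma lp_norm_sq {μ : Measure (E d)} (u : Lp ℂ 2 μ) : ‖u‖ ^ 2 = ∫ x, ‖u x‖ ^ 2 ∂μ := by
  rw [← RCLike.ofReal_inj (K := ℂ), RCLike.ofReal_pow, ← inner_self_eq_norm_sq_to_K,
    L2.inner_def, ← integral_ofReal]
  simp only [inner_self_eq_norm_sq_to_K, RCLike.ofReal_pow]

lemma exists_coercive_form (hB : Coeff Ω k B σ) : ∃ c : ℝ, 0 < c ∧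
    ∀ g : Fin d → Lp ℂ 2 (volume.restrict Ω),
      c * ∑ i, ‖g i‖ ^ 2 ≤ (∑ i, ∑ j, inner ℂ (g i) (mulOp (hB.memLp_B i j) (g j))).re := by
  obtain ⟨c, hc, hcB⟩ := hB.elliptic
  refine ⟨c, hc, fun g => ?_⟩
  have hin : ∀ i, Integrable (fun x => ‖g i x‖ ^ 2) (volume.restrict Ω) := fun i =>
    (memLp_two_iff_integrable_sq_norm (Lp.memLp _).1).1 (Lp.memLp _)
  simp only [lp_norm_sq]
  rw [← integral_finsetSum _ fun i _ => hin i, ← integral_const_mul]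
  simp only [L2.inner_def]
  have hi2 : ∀ i j, Integrable (fun x => inner ℂ (g i x) (mulOp (hB.memLp_B i j) (g j) x))
      (volume.restrict Ω) := fun i j => L2.integrable_inner _ _
  simp only [← integral_finsetSum _ fun j _ => hi2 _ j]
  rw [← integral_finsetSum _ fun i _ => integrable_finsetSum _ fun j _ => hi2 i j]
  have hi3 := integrable_finsetSum (Finset.univ : Finset (Fin d)) fun i _ =>
    integrable_finsetSum (Finset.univ : Finset (Fin d)) fun j _ => hi2 i j
  refine le_trans ?_ (le_of_eq (integral_re hi3))
  refine integral_mono_ae ((integrable_finsetSum _ fun i _ => hin i).const_mul c) hi3.re ?_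
  have hm : ∀ᵐ x ∂volume.restrict Ω, ∀ i j,
      mulOp (hB.memLp_B i j) (g j) x = B x i j * g j x :=
    ae_all_iff.2 fun i => ae_all_iff.2 fun j => mulOp_ae _ _
  filter_upwards [hcB, hm] with x hx hx'
  simp only [hx']
  exact re_complex_quadForm_le hx fun i => g i x

lemma bdryFlux_eq_inner (hB : Coeff Ω k B σ) (u f : Lp ℂ 2 (volume.restrict Ω))
    (g : Fin d → Lp ℂ 2 (volume.restrict Ω)) {φ : E d → ℝ} (hφ : IsTest Ω φ) :
    bdryFlux Ω k B σ f u (fun x i => g i x) φ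
      = ∑ i, ∑ j, inner ℂ (testJet hφ (some i)) (mulOp (hB.memLp_B i j) (g j))
        - inner ℂ (testJet hφ none) (mulOp hB.memLp_s u) + inner ℂ (testJet hφ none) f := by
  rw [inner_testJet_none, inner_testJet_none]
  simp only [inner_testJet_some]
  have hi : ∀ (v : Lp ℂ 2 (volume.restrict Ω)) i,
      Integrable (fun x => v x * (pd i φ x : ℂ)) (volume.restrict Ω) := fun v i =>
    (Lp.memLp v).integrable_mul ((hφ.pd i).memLp 2 _)
  have hi' : ∀ (v : Lp ℂ 2 (volume.restrict Ω)),
      Integrable (fun x => v x * (φ x : ℂ)) (volume.restrict Ω) := fun v =>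
    (Lp.memLp v).integrable_mul (hφ.memLp 2 _)
  have hi2 : ∀ i, Integrable (fun x => ∑ j, mulOp (hB.memLp_B i j) (g j) x * (pd i φ x : ℂ))
      (volume.restrict Ω) := fun i => integrable_finsetSum _ fun j _ => hi _ _
  have hi3 := integrable_finsetSum (Finset.univ : Finset (Fin d)) fun i _ => hi2 i
  have e2 : ∀ {F G H : E d → ℂ}, Integrable F (volume.restrict Ω) →
      Integrable G (volume.restrict Ω) → Integrable H (volume.restrict Ω) →
      (∫ x in Ω, F x) - (∫ x in Ω, G x) + ∫ x in Ω, H x = ∫ x in Ω, (F x - G x + H x) :=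
    fun hF hG hH => by rw [← integral_sub hF hG]; exact (integral_add (hF.sub hG) hH).symm
  have e1 : ∀ i, ∑ j, ∫ x in Ω, mulOp (hB.memLp_B i j) (g j) x * (pd i φ x : ℂ)
      = ∫ x in Ω, ∑ j, mulOp (hB.memLp_B i j) (g j) x * (pd i φ x : ℂ) := fun i =>
    (integral_finsetSum _ fun j _ => hi _ _).symm
  rw [Finset.sum_congr rfl fun i _ => e1 i, ← integral_finsetSum _ fun i _ => hi2 i,
    e2 hi3 (hi' _) (hi' _)]
  refine integral_congr_ae ?_
  have hm : ∀ᵐ x ∂volume.restrict Ω, ∀ i j,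
      mulOp (hB.memLp_B i j) (g j) x = B x i j * g j x :=
    ae_all_iff.2 fun i => ae_all_iff.2 fun j => mulOp_ae _ _
  filter_upwards [hm, mulOp_ae hB.memLp_s u] with x h1 h2
  simp only [h1, h2, Finset.sum_mul]
  ring

lemma bdryFlux_congr_rhs {f f' u : E d → ℂ} {g : E d → Fin d → ℂ} {φ : E d → ℝ}
    (h : f =ᵐ[volume.restrict Ω] f') : bdryFlux Ω k B σ f u g φ = bdryFlux Ω k B σ f' u g φ := by
  refine integral_congr_ae ?_
  filter_upwards [h] with x hx
  rw [hx]

/-- Uniqueness implies existence for the Dirichlet problem in `H¹₀(Ω)`. -/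
theorem exists_isWeakSol (hΩ : IsOpen Ω) (hb : Bornology.IsBounded Ω) (hB : Coeff Ω k B σ)
    (huniq : ∀ v g, IsH1 Ω v g → IsWeakSol Ω k B σ 0 v g → VanishesOn Ω (frontier Ω) v g →
      ∀ᵐ x ∂volume.restrict Ω, v x = 0)
    {f : E d → ℂ} (hf : MemLp f 2 (volume.restrict Ω)) :
    ∃ W gW, IsH1 Ω W gW ∧ VanishesOn Ω (frontier Ω) W gW ∧ IsWeakSol Ω k B σ f W gW := by
  obtain ⟨c, hc, hcB⟩ := exists_coercive_form hB
  have hinj : ∀ u, (∀ w, ∑ i, ∑ j, inner ℂ (toPartialL Ω i w)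
      (mulOp (hB.memLp_B i j) (toPartialL Ω j u))
        = inner ℂ (toFunL Ω w) (mulOp hB.memLp_s (toFunL Ω u))) → toFunL Ω u = 0 := by
    intro u hu
    have h2 : IsWeakSol Ω k B σ 0 (u.1 none) (fun x i => u.1 (some i) x) := by
      intro φ hφ
      rw [← bdryFlux_congr_rhs (Lp.coeFn_zero ℂ 2 (volume.restrict Ω)),
        bdryFlux_eq_inner hB (u.1 none) 0 (fun i => u.1 (some i)) hφ]
      have h1 := hu ⟨testJet hφ, testJet_mem hφ⟩
      simp only [toFunL_apply, toPartialL_apply] at h1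
      rw [h1, inner_zero_right]; ring
    have h3 := huniq _ _ (isH1_of_mem_sobolevZero u.2) h2 (vanishesOn_of_mem_sobolevZero hΩ u.2)
    refine Lp.ext ?_
    filter_upwards [h3, Lp.coeFn_zero ℂ 2 (volume.restrict Ω)] with x hx hx'
    rw [hx', Pi.zero_apply]
    exact hx
  obtain ⟨W, hW⟩ := exists_form_eq norm_sq_sobolevZero (isCompactOperator_toFunL hΩ hb) hc
    (fun u => hcB fun i => toPartialL Ω i u) hinj hf.toLp
  refine ⟨W.1 none, fun x i => W.1 (some i) x, isH1_of_mem_sobolevZero W.2,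
    vanishesOn_of_mem_sobolevZero hΩ W.2, fun φ hφ => ?_⟩
  rw [bdryFlux_congr_rhs hf.coeFn_toLp.symm,
    bdryFlux_eq_inner hB (W.1 none) hf.toLp (fun i => W.1 (some i)) hφ]
  have h1 := hW ⟨testJet hφ, testJet_mem hφ⟩
  simp only [toFunL_apply, toPartialL_apply] at h1
  rw [h1]; ring

end Existence

end NIM

end

noncomputable section

open scoped Pointwise

namespace NIM

variable {d : ℕ}

/-! ### The boundary of a smooth open set is a null set -/

/-- By Rolle's theorem a line in direction `v` meets `S` at most once, so the translates of `S` by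
distinct multiples of `v` are disjoint. Infinitely many disjoint translates by a bounded sequence of
vectors force measure zero. -/
lemma volume_eq_zero_of_subset_levelSet {S : Set (E d)} {ρ : E d → ℝ} {x v : E d} {r : ℝ}
    (hS : MeasurableSet S) (hSb : S ⊆ Metric.ball x r) (h0 : ∀ y ∈ S, ρ y = 0)
    (hd : ∀ y ∈ Metric.ball x r, DifferentiableAt ℝ ρ y ∧ fderiv ℝ ρ y v ≠ 0) : volume S = 0 := by
  have key : ∀ z ∈ S, ∀ t : ℝ, 0 < t → z + t • v ∉ S := by
    intro z hz t ht hzt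
    have hmem : ∀ s ∈ Icc 0 t, z + s • v ∈ Metric.ball x r := by
      intro s hs
      have h := (convex_ball x r).add_smul_mem (hSb hz) (hSb hzt) (t := s / t)
        ⟨div_nonneg hs.1 ht.le, div_le_one_of_le₀ hs.2 ht.le⟩
      rwa [smul_smul, div_mul_cancel₀ _ ht.ne'] at h
    have hder : ∀ s ∈ Icc 0 t, HasDerivAt (fun s : ℝ => ρ (z + s • v))
        (fderiv ℝ ρ (z + s • v) v) s := by
      intro s hs
      have h1 : HasDerivAt (fun s : ℝ => z + s • v) v s := by
        simpa using ((hasDerivAt_id s).smul_const v).const_add z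
      exact (hd _ (hmem s hs)).1.hasFDerivAt.comp_hasDerivAt s h1
    obtain ⟨s, hs, hs0⟩ := exists_hasDerivAt_eq_zero ht
      (fun s hs => (hder s hs).continuousAt.continuousWithinAt)
      (by simp [h0 z hz, h0 _ hzt]) (fun s hs => hder s (Ioo_subset_Icc_self hs))
    exact (hd _ (hmem s (Ioo_subset_Icc_self hs))).2 hs0
  refine Measure.addHaar_eq_zero_of_disjoint_translates volume
    (fun n : ℕ => (1 / ((n : ℝ) + 1)) • v) ?_ ?_ hS
  · exact Metric.isBounded_range_of_tendsto _
      ((tendsto_one_div_add_atTop_nhds_zero_nat (𝕜 := ℝ)).smul_const v)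
  · have hlt : ∀ m n : ℕ, m < n →
        Disjoint (({(1 / ((m : ℝ) + 1)) • v} : Set (E d)) + S) ({(1 / ((n : ℝ) + 1)) • v} + S) := by
      intro m n hmn
      rw [Set.disjoint_left]
      rintro _ ⟨_, rfl, z, hz, rfl⟩ ⟨_, rfl, z', hz', h⟩
      refine key z hz (1 / ((m : ℝ) + 1) - 1 / ((n : ℝ) + 1)) (sub_pos.2 ?_) ?_
      · exact one_div_lt_one_div_of_lt (by positivity) (by exact_mod_cast Nat.succ_lt_succ hmn)
      · have h' : (1 / ((n : ℝ) + 1)) • v + z' = (1 / ((m : ℝ) + 1)) • v + z := h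
        have : z + (1 / ((m : ℝ) + 1) - 1 / ((n : ℝ) + 1)) • v = z' := by
          rw [sub_smul, eq_comm]
          linear_combination (norm := module) h'
        rwa [this]
    intro m n hmn
    rcases lt_or_gt_of_ne hmn with h | h
    · exact hlt m n h
    · exact (hlt n m h).symm

/-- Near a boundary point the frontier lies in the zero set of the defining function `ρ`, whose
derivative in some fixed direction does not vanish nearby. Interfaces are thus invisible to volume
integrals. -/
lemma IsSmoothOpen.volume_frontier {D : Set (E d)} (hD : IsSmoothOpen D) :
    volume (frontier D) = 0 := by
  refine measure_null_of_locally_null _ fun x hx => ?_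
  obtain ⟨N, ρ, hN, hxN, hρ, hρ0, hDN⟩ := hD.2 x hx
  obtain ⟨v, hv⟩ : ∃ v, fderiv ℝ ρ x v ≠ 0 := by
    by_contra h
    push Not at h
    exact hρ0 (ContinuousLinearMap.ext h)
  have hcont : ContinuousAt (fun y => fderiv ℝ ρ y v) x :=
    ((hρ.continuousOn_fderiv_of_isOpen hN (by simp)).continuousAt (hN.mem_nhds hxN)).clm_apply
      continuousAt_const
  obtain ⟨r, hr, hrN⟩ := Metric.mem_nhds_iff.1
    (Filter.inter_mem (hN.mem_nhds hxN) (hcont.eventually_ne hv))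
  refine ⟨frontier D ∩ Metric.ball x r, inter_mem_nhdsWithin _ (Metric.ball_mem_nhds x hr),
    volume_eq_zero_of_subset_levelSet (ρ := ρ) (v := v)
      (isClosed_frontier.measurableSet.inter measurableSet_ball) inter_subset_right ?_ ?_⟩
  · rintro y ⟨hy, hyr⟩
    have hyN : y ∈ N := (hrN hyr).1
    have hcy : ContinuousAt ρ y := hρ.continuousOn.continuousAt (hN.mem_nhds hyN)
    refine le_antisymm ?_ ?_
    · by_contra hlt
      push Not at hlt
      have hev := (hcy.eventually_const_lt hlt).and (hN.mem_nhds hyN)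
      obtain ⟨z, hz, hzD⟩ := mem_closure_iff_nhds.1 (frontier_subset_closure hy) _ hev
      have : z ∈ {y ∈ N | ρ y < 0} := hDN ▸ ⟨hzD, hz.2⟩
      exact lt_asymm hz.1 this.2
    · by_contra hlt
      push Not at hlt
      have : y ∈ D ∩ N := hDN ▸ ⟨hyN, hlt⟩
      rw [frontier, hD.1.interior_eq] at hy
      exact hy.2 this.1
  · intro y hy
    exact ⟨(hρ.differentiableOn (by simp)).differentiableAt (hN.mem_nhds (hrN hy).1), (hrN hy).2⟩

/-! ### Diffeomorphisms and push-forwards -/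

lemma jac_comp {F G : E d → E d} {x : E d} (hG : DifferentiableAt ℝ G (F x))
    (hF : DifferentiableAt ℝ F x) : jac (G ∘ F) x = jac G (F x) * jac F x := by
  ext i j
  simp only [jac, Matrix.of_apply, Matrix.mul_apply]
  rw [fderiv_comp x hG hF, ContinuousLinearMap.comp_apply]
  have h : ∀ w : E d, w = ∑ k, w k • EuclideanSpace.single k (1 : ℝ) := fun w => by
    ext l; simp [Finset.sum_apply, Pi.single_apply]
  conv_lhs => rw [h (fderiv ℝ F x (EuclideanSpace.single j 1)), map_sum]
  simp [mul_comm]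

lemma jac_congr {F G : E d → E d} {x : E d} (h : F =ᶠ[nhds x] G) : jac F x = jac G x := by
  simp only [jac, h.fderiv_eq]

lemma jac_id (x : E d) : jac id x = 1 := by
  ext i j
  simp [jac, Matrix.one_apply]

namespace IsDiffeo

variable {F : E d → E d} {D D' : Set (E d)}

lemma inv_mem (h : IsDiffeo F D D') {y : E d} (hy : y ∈ D') : Function.invFunOn F D y ∈ D :=
  Function.invFunOn_mem (h.2.2.1.surjOn hy)

lemma apply_inv (h : IsDiffeo F D D') {y : E d} (hy : y ∈ D') :
    F (Function.invFunOn F D y) = y :=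
  Function.invFunOn_eq (h.2.2.1.surjOn hy)

lemma inv_apply (h : IsDiffeo F D D') {x : E d} (hx : x ∈ D) :
    Function.invFunOn F D (F x) = x :=
  h.2.2.1.invOn_invFunOn.1 hx

lemma differentiableAt (h : IsDiffeo F D D') {x : E d} (hx : x ∈ D) : DifferentiableAt ℝ F x :=
  (h.2.2.2.1.differentiableOn (by simp)).differentiableAt (h.1.mem_nhds hx)

lemma differentiableAt_inv (h : IsDiffeo F D D') {y : E d} (hy : y ∈ D') :
    DifferentiableAt ℝ (Function.invFunOn F D) y :=
  (h.2.2.2.2.differentiableOn (by simp)).differentiableAt (h.2.1.mem_nhds hy)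

lemma jac_mul_jac_inv (h : IsDiffeo F D D') {y : E d} (hy : y ∈ D') :
    jac F (Function.invFunOn F D y) * jac (Function.invFunOn F D) y = 1 := by
  rw [← jac_comp (h.differentiableAt (h.inv_mem hy)) (h.differentiableAt_inv hy), ← jac_id y]
  refine jac_congr ?_
  filter_upwards [h.2.1.mem_nhds hy] with z hz using h.apply_inv hz

lemma det_jac_ne_zero (h : IsDiffeo F D D') {y : E d} (hy : y ∈ D') :
    (jac F (Function.invFunOn F D y)).det ≠ 0 := by
  intro h0
  have := congrArg Matrix.det (h.jac_mul_jac_inv hy)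
  rw [Matrix.det_mul, h0, zero_mul, Matrix.det_one] at this
  exact zero_ne_one this

/-- The exceptional set in `D'` is contained in the image under `F` of the one in `D`, and
differentiable maps send null sets to null sets. -/
lemma ae_inv (h : IsDiffeo F D D') {P : E d → Prop} (hP : ∀ᵐ x ∂volume.restrict D, P x) :
    ∀ᵐ y ∂volume.restrict D', P (Function.invFunOn F D y) := by
  rw [ae_restrict_iff' h.1.measurableSet, ae_iff] at hP
  rw [ae_restrict_iff' h.2.1.measurableSet, ae_iff]
  have h0 := addHaar_image_eq_zero_of_differentiableOn_of_addHaar_eq_zero volume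
    (f := F) (s := {x | ¬(x ∈ D → P x)}) (fun x hx => by
      simp only [mem_ofPred_eq, Classical.not_imp] at hx
      exact (h.differentiableAt hx.1).differentiableWithinAt) hP
  refine measure_mono_null (fun y hy => ?_) h0
  simp only [mem_ofPred_eq, Classical.not_imp] at hy
  exact ⟨Function.invFunOn F D y, by simpa using ⟨h.inv_mem hy.1, hy.2⟩, h.apply_inv hy.1⟩

lemma continuousOn_inv (h : IsDiffeo F D D') : ContinuousOn (Function.invFunOn F D) D' :=
  h.2.2.2.2.continuousOn

lemma _root_.NIM.continuousOn_jac {F : E d → E d} {D : Set (E d)} (hF : ContDiffOn ℝ 1 F D)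
    (hD : IsOpen D) : ContinuousOn (jac F) D := by
  refine continuousOn_pi.2 fun i => continuousOn_pi.2 fun j => ?_
  have h1 : ContinuousOn (fun x => fderiv ℝ F x (EuclideanSpace.single j 1)) D :=
    (hF.continuousOn_fderiv_of_isOpen hD (by simp)).clm_apply continuousOn_const
  exact (PiLp.continuous_apply 2 _ i).comp_continuousOn h1

lemma continuousOn_jac_inv (h : IsDiffeo F D D') :
    ContinuousOn (fun y => jac F (Function.invFunOn F D y)) D' :=
  (continuousOn_jac h.2.2.2.1 h.1).comp h.continuousOn_inv fun _ hy => h.inv_mem hy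

lemma aemeasurable_comp_inv (h : IsDiffeo F D D') {f : E d → ℝ}
    (hf : AEMeasurable f (volume.restrict D)) :
    AEMeasurable (fun y => f (Function.invFunOn F D y)) (volume.restrict D') := by
  have hi : AEMeasurable (Function.invFunOn F D) (volume.restrict D') :=
    h.continuousOn_inv.aemeasurable h.2.1.measurableSet
  refine ⟨fun y => hf.mk f (hi.mk _ y), hf.measurable_mk.comp hi.measurable_mk, ?_⟩
  filter_upwards [h.ae_inv hf.ae_eq_mk, hi.ae_eq_mk] with y h1 h2
  rw [h1, ← h2]

lemma continuousOn_det (h : IsDiffeo F D D') :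
    ContinuousOn (fun y => (jac F (Function.invFunOn F D y)).det) D' :=
  (continuous_id.matrix_det).comp_continuousOn h.continuousOn_jac_inv

lemma continuousOn_inv_det (h : IsDiffeo F D D') :
    ContinuousOn (fun y => |(jac F (Function.invFunOn F D y)).det|⁻¹) D' :=
  h.continuousOn_det.abs.inv₀ fun _ hy => abs_ne_zero.2 (h.det_jac_ne_zero hy)

lemma aemeasurable_pushFun (h : IsDiffeo F D D') {f : E d → ℝ}
    (hf : AEMeasurable f (volume.restrict D)) :
    AEMeasurable (pushFun F D f) (volume.restrict D') :=
  (h.continuousOn_inv_det.aemeasurable h.2.1.measurableSet).mul (h.aemeasurable_comp_inv hf)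

lemma pushMat_apply (B : E d → Matrix (Fin d) (Fin d) ℝ) (y : E d) (i j : Fin d) :
    pushMat F D B y i j = |(jac F (Function.invFunOn F D y)).det|⁻¹ *
      ∑ l, (∑ k, jac F (Function.invFunOn F D y) i k * B (Function.invFunOn F D y) k l) *
        jac F (Function.invFunOn F D y) j l := by
  simp [pushMat, Matrix.mul_apply]

lemma aemeasurable_pushMat (h : IsDiffeo F D D') {B : E d → Matrix (Fin d) (Fin d) ℝ}
    (hB : ∀ i j, AEMeasurable (fun x => B x i j) (volume.restrict D)) (i j : Fin d) :
    AEMeasurable (fun y => pushMat F D B y i j) (volume.restrict D') := by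
  have hJ : ∀ i j, AEMeasurable (fun y => jac F (Function.invFunOn F D y) i j)
      (volume.restrict D') := fun i j =>
    (continuousOn_pi.1 (continuousOn_pi.1 h.continuousOn_jac_inv i) j).aemeasurable
      h.2.1.measurableSet
  simp only [pushMat_apply]
  refine (h.continuousOn_inv_det.aemeasurable h.2.1.measurableSet).mul ?_
  refine Finset.aemeasurable_fun_sum _ fun l _ => AEMeasurable.mul ?_ (hJ j l)
  exact Finset.aemeasurable_fun_sum _ fun k _ => (hJ i k).mul (h.aemeasurable_comp_inv (hB k l))

end IsDiffeo

lemma exists_entry_bound {K D : Set (E d)} {J : E d → Matrix (Fin d) (Fin d) ℝ}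
    (hK : IsCompact K) (hKD : K ⊆ D) (hJ : ContinuousOn J D) :
    ∃ C : ℝ, 0 < C ∧ ∀ y ∈ K, ∀ i j, |J y i j| ≤ C := by
  have h : ∀ i j, ∃ C : ℝ, ∀ y ∈ K, |J y i j| ≤ C := fun i j =>
    hK.exists_bound_of_continuousOn
      (continuousOn_pi.1 (continuousOn_pi.1 (hJ.mono hKD) i) j)
  choose C hC using h
  refine ⟨1 + ∑ i, ∑ j, |C i j|, by positivity, fun y hy i j => ?_⟩
  calc |J y i j| ≤ C i j := hC i j y hy
    _ ≤ |C i j| := le_abs_self _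
    _ ≤ ∑ j, |C i j| := Finset.single_le_sum (f := fun j => |C i j|) (fun _ _ => abs_nonneg _)
        (Finset.mem_univ j)
    _ ≤ ∑ i, ∑ j, |C i j| := Finset.single_le_sum (f := fun i => ∑ j, |C i j|)
        (fun _ _ => Finset.sum_nonneg fun _ _ => abs_nonneg _) (Finset.mem_univ i)
    _ ≤ _ := by linarith

/-- The bound is confined to compact subsets of `D'`, as the Jacobian of a diffeomorphism between
open sets may be unbounded or degenerate towards the boundary. -/
lemma IsDiffeo.pushMat_bounded {F : E d → E d} {D D' K : Set (E d)} (h : IsDiffeo F D D')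
    (hK : IsCompact K) (hKD : K ⊆ D') {B : E d → Matrix (Fin d) (Fin d) ℝ} {C : ℝ}
    (hB : ∀ᵐ x ∂volume.restrict D, ∀ i j, |B x i j| ≤ C) :
    ∃ C' : ℝ, ∀ᵐ y ∂volume.restrict D', y ∈ K → ∀ i j, |pushMat F D B y i j| ≤ C' := by
  obtain ⟨CJ, hCJ, hJ⟩ := exists_entry_bound hK hKD h.continuousOn_jac_inv
  obtain ⟨Cd, hCd⟩ := hK.exists_bound_of_continuousOn (h.continuousOn_inv_det.mono hKD)
  refine ⟨Cd * ∑ _l : Fin d, (∑ _k : Fin d, CJ * C) * CJ, ?_⟩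
  filter_upwards [h.ae_inv hB] with y hy hyK i j
  rw [IsDiffeo.pushMat_apply, abs_mul]
  have h1 := hCd y hyK
  rw [Real.norm_eq_abs] at h1
  have hC0 : 0 ≤ C := (abs_nonneg _).trans (hy i j)
  refine mul_le_mul h1 ((Finset.abs_sum_le_sum_abs _ _).trans (Finset.sum_le_sum fun l _ => ?_))
    (abs_nonneg _) ((abs_nonneg _).trans h1)
  rw [abs_mul]
  refine mul_le_mul ((Finset.abs_sum_le_sum_abs _ _).trans (Finset.sum_le_sum fun k _ => ?_))
    (hJ y hyK j l) (abs_nonneg _) (Finset.sum_nonneg fun _ _ => by positivity)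
  rw [abs_mul]
  exact mul_le_mul (hJ y hyK i k) (hy k l) (abs_nonneg _) hCJ.le

/-- From `J L = 1` one gets `ξ = Lᵀ (Jᵀ ξ)`; Cauchy–Schwarz in each of the `d` components
contributes `d C²`. -/
lemma dotProduct_self_le_of_transpose_mulVec {L J : Matrix (Fin d) (Fin d) ℝ} (hLJ : J * L = 1)
    {C : ℝ} (hL : ∀ i j, |L i j| ≤ C) (ξ : Fin d → ℝ) :
    ξ ⬝ᵥ ξ ≤ (d ^ 2 * C ^ 2) * (J.transpose.mulVec ξ ⬝ᵥ J.transpose.mulVec ξ) := by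
  set η := J.transpose.mulVec ξ with hη
  have hξ : ξ = L.transpose.mulVec η := by
    rw [hη, Matrix.mulVec_mulVec, ← Matrix.transpose_mul, hLJ, Matrix.transpose_one,
      Matrix.one_mulVec]
  have h1 : ∀ i, ξ i * ξ i ≤ d * C ^ 2 * (η ⬝ᵥ η) := by
    intro i
    rw [hξ]
    simp only [Matrix.mulVec, dotProduct, Matrix.transpose_apply]
    rw [← pow_two]
    refine (Finset.sum_mul_sq_le_sq_mul_sq _ _ _).trans ?_
    refine mul_le_mul ?_ (le_of_eq (Finset.sum_congr rfl fun _ _ => pow_two _))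
      (Finset.sum_nonneg fun _ _ => sq_nonneg _) (by positivity)
    calc ∑ k, L k i ^ 2 ≤ ∑ _k : Fin d, C ^ 2 := Finset.sum_le_sum fun k _ => by
          rw [← sq_abs]; exact pow_le_pow_left₀ (abs_nonneg _) (hL k i) 2
      _ = _ := by simp
  calc ξ ⬝ᵥ ξ ≤ ∑ _i : Fin d, d * C ^ 2 * (η ⬝ᵥ η) := Finset.sum_le_sum fun i _ => h1 i
    _ = _ := by simp; ring

/-- The pushed form at `ξ` is `|det J|⁻¹` times the original form at `Jᵀ ξ`. The inverse Jacobian,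
bounded on `K`, keeps `Jᵀ ξ` from being small. -/
lemma IsDiffeo.pushMat_elliptic {F : E d → E d} {D D' K : Set (E d)} (h : IsDiffeo F D D')
    (hK : IsCompact K) (hKD : K ⊆ D') {B : E d → Matrix (Fin d) (Fin d) ℝ} {c : ℝ} (hc : 0 < c)
    (hB : ∀ᵐ x ∂volume.restrict D, ∀ ξ : Fin d → ℝ, c * (ξ ⬝ᵥ ξ) ≤ (B x).mulVec ξ ⬝ᵥ ξ) :
    ∃ c' : ℝ, 0 < c' ∧ ∀ᵐ y ∂volume.restrict D', y ∈ K → ∀ ξ : Fin d → ℝ,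
      c' * (ξ ⬝ᵥ ξ) ≤ (pushMat F D B y).mulVec ξ ⬝ᵥ ξ := by
  obtain ⟨C, hC, hL⟩ := exists_entry_bound hK hKD (continuousOn_jac h.2.2.2.2 h.2.1)
  obtain ⟨Cd, hCd⟩ := hK.exists_bound_of_continuousOn (h.continuousOn_det.mono hKD)
  -- An upper bound for `|det J|` times the constant of the preceding lemma; the added ones keep
  -- both factors positive.
  set m : ℝ := (d ^ 2 * C ^ 2 + 1) * (|Cd| + 1) with hm
  have hm0 : 0 < m := by positivity
  refine ⟨c / m, by positivity, ?_⟩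
  filter_upwards [h.ae_inv hB, ae_restrict_mem h.2.1.measurableSet] with y hy hyD hyK ξ
  set J := jac F (Function.invFunOn F D y) with hJ
  have hdet : 0 < |J.det| := abs_pos.2 (h.det_jac_ne_zero hyD)
  have hdet' : |J.det| ≤ |Cd| + 1 := (hCd y hyK).trans ((le_abs_self _).trans (by linarith))
  set η := J.transpose.mulVec ξ with hη
  have e1 : (pushMat F D B y).mulVec ξ ⬝ᵥ ξ
      = |J.det|⁻¹ * ((B (Function.invFunOn F D y)).mulVec η ⬝ᵥ η) := by
    simp only [pushMat, ← hJ]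
    rw [Matrix.smul_mulVec, smul_dotProduct, smul_eq_mul, ← Matrix.mulVec_mulVec,
      ← Matrix.mulVec_mulVec, ← hη, hη, Matrix.mulVec_transpose J ξ,
      dotProduct_comm (Matrix.mulVec J _) ξ, Matrix.dotProduct_mulVec, dotProduct_comm]
  have hηη : 0 ≤ η ⬝ᵥ η := Finset.sum_nonneg fun i _ => mul_self_nonneg _
  have h1 : ξ ⬝ᵥ ξ ≤ (d ^ 2 * C ^ 2 + 1) * (η ⬝ᵥ η) :=
    (dotProduct_self_le_of_transpose_mulVec (h.jac_mul_jac_inv hyD) (hL y hyK) ξ).trans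
      (by gcongr; linarith)
  rw [e1]
  calc c / m * (ξ ⬝ᵥ ξ) ≤ c / m * ((d ^ 2 * C ^ 2 + 1) * (η ⬝ᵥ η)) := by gcongr
    _ = (|Cd| + 1)⁻¹ * (c * (η ⬝ᵥ η)) := by rw [hm]; field_simp
    _ ≤ |J.det|⁻¹ * (c * (η ⬝ᵥ η)) := by gcongr
    _ ≤ _ := by gcongr; exact hy η

end NIM

end

noncomputable section

namespace NIM

variable {d : ℕ}

/-! ### The transformed coefficients -/

/-- `G ∘ F`, extended to `x₁`. -/
def Reflections.comp (R : Reflections d) : E d → E d := Function.update (R.G ∘ R.F) R.x₁ R.x₂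

namespace ReflectingComplementary

variable {M : Medium d} {R : Reflections d}

lemma comp_diffeo (hR : ReflectingComplementary M R) : IsDiffeo R.comp M.Ω₁ M.Ω₃ := hR.GF_diffeo

/-- Needed for `G` to apply. The image of `Ω₁ \ {x₁}` under `F` is open, and it misses `Ω₃` because
points of `Ω₃ \ closure Ω₂` already have their preimages outside `closure Ω₁`. An open set disjoint
from `Ω₃` is disjoint from its closure. -/
lemma F_mem_exterior (hS : M.Standing) (hR : ReflectingComplementary M R) {x : E d}
    (hx : x ∈ M.Ω₁) (hx1 : x ≠ R.x₁) : R.F x ∈ R.Ω₄ \ closure M.Ω₃ := by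
  have h12 : M.Ω₁ ⊆ M.Ω₂ := subset_closure.trans hS.sub₁₂
  have hO : IsOpen ((R.Ω₄ \ closure M.Ω₂) ∩
      Function.invFunOn R.F (M.Ω₂ \ {R.x₁}) ⁻¹' (M.Ω₁ \ {R.x₁})) :=
    hR.F_ext.continuousOn_inv.isOpen_inter_preimage hR.F_ext.2.1
      (hS.smooth₁.1.sdiff isClosed_singleton)
  have hd : Disjoint ((R.Ω₄ \ closure M.Ω₂) ∩
      Function.invFunOn R.F (M.Ω₂ \ {R.x₁}) ⁻¹' (M.Ω₁ \ {R.x₁})) M.Ω₃ := by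
    rw [Set.disjoint_left]
    rintro y ⟨hy, hy1⟩ hy3
    obtain ⟨x', hx', hx'y⟩ := hR.F_diffeo.2.2.1.surjOn (⟨hy3, hy.2⟩ : y ∈ M.Ω₃ \ closure M.Ω₂)
    have hx'1 : x' ≠ R.x₁ := fun h => hx'.2 (subset_closure (h ▸ hR.x₁_mem))
    have h2 := hR.F_ext.inv_apply (x := x') ⟨hx'.1, hx'1⟩
    rw [hx'y] at h2
    rw [mem_preimage, h2] at hy1
    exact hx'.2 (subset_closure hy1.1)
  have hF := hR.F_ext.2.2.1.mapsTo (⟨h12 hx, hx1⟩ : x ∈ M.Ω₂ \ {R.x₁})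
  refine ⟨hF.1, fun hcl => Set.disjoint_left.1 (hd.closure_right hO) ⟨hF, ?_⟩ hcl⟩
  rw [mem_preimage, hR.F_ext.inv_apply ⟨h12 hx, hx1⟩]
  exact ⟨hx, hx1⟩

/-- The preimage of a point of `Ω₃ \ {x₂}` under `G ∘ F`. -/
lemma comp_inv_spec (hS : M.Standing) (hR : ReflectingComplementary M R) {y : E d}
    (hy : y ∈ M.Ω₃) (hy2 : y ≠ R.x₂) :
    Function.invFunOn R.G (R.Ω₄ \ closure M.Ω₃) y = R.F (Function.invFunOn R.comp M.Ω₁ y) ∧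
    Function.invFunOn R.F (M.Ω₂ \ {R.x₁}) (R.F (Function.invFunOn R.comp M.Ω₁ y))
      = Function.invFunOn R.comp M.Ω₁ y ∧
    jac R.comp (Function.invFunOn R.comp M.Ω₁ y)
      = jac R.G (R.F (Function.invFunOn R.comp M.Ω₁ y))
        * jac R.F (Function.invFunOn R.comp M.Ω₁ y) := by
  set x := Function.invFunOn R.comp M.Ω₁ y with hx
  have hx1 : x ∈ M.Ω₁ := hR.comp_diffeo.inv_mem hy
  have hxy : R.comp x = y := hR.comp_diffeo.apply_inv hy
  have hne : x ≠ R.x₁ := fun h => hy2 (by rw [← hxy, h]; simp [Reflections.comp])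
  have hFx := F_mem_exterior hS hR hx1 hne
  have hGF : R.G (R.F x) = y := by rw [← hxy]; simp [Reflections.comp, hne]
  have hx2 : x ∈ M.Ω₂ \ {R.x₁} := ⟨hS.sub₁₂ (subset_closure hx1), hne⟩
  refine ⟨?_, hR.F_ext.inv_apply hx2, ?_⟩
  · rw [← hGF]; exact hR.G_diffeo.inv_apply hFx
  · rw [← jac_comp (hR.G_diffeo.differentiableAt hFx) (hR.F_ext.differentiableAt hx2)]
    refine jac_congr ?_
    filter_upwards [isOpen_ne.mem_nhds hne] with z hz
    simp [Reflections.comp, Function.update_of_ne hz]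

/-- Push-forward is functorial. The gain is that the extended `G ∘ F` is a single diffeomorphism of
`Ω₁`, so no degeneration of `F` near `x₁` enters the estimates. -/
lemma pushGFA_eq (hS : M.Standing) (hR : ReflectingComplementary M R) {y : E d}
    (hy : y ∈ M.Ω₃) (hy2 : y ≠ R.x₂) : pushGFA M R y = pushMat R.comp M.Ω₁ M.A y := by
  obtain ⟨h1, h2, h3⟩ := comp_inv_spec hS hR hy hy2
  simp only [pushGFA, pushFA, pushMat, h1, h2, h3, Matrix.det_mul, Matrix.transpose_mul, abs_mul,
    mul_inv, Matrix.mul_smul, Matrix.smul_mul, smul_smul, Matrix.mul_assoc]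

lemma pushGF_eq {V : Type} [AddCommGroup V] [Module ℝ V] (hS : M.Standing)
    (hR : ReflectingComplementary M R) {y : E d}
    (hy : y ∈ M.Ω₃) (hy2 : y ≠ R.x₂) (h : E d → V) :
    pushGF M R h y = pushFun R.comp M.Ω₁ h y := by
  obtain ⟨h1, h2, h3⟩ := comp_inv_spec hS hR hy hy2
  simp only [pushGF, pushF, pushFun, h1, h2, h3, Matrix.det_mul, abs_mul, mul_inv, smul_smul]

lemma ae_ne_x₂ (hd : 0 < d) : ∀ᵐ y : E d, y ≠ R.x₂ := by
  have : Nontrivial (E d) := Module.nontrivial_of_finrank_pos (R := ℝ) (by simpa using hd)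
  rw [ae_iff]
  simp

/-- In `Ω₃` the transformed source takes its values from `Ω₁ ⊆ Ω₃`, where `f` vanishes; outside
nothing is changed. -/
lemma hat_ae_eq (hd : 0 < d) (hS : M.Standing) (hR : ReflectingComplementary M R) {f : E d → ℂ}
    (hf : ∀ᵐ x ∂volume.restrict M.Ω₃, f x = 0) :
    ∀ᵐ x ∂(volume : Measure (E d)), hat M R f x = f x := by
  have h13 : M.Ω₁ ⊆ M.Ω₃ := subset_closure.trans <| hS.sub₁₂.trans <| subset_closure.trans hS.sub₂₃
  have h1 := hR.comp_diffeo.ae_inv (ae_mono (Measure.restrict_mono_set volume h13) hf)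
  rw [ae_restrict_iff' hS.smooth₃.1.measurableSet] at h1 hf
  filter_upwards [h1, hf, ae_ne_x₂ (R := R) hd] with y h2 h3 h4
  by_cases hy : y ∈ M.Ω₃
  · rw [hat, if_pos hy, h3 hy, pushGF_eq hS hR hy h4, pushFun]
    simp only [h2 hy, smul_zero]
  · rw [hat, if_neg hy]

/-- In the shell `F_* f` takes its values from `Ω₂ \ closure Ω₁`, which is again part of `Ω₃`. -/
lemma rhsU_ae_eq_zero (hS : M.Standing) (hR : ReflectingComplementary M R) {f : E d → ℂ}
    (hf : ∀ᵐ x ∂volume.restrict M.Ω₃, f x = 0) :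
    ∀ᵐ x ∂volume.restrict (M.Ω₃ \ closure M.Ω₂), rhsU M R f x = 0 := by
  have h23 : M.Ω₂ \ closure M.Ω₁ ⊆ M.Ω₃ := fun x hx => hS.sub₂₃ (subset_closure hx.1)
  have h1 := hR.F_diffeo.ae_inv (ae_mono (Measure.restrict_mono_set volume h23) hf)
  filter_upwards [h1, ae_mono (Measure.restrict_mono_set volume sdiff_subset) hf,
    ae_restrict_mem hR.F_diffeo.2.1.measurableSet] with y h2 h3 hy
  -- `pushF` inverts `F` on `Ω₂ \ {x₁}`, the null set argument on the smaller shell; injectivity on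
  -- the larger set identifies the two inverses.
  have h4 : Function.invFunOn R.F (M.Ω₂ \ {R.x₁}) y
      = Function.invFunOn R.F (M.Ω₂ \ closure M.Ω₁) y := by
    have hm := hR.F_diffeo.inv_mem hy
    conv_lhs => rw [← hR.F_diffeo.apply_inv hy]
    exact hR.F_ext.inv_apply ⟨hm.1, fun h => hm.2 (subset_closure (h ▸ hR.x₁_mem))⟩
  rw [rhsU, h3, sub_zero, pushF, pushFun]
  simp only [h4, h2, smul_zero]

lemma ae_Ω_of_parts (hS : M.Standing) {P : E d → Prop}
    (h1 : ∀ᵐ x ∂volume.restrict M.Ω, x ∉ M.Ω₃ → P x)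
    (h2 : ∀ᵐ x ∂volume.restrict (M.Ω₃ \ closure M.Ω₂), P x)
    (h3 : ∀ᵐ x ∂volume.restrict M.Ω₃, x ∈ closure M.Ω₂ → P x) :
    ∀ᵐ x ∂volume.restrict M.Ω, P x := by
  rw [ae_restrict_iff' (hS.smooth₃.1.sdiff isClosed_closure).measurableSet] at h2
  rw [ae_restrict_iff' hS.smooth₃.1.measurableSet] at h3
  filter_upwards [h1, ae_restrict_of_ae h2, ae_restrict_of_ae h3] with x k1 k2 k3
  by_cases hx : x ∈ M.Ω₃
  · by_cases hx2 : x ∈ closure M.Ω₂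
    · exact k3 hx hx2
    · exact k2 ⟨hx, hx2⟩
  · exact k1 hx

lemma aemeasurable_of_parts {f : E d → ℝ} (hS : M.Standing)
    (h1 : AEMeasurable f (volume.restrict M.Ω₃))
    (h2 : AEMeasurable f (volume.restrict (M.Ω \ M.Ω₃))) :
    AEMeasurable f (volume.restrict M.Ω) := by
  have : M.Ω = M.Ω₃ ∪ (M.Ω \ M.Ω₃) := by
    rw [union_sdiff_cancel (subset_closure.trans hS.sub₃)]
  rw [this]
  exact aemeasurable_union_iff.2 ⟨h1, h2⟩

lemma hatA_ae_eq (hR : ReflectingComplementary M R) (hD : DoublyInvariant M R) :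
    ∀ᵐ x ∂volume.restrict (M.Ω₃ \ closure M.Ω₂), hatA M R x = M.A x := by
  filter_upwards [hD.1, ae_restrict_mem hR.F_diffeo.2.1.measurableSet] with x h1 h2
  rw [hatA, if_pos h2.1, h1]

lemma hat_sig_ae_eq (hR : ReflectingComplementary M R)
    (hD : DoublyInvariant M R) (hk : M.k ≠ 0) :
    ∀ᵐ x ∂volume.restrict (M.Ω₃ \ closure M.Ω₂), hat M R M.sig x = M.sig x := by
  filter_upwards [hD.2 hk, ae_restrict_mem hR.F_diffeo.2.1.measurableSet] with x h1 h2
  rw [hat, if_pos h2.1, h1]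

/-- Three regions: outside `Ω₃` the coefficients are the old ones; in the shell they are the old
ones by double invariance; on the compact set `closure Ω₂ ⊆ Ω₃` they come from the diffeomorphism `G
∘ F`, whose Jacobian and its inverse are bounded there. -/
lemma coeff_hat (hd : 0 < d) (hS : M.Standing) (hR : ReflectingComplementary M R)
    (hD : DoublyInvariant M R) : Coeff M.Ω M.k (hatA M R) (hat M R M.sig) := by
  have hK : IsCompact (closure M.Ω₂) := Metric.isCompact_of_isClosed_isBounded isClosed_closure
    (hS.bdd.subset (hS.sub₂₃.trans (subset_closure.trans hS.sub₃)))
  have h1Ω : M.Ω₁ ⊆ M.Ω := subset_closure.trans <| hS.sub₁₂.trans <| subset_closure.trans <|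
    hS.sub₂₃.trans <| subset_closure.trans hS.sub₃
  have h3Ω : M.Ω₃ ⊆ M.Ω := subset_closure.trans hS.sub₃
  have r1 := Measure.restrict_mono_set volume h1Ω
  have r23 := Measure.restrict_mono_set volume ((sdiff_subset (t := closure M.Ω₂)).trans h3Ω)
  have hA3 : ∀ᵐ y ∂volume.restrict M.Ω₃, hatA M R y = pushMat R.comp M.Ω₁ M.A y := by
    filter_upwards [ae_restrict_of_ae (ae_ne_x₂ (R := R) hd),
      ae_restrict_mem hS.smooth₃.1.measurableSet] with y h1 h2
    rw [hatA, if_pos h2, pushGFA_eq hS hR h2 h1]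
  have hs3 : ∀ᵐ y ∂volume.restrict M.Ω₃, hat M R M.sig y = pushFun R.comp M.Ω₁ M.sig y := by
    filter_upwards [ae_restrict_of_ae (ae_ne_x₂ (R := R) hd),
      ae_restrict_mem hS.smooth₃.1.measurableSet] with y h1 h2
    rw [hat, if_pos h2, pushGF_eq hS hR h2 h1]
  refine ⟨fun i j => ?_, ?_, ?_⟩
  · have hm : AEMeasurable (fun x => hatA M R x i j) (volume.restrict M.Ω) := by
      refine aemeasurable_of_parts hS ?_ ?_
      · refine (hR.comp_diffeo.aemeasurable_pushMat
          (fun i j => (hS.meas_A i j).mono_measure r1) i j).congr ?_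
        filter_upwards [hA3] with y hy
        rw [hy]
      · refine ((hS.meas_A i j).mono_measure (Measure.restrict_mono_set _ sdiff_subset)).congr ?_
        filter_upwards [ae_restrict_mem
          (hS.smooth.1.measurableSet.diff hS.smooth₃.1.measurableSet)] with y hy
        rw [hatA, if_neg hy.2]
    obtain ⟨C, hC⟩ := hS.bdd_A
    obtain ⟨C', hC'⟩ := hR.comp_diffeo.pushMat_bounded hK hS.sub₂₃ (ae_mono r1 hC)
    have hb : ∀ᵐ x ∂volume.restrict M.Ω, |hatA M R x i j| ≤ max C C' := by
      refine ae_Ω_of_parts hS ?_ ?_ ?_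
      · filter_upwards [hC] with x hx hx3
        rw [hatA, if_neg hx3]
        exact (hx i j).trans (le_max_left _ _)
      · filter_upwards [hatA_ae_eq hR hD, ae_mono r23 hC] with x h1 h2
        rw [h1]
        exact (h2 i j).trans (le_max_left _ _)
      · filter_upwards [hA3, hC'] with x h1 h2 h3
        rw [h1]
        exact (h2 h3 i j).trans (le_max_right _ _)
    refine memLp_top_of_bound (Complex.measurable_ofReal.comp_aemeasurable
      hm).aestronglyMeasurable (max C C') ?_
    filter_upwards [hb] with x hx
    simpa using hx
  · obtain ⟨Λ, hΛ, hA⟩ := hS.elliptic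
    have hA' : ∀ᵐ x ∂volume.restrict M.Ω, ∀ ξ : Fin d → ℝ,
        Λ⁻¹ * (ξ ⬝ᵥ ξ) ≤ (M.A x).mulVec ξ ⬝ᵥ ξ := by
      filter_upwards [hA] with x hx ξ using (hx ξ).1
    obtain ⟨c', hc', hC'⟩ := hR.comp_diffeo.pushMat_elliptic hK hS.sub₂₃ (inv_pos.2 hΛ)
      (ae_mono r1 hA')
    have hn : ∀ ξ : Fin d → ℝ, 0 ≤ ξ ⬝ᵥ ξ := fun ξ =>
      Finset.sum_nonneg fun i _ => mul_self_nonneg _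
    have hl : ∀ ξ : Fin d → ℝ, min Λ⁻¹ c' * (ξ ⬝ᵥ ξ) ≤ Λ⁻¹ * (ξ ⬝ᵥ ξ) := fun ξ =>
      mul_le_mul_of_nonneg_right (min_le_left _ _) (hn ξ)
    have hl' : ∀ ξ : Fin d → ℝ, min Λ⁻¹ c' * (ξ ⬝ᵥ ξ) ≤ c' * (ξ ⬝ᵥ ξ) := fun ξ =>
      mul_le_mul_of_nonneg_right (min_le_right _ _) (hn ξ)
    refine ⟨min Λ⁻¹ c', lt_min (inv_pos.2 hΛ) hc', ae_Ω_of_parts hS ?_ ?_ ?_⟩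
    · filter_upwards [hA'] with x hx hx3 ξ
      rw [hatA, if_neg hx3]
      exact (hl ξ).trans (hx ξ)
    · filter_upwards [hatA_ae_eq hR hD, ae_mono r23 hA'] with x h1 h2 ξ
      rw [h1]
      exact (hl ξ).trans (h2 ξ)
    · filter_upwards [hA3, hC'] with x h1 h2 h3 ξ
      rw [h1]
      exact (hl' ξ).trans (h2 h3 ξ)
  -- For `k = 0` invariance of `Σ` is not available, but the lower order coefficient `k²Σ̂` is zero.
  · by_cases hk : M.k = 0
    · simp [hk]
    have hm : AEMeasurable (hat M R M.sig) (volume.restrict M.Ω) := by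
      refine aemeasurable_of_parts hS ?_ ?_
      · refine (hR.comp_diffeo.aemeasurable_pushFun (hS.meas_sig.mono_measure r1)).congr ?_
        filter_upwards [hs3] with y hy
        rw [hy]
      · refine (hS.meas_sig.mono_measure (Measure.restrict_mono_set _ sdiff_subset)).congr ?_
        filter_upwards [ae_restrict_mem
          (hS.smooth.1.measurableSet.diff hS.smooth₃.1.measurableSet)] with y hy
        rw [hat, if_neg hy.2]
    obtain ⟨c, C, hc, hC⟩ := hS.bdd_sig
    have hC1 : ∀ᵐ x ∂volume.restrict M.Ω, |M.sig x| ≤ C := by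
      filter_upwards [hC] with x hx
      rw [abs_of_nonneg (hc.le.trans hx.1)]; exact hx.2
    obtain ⟨Cd, hCd⟩ := hK.exists_bound_of_continuousOn
      (hR.comp_diffeo.continuousOn_inv_det.mono hS.sub₂₃)
    have hb : ∀ᵐ x ∂volume.restrict M.Ω, |hat M R M.sig x| ≤ max C (Cd * C) := by
      refine ae_Ω_of_parts hS ?_ ?_ ?_
      · filter_upwards [hC1] with x hx hx3
        rw [hat, if_neg hx3]
        exact hx.trans (le_max_left _ _)
      · filter_upwards [hat_sig_ae_eq hR hD hk, ae_mono r23 hC1] with x h1 h2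
        rw [h1]
        exact h2.trans (le_max_left _ _)
      · filter_upwards [hs3, hR.comp_diffeo.ae_inv (ae_mono r1 hC1)] with x h1 h2 h3
        rw [h1, pushFun, smul_eq_mul, abs_mul]
        refine le_trans ?_ (le_max_right _ _)
        exact mul_le_mul (hCd x h3) h2 (abs_nonneg _) ((norm_nonneg _).trans (hCd x h3))
    refine memLp_top_of_bound ((Complex.measurable_ofReal.comp_aemeasurable
      hm).const_mul _).aestronglyMeasurable (|M.k| ^ 2 * max C (Cd * C)) ?_
    filter_upwards [hb] with x hx
    simp only [norm_mul, norm_pow, Complex.norm_real, Real.norm_eq_abs]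
    gcongr

end ReflectingComplementary

end NIM

end

noncomputable section

namespace NIM

variable {d : ℕ}

/-! ### Operations on weak solutions and on functions with vanishing trace -/

lemma isH1_zero (D : Set (E d)) : IsH1 D 0 0 :=
  ⟨MemLp.zero, fun _ => MemLp.zero, fun _ _ _ => by simp [bdryTrace]⟩

lemma bdryTrace_zero (D : Set (E d)) (i : Fin d) (φ : E d → ℝ) : bdryTrace D 0 0 i φ = 0 := by
  simp [bdryTrace]

lemma bdryFlux_zero {D : Set (E d)} {k : ℝ} {B : E d → Matrix (Fin d) (Fin d) ℝ} {σ : E d → ℝ}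
    {h : E d → ℂ} (hh : ∀ᵐ x ∂volume.restrict D, h x = 0) (φ : E d → ℝ) :
    bdryFlux D k B σ h 0 0 φ = 0 := by
  rw [bdryFlux_congr_rhs (f' := 0) hh]
  simp [bdryFlux]

lemma bdryFlux_congr {D : Set (E d)} {k : ℝ} {B B' : E d → Matrix (Fin d) (Fin d) ℝ}
    {σ σ' : E d → ℝ} {h h' u : E d → ℂ} {g : E d → Fin d → ℂ} {φ : E d → ℝ}
    (hB : ∀ᵐ x ∂volume.restrict D, B x = B' x)
    (hσ : k ≠ 0 → ∀ᵐ x ∂volume.restrict D, σ x = σ' x)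
    (hh : ∀ᵐ x ∂volume.restrict D, h x = h' x) :
    bdryFlux D k B σ h u g φ = bdryFlux D k B' σ' h' u g φ := by
  refine integral_congr_ae ?_
  by_cases hk : k = 0
  · filter_upwards [hB, hh] with x h1 h3
    simp [h1, h3, hk]
  · filter_upwards [hB, hσ hk, hh] with x h1 h2 h3
    rw [h1, h2, h3]

lemma IsWeakSol.sub {D : Set (E d)} {k : ℝ} {B : E d → Matrix (Fin d) (Fin d) ℝ} {σ : E d → ℝ}
    (hB : Coeff D k B σ) {h u v : E d → ℂ} {g q : E d → Fin d → ℂ}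
    (hh : MemLp h 2 (volume.restrict D)) (hu : IsH1 D u g) (hv : IsH1 D v q)
    (hus : IsWeakSol D k B σ h u g) (hvs : IsWeakSol D k B σ h v q) :
    IsWeakSol D k B σ 0 (fun x => u x - v x) (fun x i => g x i - q x i) := by
  intro φ hφ
  have h1 := green_sub (hB.isL2 hh hu.1 hu.2.1) (hB.isL2 hh hv.1 hv.2.1) hφ
  rw [← bdryFlux_eq_green, ← bdryFlux_eq_green, hus φ hφ, hvs φ hφ, sub_zero] at h1
  rw [bdryFlux_eq_green]
  refine Eq.trans (green_congr (.of_forall fun x => ⟨fun i => ?_, ?_⟩)) h1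
  · simp [mul_sub, Finset.sum_sub_distrib]
  · simp only [Pi.zero_apply]; ring

lemma VanishesOn.sub {D S : Set (E d)} {u v : E d → ℂ} {g q : E d → Fin d → ℂ}
    (hu1 : IsH1 D u g) (hv1 : IsH1 D v q)
    (hu : VanishesOn D S u g) (hv : VanishesOn D S v q) :
    VanishesOn D S (fun x => u x - v x) (fun x i => g x i - q x i) := by
  intro ε hε
  have hε2 : 0 < ε / 2 := ENNReal.half_pos hε.ne'
  obtain ⟨u', g', hu', ⟨N, hN, hSN, hNu⟩, h1, h2⟩ := hu _ hε2
  obtain ⟨v', q', hv', ⟨N', hN', hSN', hNv⟩, k1, k2⟩ := hv _ hε2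
  have key : ∀ {a a' b b' : E d → ℂ}, MemLp a 2 (volume.restrict D) →
      MemLp a' 2 (volume.restrict D) → MemLp b 2 (volume.restrict D) →
      MemLp b' 2 (volume.restrict D) →
      eLpNorm (fun x => a x - a' x) 2 (volume.restrict D) < ε / 2 →
      eLpNorm (fun x => b x - b' x) 2 (volume.restrict D) < ε / 2 →
      eLpNorm (fun x => (a x - b x) - (a' x - b' x)) 2 (volume.restrict D) < ε := by
    intro a a' b b' ha ha' hb hb' hlt hlt'
    have e : (fun x => (a x - b x) - (a' x - b' x))
        = (fun x => a x - a' x) - fun x => b x - b' x := by ext x; simp; ring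
    rw [e]
    calc _ ≤ _ := eLpNorm_sub_le (ha.sub ha').1 (hb.sub hb').1 one_le_two
      _ < ε / 2 + ε / 2 := ENNReal.add_lt_add hlt hlt'
      _ = ε := ENNReal.add_halves ε
  refine ⟨_, _, hu'.sub hv', ⟨N ∩ N', hN.inter hN', subset_inter hSN hSN', ?_⟩,
    key hu1.1 hu'.1 hv1.1 hv'.1 h1 k1,
    fun i => key (hu1.2.1 i) (hu'.2.1 i) (hv1.2.1 i) (hv'.2.1 i) (h2 i) (k2 i)⟩
  filter_upwards [ae_mono (Measure.restrict_mono_set volume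
      (inter_subset_inter_right D inter_subset_left)) hNu,
    ae_mono (Measure.restrict_mono_set volume
      (inter_subset_inter_right D inter_subset_right)) hNv] with x h3 h4
  rw [h3, h4, sub_zero]

lemma VanishesOn.mono {D D' S : Set (E d)} {u : E d → ℂ} {g : E d → Fin d → ℂ}
    (hu : VanishesOn D' S u g) (hD' : MeasurableSet D') (hD : D ⊆ D') : VanishesOn D S u g := by
  intro ε hε
  obtain ⟨u', g', hu', ⟨N, hN, hSN, hNu⟩, h1, h2⟩ := hu _ hε
  have hμ := Measure.restrict_mono_set volume hD
  exact ⟨u', g', hu'.mono hD' hD, ⟨N, hN, hSN,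
    ae_mono (Measure.restrict_mono_set volume (inter_subset_inter_left N hD)) hNu⟩,
    (eLpNorm_mono_measure _ hμ).trans_lt h1, fun i => (eLpNorm_mono_measure _ hμ).trans_lt (h2 i)⟩

/-- The approximants `v` of `W` vanish near `∂Ω` but may jump across the set `Ω \ D` inside `K`.
They are replaced by `W + ζ (v - W)`, where `ζ` vanishes near `K` and equals 1 near `∂Ω`: this is
`W` itself near `K`, where it is `H¹`, and `v` near `∂Ω`. -/
lemma VanishesOn.extend {D Ω K : Set (E d)} {W : E d → ℂ} {g : E d → Fin d → ℂ}
    (hΩ : IsOpen Ω) (hae : D =ᵐ[volume] Ω) (hK : IsCompact K) (hKΩ : K ⊆ Ω)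
    (hKD : Ω \ K ⊆ D) (hW : IsH1 Ω W g) (hWD : IsH1 D W g) (hv : VanishesOn D (frontier Ω) W g) :
    VanishesOn Ω (frontier Ω) W g := by
  intro ε hε
  obtain ⟨χ, hχ, ⟨N₀, hN₀, hKN₀, hχ1⟩, hχI⟩ := exists_cutoff hK hΩ hKΩ
  set ζ : E d → ℝ := fun x => 1 - χ x with hζdef
  have hζ : ContDiff ℝ ∞ ζ := contDiff_const.sub hχ.1
  have hpd : ∀ i x, pd i ζ x = -pd i χ x := fun i x => by
    simp only [pd, hζdef]
    rw [fderiv_const_sub]; rfl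
  choose C hC0 hC using fun i => (hχ.pd i).bounded
  -- A common bound for `ζ` and all its partial derivatives.
  set c : ℝ := 1 + ∑ i, C i with hc
  have hC0' : 0 ≤ ∑ i, C i := Finset.sum_nonneg fun i _ => hC0 i
  have hc1 : 1 ≤ c := by rw [hc]; linarith
  have hζc : ∀ x, |ζ x| ≤ c := fun x => by
    have := hχI x
    rw [abs_le]
    constructor <;> simp only [hζdef] <;> linarith [this.1, this.2]
  have hpdc : ∀ i x, |pd i ζ x| ≤ c := fun i x => by
    rw [hpd, abs_neg]
    refine (hC i x).trans ?_
    have := Finset.single_le_sum (f := C) (fun i _ => hC0 i) (Finset.mem_univ i)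
    rw [hc]; linarith
  have hce : ENNReal.ofReal c ≠ 0 := by simp; linarith
  -- The gradient error has two terms, `ζ` times a gradient error and a derivative of `ζ` times a
  -- function error, each below `c ε'`; their bounds add up to `ε`.
  set ε' : ℝ≥0∞ := ε / (2 * ENNReal.ofReal c) with hε'
  have hε'0 : 0 < ε' := ENNReal.div_pos hε.ne' (by finiteness)
  have hε'c : ENNReal.ofReal c * ε' + ENNReal.ofReal c * ε' = ε := by
    rw [← two_mul, ← mul_assoc, hε', ENNReal.mul_div_cancel (by simpa using hce) (by finiteness)]
  obtain ⟨v, h, hvh, ⟨N, hN, hSN, hNv⟩, h1, h2⟩ := hv _ hε'0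
  have hμ : volume.restrict Ω = volume.restrict D := Measure.restrict_congr_set hae.symm
  have hw := hvh.sub hWD
  have hext := hw.mul_extend hae hζ hζc hpdc fun φ hφ =>
    (hφ.mul_left_of_eq_zero hζ hN₀ fun x hx => by simp [hζdef, hχ1 x hx]).mono
      fun x hx => hKD ⟨hx.1, fun hxK => hx.2 (hKN₀ hxK)⟩
  refine ⟨_, _, hW.add hext, ⟨N ∩ (tsupport χ)ᶜ, hN.inter (isClosed_tsupport χ).isOpen_compl,
    fun x hx => ⟨hSN hx, fun hxχ => ?_⟩, ?_⟩, ?_, fun i => ?_⟩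
  · rw [frontier, hΩ.interior_eq] at hx
    exact hx.2 (hχ.2.2 hxχ)
  · have hsub : (Ω ∩ (N ∩ (tsupport χ)ᶜ) : Set (E d)) =ᵐ[volume]
        (D ∩ (N ∩ (tsupport χ)ᶜ) : Set (E d)) := hae.symm.inter (ae_eq_refl _)
    rw [Measure.restrict_congr_set hsub]
    have hm : MeasurableSet (N ∩ (tsupport χ)ᶜ) :=
      (hN.inter (isClosed_tsupport χ).isOpen_compl).measurableSet
    have hmem : ∀ᵐ x ∂volume.restrict (D ∩ (N ∩ (tsupport χ)ᶜ)), x ∈ N ∩ (tsupport χ)ᶜ :=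
      ae_mono (Measure.restrict_mono_set volume inter_subset_right) (ae_restrict_mem hm)
    filter_upwards [ae_mono (Measure.restrict_mono_set volume
      (inter_subset_inter_right D inter_subset_left)) hNv, hmem] with x hx hx'
    have : χ x = 0 := image_eq_zero_of_notMem_tsupport hx'.2
    simp [hζdef, this, hx]
  · refine lt_of_le_of_lt (eLpNorm_le_mul_eLpNorm_of_ae_le_mul
      (g := fun x => W x - v x) (c := c) (.of_forall fun x => ?_) 2) ?_
    · rw [← norm_neg]
      have : -(W x - (W x + (ζ x : ℂ) * (v x - W x))) = ζ x * -(W x - v x) := by ring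
      rw [this, norm_mul, norm_neg]
      gcongr
      simpa using hζc x
    · rw [hμ]
      calc _ < ENNReal.ofReal c * ε' := ENNReal.mul_lt_mul_right hce (by finiteness) h1
        _ ≤ _ := hε'c ▸ le_self_add
  · have e : (fun x => g x i - (g x i + ((ζ x : ℂ) * (h x i - g x i) + (v x - W x) * pd i ζ x)))
        = (fun x => (ζ x : ℂ) * (g x i - h x i)) + fun x => (pd i ζ x : ℂ) * (W x - v x) := by
      ext x; simp only [Pi.add_apply]; ring
    rw [e, hμ]
    have b1 : eLpNorm (fun x => (ζ x : ℂ) * (g x i - h x i)) 2 (volume.restrict D)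
        ≤ ENNReal.ofReal c * eLpNorm (fun x => g x i - h x i) 2 (volume.restrict D) :=
      eLpNorm_le_mul_eLpNorm_of_ae_le_mul (.of_forall fun x => by
        rw [norm_mul]; gcongr; simpa using hζc x) 2
    have b2 : eLpNorm (fun x => (pd i ζ x : ℂ) * (W x - v x)) 2 (volume.restrict D)
        ≤ ENNReal.ofReal c * eLpNorm (fun x => W x - v x) 2 (volume.restrict D) :=
      eLpNorm_le_mul_eLpNorm_of_ae_le_mul (.of_forall fun x => by
        rw [norm_mul]; gcongr; simpa using hpdc i x) 2
    have m1 : AEStronglyMeasurable (fun x => (ζ x : ℂ) * (g x i - h x i)) (volume.restrict D) :=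
      (Complex.continuous_ofReal.comp hζ.continuous).aestronglyMeasurable.mul
        ((hWD.2.1 i).sub (hvh.2.1 i)).1
    have m2 : AEStronglyMeasurable (fun x => (pd i ζ x : ℂ) * (W x - v x)) (volume.restrict D) :=
      (Complex.continuous_ofReal.comp (contDiff_pd hζ i).continuous).aestronglyMeasurable.mul
        (hWD.1.sub hvh.1).1
    calc _ ≤ _ := eLpNorm_add_le m1 m2 one_le_two
      _ ≤ _ := add_le_add b1 b2
      _ < ENNReal.ofReal c * ε' + ENNReal.ofReal c * ε' :=
        ENNReal.add_lt_add (ENNReal.mul_lt_mul_right hce (by finiteness) (h2 i))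
          (ENNReal.mul_lt_mul_right hce (by finiteness) h1)
      _ = ε := hε'c

/-- A weak equation is local: a cutoff splits each test function into a part supported in `Ω₃` and a
part supported off `K`. -/
lemma green_eq_zero_of_cover {Ω Ω₃ K : Set (E d)} {p : E d → Fin d → ℂ} {s : E d → ℂ}
    (hp : IsL2 Ω p s) (hK : IsCompact K) (hΩ₃ : IsOpen Ω₃) (hK3 : K ⊆ Ω₃)
    (h1 : ∀ φ, IsTest Ω₃ φ → green Ω p s φ = 0)
    (h2 : ∀ φ, IsTest (Ω \ K) φ → green Ω p s φ = 0) {φ : E d → ℝ} (hφ : IsTest Ω φ) :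
    green Ω p s φ = 0 := by
  obtain ⟨χ, hχ, ⟨N, hN, hKN, hχ1⟩, -⟩ := exists_cutoff hK hΩ₃ hK3
  have t1 : IsTest Ω₃ (fun x => χ x * φ x) :=
    (hφ.mul_left_of_tsupport hχ.1 hχ.2.2).mono inter_subset_right
  have t2 : IsTest (Ω \ K) (fun x => (1 - χ x) * φ x) :=
    (hφ.mul_left_of_eq_zero (contDiff_const.sub hχ.1) hN fun x hx => by simp [hχ1 x hx]).mono
      (sdiff_subset_sdiff_right hKN)
  have e : φ = fun x => χ x * φ x + (1 - χ x) * φ x := by ext x; ring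
  rw [e, green_add_test hp t1 t2, h1 _ t1, h2 _ t2, add_zero]

end NIM

end

noncomputable section

namespace NIM

variable {d : ℕ}

/-! ### Compatibility of sources vanishing in `Ω₃` -/

lemma ae_eq_sdiff_frontier {Ω Ω₃ : Set (E d)} (h3 : IsSmoothOpen Ω₃) :
    (Ω \ frontier Ω₃ : Set (E d)) =ᵐ[volume] Ω :=
  sdiff_null_ae_eq_self h3.volume_frontier

/-- The interface `∂Ω₃` is a null set, so the integral over `Ω` is the sum of the two one-sided
ones. For an equation holding across the interface the two one-sided boundary terms therefore
cancel. -/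
lemma green_split {Ω Ω₃ O : Set (E d)} (h3 : IsSmoothOpen Ω₃) (hsub : Ω₃ ⊆ Ω)
    {p : E d → Fin d → ℂ} {s : E d → ℂ} {φ : E d → ℝ} (h : IsL2 Ω p s) (hφ : IsTest O φ) :
    green Ω p s φ = green (Ω \ closure Ω₃) p s φ + green Ω₃ p s φ := by
  have e : (Ω \ closure Ω₃) ∪ Ω₃ = Ω \ frontier Ω₃ := by
    ext x
    have h1 : Ω₃ ⊆ closure Ω₃ := subset_closure
    rw [frontier, h3.1.interior_eq]
    constructor
    · rintro (⟨ha, hb⟩ | ha)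
      · exact ⟨ha, fun h => hb h.1⟩
      · exact ⟨hsub ha, fun h => h.2 ha⟩
    · rintro ⟨ha, hb⟩
      by_cases hx : x ∈ Ω₃
      · exact Or.inr hx
      · exact Or.inl ⟨ha, fun h => hb ⟨h, hx⟩⟩
  have e' := ae_eq_sdiff_frontier (Ω := Ω) h3
  rw [← e] at e'
  rw [← green_congr_set e', green_union (disjoint_sdiff_left.mono_right subset_closure)
    h3.1.measurableSet (h.mono (union_subset sdiff_subset hsub)) hφ]

section

variable {M : Medium d} {R : Reflections d} {f : E d → ℂ}

lemma Medium.Standing.sub₃' (hS : M.Standing) : M.Ω₃ ⊆ M.Ω := subset_closure.trans hS.sub₃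

lemma solvesU_zero (hS : M.Standing) (hR : ReflectingComplementary M R)
    (hf : ∀ᵐ x ∂volume.restrict M.Ω₃, f x = 0) : SolvesU M R f 0 0 where
  h1 := isH1_zero _
  eqn φ _ := bdryFlux_zero (hR.rhsU_ae_eq_zero hS hf) φ
  dirichlet i φ _ := bdryTrace_zero _ i φ
  neumann φ _ := bdryFlux_zero (hR.rhsU_ae_eq_zero hS hf) φ

variable {W : E d → ℂ} {gW : E d → Fin d → ℂ}

lemma bdryTrace_split (hS : M.Standing) (hW : IsH1 M.Ω W gW) {O : Set (E d)} {φ : E d → ℝ}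
    (hφ : IsTest O φ) (i : Fin d) : bdryTrace M.Ω W gW i φ
      = bdryTrace (M.Ω \ closure M.Ω₃) W gW i φ + bdryTrace M.Ω₃ W gW i φ := by
  simp only [bdryTrace_eq_green]
  exact green_split hS.smooth₃ hS.sub₃' (hW.isL2 i) hφ

lemma bdryFlux_split (hS : M.Standing) {k : ℝ} {B : E d → Matrix (Fin d) (Fin d) ℝ} {σ : E d → ℝ}
    (hB : Coeff M.Ω k B σ) {h : E d → ℂ} (hh : MemLp h 2 (volume.restrict M.Ω))
    (hW : MemLp W 2 (volume.restrict M.Ω))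
    (hg : ∀ i, MemLp (fun x => gW x i) 2 (volume.restrict M.Ω))
    {O : Set (E d)} {φ : E d → ℝ} (hφ : IsTest O φ) : bdryFlux M.Ω k B σ h W gW φ
      = bdryFlux (M.Ω \ closure M.Ω₃) k B σ h W gW φ + bdryFlux M.Ω₃ k B σ h W gW φ := by
  simp only [bdryFlux_eq_green]
  exact green_split hS.smooth₃ hS.sub₃' (hB.isL2 hh hW hg) hφ

lemma bdryFlux_hat_rhs (hd : 0 < d) (hS : M.Standing) (hR : ReflectingComplementary M R)
    (hf : ∀ᵐ x ∂volume.restrict M.Ω₃, f x = 0) {D : Set (E d)} {k : ℝ}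
    {B : E d → Matrix (Fin d) (Fin d) ℝ} {σ : E d → ℝ} {φ : E d → ℝ} :
    bdryFlux D k B σ (hat M R f) W gW φ = bdryFlux D k B σ f W gW φ :=
  bdryFlux_congr_rhs (ae_restrict_of_ae (hR.hat_ae_eq hd hS hf))

/-- For test functions crossing `∂Ω₃`, the global weak identities split into the two sides, and this
is exactly the absence of jumps. -/
lemma solvesW_of_isWeakSol (hd : 0 < d) (hS : M.Standing) (hR : ReflectingComplementary M R)
    (hD : DoublyInvariant M R) (hfL : MemLp f 2 (volume.restrict M.Ω))
    (hf : ∀ᵐ x ∂volume.restrict M.Ω₃, f x = 0) (hW : IsH1 M.Ω W gW)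
    (hv : VanishesOn M.Ω (frontier M.Ω) W gW)
    (hs : IsWeakSol M.Ω M.k (hatA M R) (hat M R M.sig) f W gW) : SolvesW M R f 0 0 W gW where
  h1 := hW.mono hS.smooth.1.measurableSet sdiff_subset
  eqn φ hφ := by
    rw [bdryFlux_hat_rhs hd hS hR hf]
    exact hs.mono hS.smooth.1.measurableSet sdiff_subset φ hφ
  dirichlet := hv.mono hS.smooth.1.measurableSet sdiff_subset
  jump i φ hφ := by
    have := bdryTrace_split hS hW hφ i
    rw [hW.2.2 i φ (hφ.mono sdiff_subset)] at this
    rw [bdryTrace_zero, neg_zero]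
    linear_combination this
  flux_jump φ hφ := by
    have := bdryFlux_split hS (hR.coeff_hat hd hS hD) hfL hW.1 hW.2.1 hφ
    rw [hs φ (hφ.mono sdiff_subset)] at this
    rw [bdryFlux_zero (hR.rhsU_ae_eq_zero hS hf), neg_zero]
    simp only [bdryFlux_hat_rhs hd hS hR hf]
    linear_combination this

/-- The one-sided terms of `W` at `∂Ω₃` are opposite. The inner one reduces from `Ω₃` to the shell,
since the test functions vanish on `closure Ω₂`, and there `(Â, Σ̂)` may be replaced by `(A, Σ)` in
the equation. -/
lemma solvesV_of_isWeakSol (hd : 0 < d) (hS : M.Standing) (hR : ReflectingComplementary M R)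
    (hD : DoublyInvariant M R) (hfL : MemLp f 2 (volume.restrict M.Ω))
    (hW : IsH1 M.Ω W gW)
    (hs : IsWeakSol M.Ω M.k (hatA M R) (hat M R M.sig) f W gW) : SolvesV M f W gW W gW := by
  have h3 : M.Ω₃ \ closure M.Ω₂ ⊆ M.Ω := sdiff_subset.trans hS.sub₃'
  have hin : ∀ φ, bdryFlux (M.Ω₃ \ closure M.Ω₂) M.k M.A M.sig f W gW φ
      = bdryFlux (M.Ω₃ \ closure M.Ω₂) M.k (hatA M R) (hat M R M.sig) f W gW φ := fun φ =>
    (bdryFlux_congr (hR.hatA_ae_eq hD) (hR.hat_sig_ae_eq hD) (.of_forall fun _ => rfl)).symm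
  have hsub : ∀ {p : E d → Fin d → ℂ} {s : E d → ℂ} {φ}, IsTest (M.Ω \ closure M.Ω₂) φ →
      green (M.Ω₃ \ closure M.Ω₂) p s φ = green M.Ω₃ p s φ := fun hφ =>
    green_eq_of_subset hφ hS.smooth₃.1.measurableSet sdiff_subset fun x hx => ⟨hx.1, hx.2.2⟩
  refine ⟨hW.mono hS.smooth.1.measurableSet h3, fun φ hφ => ?_, fun i φ hφ => ?_, fun φ hφ => ?_⟩
  · rw [hin]
    exact hs.mono hS.smooth.1.measurableSet h3 φ hφ
  · have := bdryTrace_split hS hW hφ i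
    rw [hW.2.2 i φ (hφ.mono sdiff_subset)] at this
    rw [bdryTrace_eq_green, hsub hφ, ← bdryTrace_eq_green]
    linear_combination -this
  · have := bdryFlux_split hS (hR.coeff_hat hd hS hD) hfL hW.1 hW.2.1 hφ
    rw [hs φ (hφ.mono sdiff_subset)] at this
    have hout : ∀ᵐ x ∂volume.restrict (M.Ω \ closure M.Ω₃), x ∉ M.Ω₃ := by
      filter_upwards [ae_restrict_mem
        (hS.smooth.1.sdiff isClosed_closure).measurableSet] with x hx h
      exact hx.2 (subset_closure h)
    rw [hin, bdryFlux_eq_green, hsub hφ, ← bdryFlux_eq_green,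
      bdryFlux_congr (B := M.A) (B' := hatA M R) (σ := M.sig) (σ' := hat M R M.sig)
        (D := M.Ω \ closure M.Ω₃) (h' := f)
        (by filter_upwards [hout] with x hx; rw [hatA, if_neg hx])
        (fun _ => by filter_upwards [hout] with x hx; rw [hat, if_neg hx])
        (.of_forall fun _ => rfl)]
    linear_combination -this

/-- A solution of the transmission problem without jumps is a solution across `∂Ω₃`. -/
lemma SolvesW.isWeakSol (hd : 0 < d) (hS : M.Standing) (hR : ReflectingComplementary M R)
    (hD : DoublyInvariant M R) (hfL : MemLp f 2 (volume.restrict M.Ω))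
    (hf : ∀ᵐ x ∂volume.restrict M.Ω₃, f x = 0) (h : SolvesW M R f 0 0 W gW) :
    IsH1 M.Ω W gW ∧ VanishesOn M.Ω (frontier M.Ω) W gW ∧
      IsWeakSol M.Ω M.k (hatA M R) (hat M R M.sig) f W gW := by
  have hae := ae_eq_sdiff_frontier (Ω := M.Ω) hS.smooth₃
  have hμ : volume.restrict (M.Ω \ frontier M.Ω₃) = volume.restrict M.Ω :=
    Measure.restrict_congr_set hae
  have hcpt : ∀ {S : Set (E d)}, S ⊆ M.Ω → IsClosed S → IsCompact S := fun hSΩ hc =>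
    Metric.isCompact_of_isClosed_isBounded hc (hS.bdd.subset hSΩ)
  have hK2 := hcpt (hS.sub₂₃.trans hS.sub₃') isClosed_closure
  have hK3 := hcpt hS.sub₃ isClosed_closure
  have h3sub : M.Ω₃ ⊆ M.Ω \ frontier M.Ω₃ := fun x hx =>
    ⟨hS.sub₃' hx, fun h => (hS.smooth₃.1.frontier_eq ▸ h).2 hx⟩
  have hW2 : MemLp W 2 (volume.restrict M.Ω) := hμ ▸ h.h1.1
  have hg2 : ∀ i, MemLp (fun x => gW x i) 2 (volume.restrict M.Ω) := hμ ▸ h.h1.2.1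
  have hH1 : IsH1 M.Ω W gW := by
    refine ⟨hW2, hg2, fun i φ hφ => ?_⟩
    have hL : IsL2 M.Ω (fun x j => if j = i then W x else 0) (fun x => gW x i) := by
      have := h.h1.isL2 i
      rwa [IsL2, hμ] at this
    rw [bdryTrace_eq_green]
    -- Test functions in `Ω₃` are covered by the weak gradient relation in `Ω \ ∂Ω₃`, those off
    -- `closure Ω₂` by the jump condition.
    refine green_eq_zero_of_cover hL hK2 hS.smooth₃.1 hS.sub₂₃ (fun φ hφ => ?_)
      (fun φ hφ => ?_) hφ
    · rw [← green_congr_set hae, ← bdryTrace_eq_green]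
      exact h.h1.2.2 i φ (hφ.mono h3sub)
    · have h1 := h.jump i φ hφ
      rw [bdryTrace_zero] at h1
      rw [green_split hS.smooth₃ hS.sub₃' hL hφ, ← bdryTrace_eq_green, ← bdryTrace_eq_green]
      linear_combination -h1
  refine ⟨hH1, h.dirichlet.extend hS.smooth.1 hae hK3 hS.sub₃
    (sdiff_subset_sdiff_right frontier_subset_closure) hH1 h.h1, fun φ hφ => ?_⟩
  have hC := hR.coeff_hat hd hS hD
  have hL := hC.isL2 hfL hW2 hg2
  rw [bdryFlux_eq_green]
  refine green_eq_zero_of_cover hL hK2 hS.smooth₃.1 hS.sub₂₃ (fun φ hφ => ?_) (fun φ hφ => ?_) hφ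
  · rw [← green_congr_set hae, ← bdryFlux_eq_green, ← bdryFlux_hat_rhs hd hS hR hf]
    exact h.eqn φ (hφ.mono h3sub)
  · have h1 := h.flux_jump φ hφ
    rw [bdryFlux_zero (hR.rhsU_ae_eq_zero hS hf)] at h1
    simp only [bdryFlux_hat_rhs hd hS hR hf] at h1
    rw [green_split hS.smooth₃ hS.sub₃' hL hφ, ← bdryFlux_eq_green, ← bdryFlux_eq_green]
    linear_combination -h1

theorem compatible_of_vanishes (hd : 0 < d) (hS : M.Standing) (hR : ReflectingComplementary M R)
    (hwp : WellPosed M R) (hD : DoublyInvariant M R)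
    (hfL : MemLp f 2 (volume.restrict M.Ω)) (hf : ∀ᵐ x ∂volume.restrict M.Ω₃, f x = 0) :
    Compatible M R f ∧ ∃ W gW, IsH1 M.Ω W gW ∧ VanishesOn M.Ω (frontier M.Ω) W gW ∧
      IsWeakSol M.Ω M.k (hatA M R) (hat M R M.sig) f W gW ∧
      (∀ W' gW', IsH1 M.Ω W' gW' → VanishesOn M.Ω (frontier M.Ω) W' gW' →
        IsWeakSol M.Ω M.k (hatA M R) (hat M R M.sig) f W' gW' →
        ∀ᵐ x ∂volume.restrict M.Ω, W' x = W x) ∧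
      SolvesU M R f 0 0 ∧ SolvesW M R f 0 0 W gW ∧ SolvesV M f W gW W gW := by
  have hC := hR.coeff_hat hd hS hD
  obtain ⟨W, gW, h1, h2, h3⟩ := exists_isWeakSol hS.smooth.1 hS.bdd hC hwp.2 hfL
  have huniq : ∀ W' gW', IsH1 M.Ω W' gW' → VanishesOn M.Ω (frontier M.Ω) W' gW' →
      IsWeakSol M.Ω M.k (hatA M R) (hat M R M.sig) f W' gW' →
      ∀ᵐ x ∂volume.restrict M.Ω, W' x = W x := by
    intro W' gW' h1' h2' h3'
    filter_upwards [hwp.2 _ _ (h1'.sub h1) (h3'.sub hC hfL h1' h1 h3) (h2'.sub h1' h1 h2)]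
      with x hx
    exact sub_eq_zero.1 hx
  have hU := solvesU_zero hS hR hf
  have hSW := solvesW_of_isWeakSol hd hS hR hD hfL hf h1 h2 h3
  have hSV := solvesV_of_isWeakSol hd hS hR hD hfL h1 h3
  refine ⟨⟨0, 0, W, gW, W, gW, hU, hSW, fun W' gW' h' => ?_, hSV⟩,
    W, gW, h1, h2, h3, huniq, hU, hSW, hSV⟩
  obtain ⟨k1, k2, k3⟩ := h'.isWeakSol hd hS hR hD hfL hf
  exact ae_mono (Measure.restrict_mono_set volume sdiff_subset) (huniq W' gW' k1 k2 k3)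

end

end NIM

end

noncomputable section

namespace NIM

variable {d : ℕ}

/-! ### Weak equations tested with `H¹₀` functions -/

open scoped Convolution

/-- Translation is continuous in `L²`; the integral is an inner product with the conjugate of `a`.
-/
lemma continuous_integral_mul_translate {a b : E d → ℂ} (ha : MemLp a 2 volume)
    (hb : MemLp b 2 volume) : Continuous fun t => ∫ x, a x * b (x - t) := by
  have hm : ∀ t : E d, MeasurePreserving (fun x : E d => x - t) volume volume := fun t =>
    measurePreserving_sub_right volume t
  let τ : C(E d, C(E d, E d)) := ContinuousMap.curry ⟨fun p : E d × E d => p.2 - p.1, by fun_prop⟩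
  have hτ : Continuous fun t => Lp.compMeasurePreserving (τ t) (hm t) hb.toLp :=
    Continuous.compMeasurePreservingLp continuous_const τ.continuous _ (by simp)
  have ha' : MemLp (fun x => (starRingEnd ℂ) (a x)) 2 volume :=
    ha.of_le (Complex.continuous_conj.comp_aestronglyMeasurable ha.1) (.of_forall fun x => by simp)
  refine ((continuous_const (y := ha'.toLp)).inner (𝕜 := ℂ) hτ).congr fun t => ?_
  rw [L2.inner_def]
  refine integral_congr_ae ?_
  filter_upwards [ha'.coeFn_toLp, Lp.coeFn_compMeasurePreserving hb.toLp (hm t),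
    (hm t).quasiMeasurePreserving.ae_eq_comp hb.coeFn_toLp] with x h1 h2 h3
  have h4 : Lp.compMeasurePreserving (τ t) (hm t) hb.toLp x = b (x - t) := h2.trans h3
  rw [h1, h4]
  simp [mul_comm]

/-- Fubini's theorem. The integrand is dominated through `|a b| ≤ |a|² + |b|²`, and both majorants
are integrable on the product space. -/
lemma integral_mul_convolution {a : E d → ℂ} {b ψ : E d → ℝ} (ha : MemLp a 2 volume)
    (hb : MemLp b 2 volume) (hψ : IsTest univ ψ) :
    ∫ x, a x * ((b ⋆[ContinuousLinearMap.lsmul ℝ ℝ] ψ) x : ℂ)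
      = ∫ t, ψ t • ∫ x, a x * (b (x - t) : ℂ) := by
  have hψi : Integrable ψ := hψ.continuous.integrable_of_hasCompactSupport hψ.2.1
  have ha2 : Integrable fun x => ‖a x‖ ^ 2 := (memLp_two_iff_integrable_sq_norm ha.1).1 ha
  have hb2 : Integrable fun x => ‖b x‖ ^ 2 := (memLp_two_iff_integrable_sq_norm hb.1).1 hb
  have h1 : Integrable (fun p : E d × E d => ‖a p.1‖ ^ 2 * ‖ψ p.2‖) (volume.prod volume) :=
    ha2.mul_prod hψi.norm
  have h2 : Integrable (fun p : E d × E d => ‖ψ p.2‖ * ‖b (p.1 - p.2)‖ ^ 2)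
      (volume.prod volume) :=
    hψi.norm.convolution_integrand (ContinuousLinearMap.mul ℝ ℝ) hb2
  have hbm : AEStronglyMeasurable (fun p : E d × E d => (ψ p.2 : ℂ) * (b (p.1 - p.2) : ℂ))
      (volume.prod volume) := by
    have := hψi.1.convolution_integrand (ContinuousLinearMap.mul ℝ ℝ) hb.1 (μ := volume)
    refine (Complex.continuous_ofReal.comp_aestronglyMeasurable this).congr (.of_forall fun p => ?_)
    simp
  have h3 : Integrable (fun p : E d × E d => a p.1 * ((ψ p.2 : ℂ) * (b (p.1 - p.2) : ℂ)))
      (volume.prod volume) := by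
    refine (h1.add h2).mono' (ha.1.comp_fst.mul hbm) (.of_forall fun p => ?_)
    simp only [norm_mul, Complex.norm_real, Pi.add_apply]
    nlinarith [sq_nonneg (‖a p.1‖ - ‖b (p.1 - p.2)‖), norm_nonneg (ψ p.2),
      mul_nonneg (norm_nonneg (ψ p.2)) (sq_nonneg (‖a p.1‖ - ‖b (p.1 - p.2)‖)),
      mul_nonneg (norm_nonneg (ψ p.2)) (sq_nonneg ‖a p.1‖),
      mul_nonneg (norm_nonneg (ψ p.2)) (sq_nonneg ‖b (p.1 - p.2)‖)]
  calc ∫ x, a x * ((b ⋆[ContinuousLinearMap.lsmul ℝ ℝ] ψ) x : ℂ)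
      = ∫ x, ∫ t, a x * ((ψ t : ℂ) * (b (x - t) : ℂ)) := by
        refine integral_congr_ae (.of_forall fun x => ?_)
        simp only
        rw [integral_const_mul, convolution_def]
        congr 1
        rw [← integral_sub_left_eq_self _ volume x, ← integral_complex_ofReal]
        refine integral_congr_ae (.of_forall fun t => ?_)
        simp [mul_comm]
    _ = ∫ t, ∫ x, a x * ((ψ t : ℂ) * (b (x - t) : ℂ)) := integral_integral_swap h3
    _ = _ := by
        refine integral_congr_ae (.of_forall fun t => ?_)
        simp only
        rw [← integral_smul]
        refine integral_congr_ae (.of_forall fun x => ?_)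
        simp only [Complex.real_smul]
        ring

/-- The derivative falls on `ψ`. Since `y ↦ ψ (x - y)` is a test function with `∂ᵢ` of opposite
sign, the weak derivative relation moves it back to `u`. -/
lemma pd_convolution {u w ψ : E d → ℝ} {i : Fin d} (hu : LocallyIntegrable u)
    (hψ : IsTest univ ψ)
    (huw : ∀ φ, IsTest univ φ → ∫ y, (u y * pd i φ y + w y * φ y) = 0)
    (hui : ∀ φ, IsTest univ φ → Integrable fun y => u y * φ y)
    (hwi : ∀ φ, IsTest univ φ → Integrable fun y => w y * φ y) (x : E d) :
    pd i (u ⋆[ContinuousLinearMap.lsmul ℝ ℝ] ψ) x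
      = (w ⋆[ContinuousLinearMap.lsmul ℝ ℝ] ψ) x := by
  have hd := hψ.2.1.hasFDerivAt_convolution_right (ContinuousLinearMap.lsmul ℝ ℝ) hu
    (hψ.1.of_le (by simp)) x
  rw [pd, hd.fderiv, convolution_precompR_apply _ hu (hψ.2.1.fderiv ℝ)
    (hψ.1.continuous_fderiv (by simp))]
  set φ : E d → ℝ := fun y => ψ (x - y) with hφ
  have hφt : IsTest univ φ :=
    ⟨hψ.1.comp (contDiff_const.sub contDiff_id),
      hψ.2.1.comp_homeomorph (Homeomorph.subLeft x), subset_univ _⟩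
  have hpd : ∀ y, pd i φ y = -pd i ψ (x - y) := fun y => by
    have h1 : HasFDerivAt (fun y : E d => x - y) (-ContinuousLinearMap.id ℝ (E d)) y :=
      (hasFDerivAt_id y).const_sub x
    have h2 := (hψ.1.differentiable (by simp) (x - y)).hasFDerivAt.comp y h1
    rw [pd, show φ = ψ ∘ fun y => x - y from rfl, h2.fderiv]
    simp [pd]
  have h1 := huw φ hφt
  rw [integral_add (hui _ (hφt.pd i)) (hwi φ hφt)] at h1
  simp only [hpd, mul_neg, integral_neg] at h1
  simp only [convolution_def, ContinuousLinearMap.lsmul_apply, smul_eq_mul]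
  change ∫ t, u t * pd i ψ (x - t) = ∫ t, w t * φ t
  linarith

/-- A weak equation in `D` may be tested with `H¹` functions supported in a compact subset. -/
lemma integral_eq_zero_of_compact_support {D K : Set (E d)} (hD : IsOpen D) (hK : IsCompact K)
    (hKD : K ⊆ D) {p : Fin d → E d → ℂ} {s : E d → ℂ} (hp : ∀ i, MemLp (p i) 2 volume)
    (hs : MemLp s 2 volume)
    (hps : ∀ φ, IsTest D φ → ∫ x, ((∑ i, p i x * (pd i φ x : ℂ)) + s x * (φ x : ℂ)) = 0)
    {u : E d → ℝ} {w : Fin d → E d → ℝ} (hu : MemLp u 2 volume) (hw : ∀ i, MemLp (w i) 2 volume)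
    (huK : ∀ x ∉ K, u x = 0)
    (huw : ∀ i φ, IsTest univ φ → ∫ x, (u x * pd i φ x + w i x * φ x) = 0) :
    ∫ x, ((∑ i, p i x * (w i x : ℂ)) + s x * (u x : ℂ)) = 0 := by
  obtain ⟨δ, hδ, hδD⟩ := hK.exists_cthickening_subset_open hD hKD
  have hreal : ∀ {b : E d → ℝ}, MemLp b 2 volume → MemLp (fun x => (b x : ℂ)) 2 volume :=
    fun hb => hb.ofReal
  -- `Ψ t` is the desired expression with `u` and `w` translated by `t`. Testing with the smooth
  -- function `u ⋆ ψ`, still supported in `D` for `ψ` supported near 0, gives `∫ ψ Ψ = 0`. So `Ψ`,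
  -- being continuous, vanishes near 0, and `t = 0` is the claim; no limit of mollifiers is taken.
  set Ψ : E d → ℂ := fun t => (∑ i, ∫ x, p i x * (w i (x - t) : ℂ))
    + ∫ x, s x * (u (x - t) : ℂ) with hΨ
  have hΨc : Continuous Ψ := (continuous_finsetSum _ fun i _ =>
    continuous_integral_mul_translate (hp i) (hreal (hw i))).add
      (continuous_integral_mul_translate hs (hreal hu))
  have hul : LocallyIntegrable u := hu.locallyIntegrable (by norm_num)
  have hint : ∀ {b φ : E d → ℝ}, MemLp b 2 volume → IsTest univ φ →
      Integrable fun y => b y * φ y := fun hb hφ =>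
    hb.integrable_mul (hφ.continuous.memLp_of_hasCompactSupport (p := 2) hφ.2.1)
  have hzero : ∀ ψ, IsTest (Metric.ball 0 δ) ψ → ∫ t, ψ t • Ψ t = 0 := by
    intro ψ hψ
    have hψ' := hψ.mono (subset_univ _)
    set φ := u ⋆[ContinuousLinearMap.lsmul ℝ ℝ] ψ with hφ
    have hφs : Function.support φ ⊆ Metric.cthickening δ K := by
      refine (support_convolution_subset_swap _).trans ?_
      rintro _ ⟨y, hy, z, hz, rfl⟩
      have hzK : z ∈ K := by_contra fun h => hz (huK z h)
      have hyδ := hψ.2.2 (subset_closure hy)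
      refine Metric.mem_cthickening_of_dist_le _ z δ K hzK ?_
      rw [dist_eq_norm, add_sub_cancel_right]
      exact (mem_ball_zero_iff.1 hyδ).le
    have hφt : tsupport φ ⊆ Metric.cthickening δ K :=
      closure_minimal hφs Metric.isClosed_cthickening
    have hφT : IsTest D φ := ⟨hψ.2.1.contDiff_convolution_right _ hul hψ.1,
      hK.cthickening.of_isClosed_subset (isClosed_tsupport _) hφt, hφt.trans hδD⟩
    have hpd : ∀ i x, pd i φ x = (w i ⋆[ContinuousLinearMap.lsmul ℝ ℝ] ψ) x := fun i x =>
      pd_convolution hul hψ' (huw i) (fun φ => hint hu) (fun φ => hint (hw i)) x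
    have h1 := hps φ hφT
    have hi1 : ∀ i, Integrable fun x => p i x * (pd i φ x : ℂ) := fun i =>
      (hp i).integrable_mul ((hφT.pd i).memLp 2 _)
    have his : Integrable fun x => s x * (φ x : ℂ) := hs.integrable_mul (hφT.memLp 2 _)
    rw [integral_add (integrable_finsetSum _ fun i _ => hi1 i) his,
      integral_finsetSum _ fun i _ => hi1 i] at h1
    simp only [hpd] at h1
    rw [integral_mul_convolution hs hu hψ',
      Finset.sum_congr rfl fun i _ => integral_mul_convolution (hp i) (hw i) hψ'] at h1
    have hi2 : ∀ {F : E d → ℂ}, Continuous F → Integrable fun t => ψ t • F t := fun hF =>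
      (hψ.continuous.smul hF).integrable_of_hasCompactSupport hψ.2.1.smul_right
    have hc : ∀ i, Continuous fun t => ∫ x, p i x * (w i (x - t) : ℂ) := fun i =>
      continuous_integral_mul_translate (hp i) (hreal (hw i))
    rw [← integral_finsetSum _ fun i _ => hi2 (hc i), ← integral_add
      (integrable_finsetSum _ fun i _ => hi2 (hc i))
      (hi2 (continuous_integral_mul_translate hs (hreal hu)))] at h1
    rw [← h1]
    refine integral_congr_ae (.of_forall fun t => ?_)
    simp only [hΨ, smul_add, Finset.smul_sum]
  have h2 := Metric.isOpen_ball.ae_eq_zero_of_integral_contDiff_smul_eq_zero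
    (μ := (volume : Measure (E d))) (hΨc.locallyIntegrable.locallyIntegrableOn
      (Metric.ball (0 : E d) δ)) fun ψ a b c => hzero ψ ⟨a, b, c⟩
  have h3 : EqOn Ψ 0 (Metric.ball 0 δ) := Measure.eqOn_open_of_ae_eq
    (μ := (volume : Measure (E d)))
    ((ae_restrict_iff' Metric.isOpen_ball.measurableSet).2 h2) Metric.isOpen_ball
    hΨc.continuousOn continuousOn_const
  have h4 := h3 (Metric.mem_ball_self hδ)
  simp only [hΨ, sub_zero, Pi.zero_apply] at h4
  have hi1 : ∀ i, Integrable fun x => p i x * (w i x : ℂ) := fun i =>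
    (hp i).integrable_mul (hreal (hw i))
  have his : Integrable fun x => s x * (u x : ℂ) := hs.integrable_mul (hreal hu)
  rw [integral_add (integrable_finsetSum _ fun i _ => hi1 i) his,
    integral_finsetSum _ fun i _ => hi1 i, h4]

end NIM

end

noncomputable section

namespace NIM

variable {d : ℕ}

/-! ### Uniqueness for the Dirichlet problem for the Laplacian -/

lemma IsH1.grad_ae_eq_zero {D N : Set (E d)} {v : E d → ℂ} {q : E d → Fin d → ℂ} (h : IsH1 D v q)
    (hD : IsOpen D) (hN : IsOpen N) (hv : ∀ᵐ x ∂volume.restrict (D ∩ N), v x = 0) (i : Fin d) :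
    ∀ᵐ x ∂volume.restrict (D ∩ N), q x i = 0 := by
  have hDN := hD.inter hN
  have hq := (h.mono hD.measurableSet inter_subset_left : IsH1 (D ∩ N) v q)
  rw [ae_restrict_iff' hDN.measurableSet]
  refine hDN.ae_eq_zero_of_integral_contDiff_smul_eq_zero
    (locallyIntegrableOn_of_locallyIntegrable_restrict
      ((hq.2.1 i).locallyIntegrable (by norm_num))) fun φ a b c => ?_
  have h1 := hq.2.2 i φ ⟨a, b, c⟩
  rw [← h1, bdryTrace, ← setIntegral_eq_integral_of_forall_compl_eq_zero (s := D ∩ N) fun x hx => by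
    rw [IsTest.eq_zero ⟨a, b, c⟩ hx, zero_smul]]
  refine integral_congr_ae ?_
  filter_upwards [hv] with x hx
  simp [hx, mul_comm]

/-- A function vanishing near `∂D` is supported in the compact set `K = closure D \ N ⊆ D`, so its
extension by zero is a legitimate test function. The functional `L` is the real or the imaginary
part, since the preceding result is for real test functions. -/
lemma integral_green_eq_zero_of_vanishes_near {D S N : Set (E d)} {v : E d → ℂ}
    {q : E d → Fin d → ℂ} {p : E d → Fin d → ℂ} {s : E d → ℂ} (hD : IsOpen D)
    (hb : Bornology.IsBounded D) (hS : frontier D ⊆ S) (h : IsH1 D v q) (hN : IsOpen N)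
    (hSN : S ⊆ N) (hv : ∀ᵐ x ∂volume.restrict (D ∩ N), v x = 0) (hp : IsL2 D p s)
    (hps : ∀ φ, IsTest D φ → green D p s φ = 0) (L : ℂ →L[ℝ] ℝ) :
    ∫ x in D, ((∑ i, p x i * (L (q x i) : ℂ)) + s x * (L (v x) : ℂ)) = 0 := by
  set K := closure D \ N with hKdef
  have hK : IsCompact K := (Metric.isCompact_of_isClosed_isBounded isClosed_closure
    hb.closure).diff hN
  have hKD : K ⊆ D := fun x hx => by
    by_contra hxD
    exact hx.2 (hSN (hS ⟨hx.1, fun hxi => hxD (interior_subset hxi)⟩))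
  have hKm := hK.measurableSet
  have hz : ∀ᵐ x, x ∈ D → x ∉ K → v x = 0 ∧ ∀ i, q x i = 0 := by
    have h2 := ae_all_iff.2 fun i => h.grad_ae_eq_zero hD hN hv i
    rw [ae_restrict_iff' (hD.inter hN).measurableSet] at hv h2
    filter_upwards [hv, h2] with x h3 h4 hx hxK
    have hxN : x ∈ N := by_contra fun hxN => hxK ⟨subset_closure hx, hxN⟩
    exact ⟨h3 ⟨hx, hxN⟩, h4 ⟨hx, hxN⟩⟩
  have hmem : ∀ {b : E d → ℂ}, MemLp b 2 (volume.restrict D) →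
      MemLp (K.indicator fun x => L (b x)) 2 volume := fun hb =>
    (memLp_indicator_iff_restrict hKm).2
      ((L.comp_memLp' hb).mono_measure (Measure.restrict_mono_set volume hKD))
  have hmemD : ∀ {b : E d → ℂ}, MemLp b 2 (volume.restrict D) → MemLp (D.indicator b) 2 volume :=
    fun hb => (memLp_indicator_iff_restrict hD.measurableSet).2 hb
  have hLr : ∀ (z : ℂ) (r : ℝ), L (z * (r : ℂ)) = L z * r := fun z r => by
    rw [mul_comm, ← Complex.real_smul, map_smul, smul_eq_mul, mul_comm]
  have h1 := integral_eq_zero_of_compact_support hD hK hKD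
    (p := fun i => D.indicator fun x => p x i) (s := D.indicator s)
    (u := K.indicator fun x => L (v x)) (w := fun i => K.indicator fun x => L (q x i))
    (fun i => hmemD (hp.1 i)) (hmemD hp.2) (fun φ hφ => ?_) (hmem h.1) (fun i => hmem (h.2.1 i))
    (fun x hx => indicator_of_notMem hx _) (fun i φ hφ => ?_)
  · rw [← h1, ← integral_indicator hD.measurableSet]
    refine integral_congr_ae ?_
    filter_upwards [hz] with x hx
    by_cases hxD : x ∈ D
    · by_cases hxK : x ∈ K
      · simp [hxD, hxK]
      · simp [hxD, hxK, hx hxD hxK]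
    · simp [hxD]
  · rw [← hps φ hφ, green, ← integral_indicator hD.measurableSet]
    refine integral_congr_ae (.of_forall fun x => ?_)
    by_cases hxD : x ∈ D <;> simp [hxD]
  -- The extension by zero has the expected weak gradient: a cutoff equal to 1 near `K` turns an
  -- arbitrary test function into one in `D` without changing the integrals.
  · obtain ⟨χ, hχ, ⟨N₁, hN₁, hKN, hχ1⟩, -⟩ := exists_cutoff hK hD hKD
    have ht : IsTest D fun x => χ x * φ x :=
      (hφ.mul_left_of_tsupport hχ.1 hχ.2.2).mono inter_subset_right
    have h2 := congrArg L (h.2.2 i _ ht)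
    have hint : IntegrableOn (fun x => v x * (pd i (fun x => χ x * φ x) x : ℂ)
        + q x i * ((χ x * φ x : ℝ) : ℂ)) D :=
      (h.1.integrable_mul ((ht.pd i).memLp 2 _)).add ((h.2.1 i).integrable_mul (ht.memLp 2 _))
    rw [bdryTrace, ← L.integral_comp_comm hint, map_zero] at h2
    rw [← h2, ← integral_indicator hD.measurableSet]
    refine integral_congr_ae ?_
    filter_upwards [hz] with x hx
    by_cases hxD : x ∈ D
    · by_cases hxK : x ∈ K
      · have h3 : pd i χ x = 0 := by
          have : χ =ᶠ[nhds x] fun _ => 1 :=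
            Filter.eventuallyEq_of_mem (hN₁.mem_nhds (hKN hxK)) hχ1
          rw [pd, this.fderiv_eq]; simp
        simp only [hxD, hxK, indicator_of_mem, map_add, hLr, pd_mul hχ.1 hφ.1, h3,
          hχ1 x (hKN hxK)]
        ring
      · simp [hxD, hxK, hx hxD hxK]
    · have hxK : x ∉ K := fun h => hxD (hKD h)
      simp [hxD, hxK]

lemma enorm_integral_mul_conj_le {μ : Measure (E d)} {p q : E d → ℂ}
    (hp : AEStronglyMeasurable p μ) (hq : AEStronglyMeasurable q μ) :
    ‖∫ x, p x * (starRingEnd ℂ) (q x) ∂μ‖ₑ ≤ eLpNorm p 2 μ * eLpNorm q 2 μ := by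
  have hq' : AEStronglyMeasurable (fun x => (starRingEnd ℂ) (q x)) μ :=
    Complex.continuous_conj.comp_aestronglyMeasurable hq
  calc _ ≤ ∫⁻ x, ‖p x * (starRingEnd ℂ) (q x)‖ₑ ∂μ := enorm_integral_le_lintegral_enorm _
    _ = eLpNorm (p • fun x => (starRingEnd ℂ) (q x)) 1 μ := by
        rw [eLpNorm_one_eq_lintegral_enorm]; rfl
    _ ≤ eLpNorm p 2 μ * eLpNorm (fun x => (starRingEnd ℂ) (q x)) 2 μ :=
        eLpNorm_smul_le_mul_eLpNorm hq' hp
    _ = _ := by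
        congr 1
        exact eLpNorm_congr_norm_ae (.of_forall fun x => by simp)

/-- A weak equation in `D` may be tested with functions in `H¹₀(D)`. -/
theorem VanishesOn.integral_green_conj_eq_zero {D S : Set (E d)} {v : E d → ℂ}
    {g : E d → Fin d → ℂ} {p : E d → Fin d → ℂ} {s : E d → ℂ} (hv : VanishesOn D S v g)
    (hD : IsOpen D) (hb : Bornology.IsBounded D) (hS : frontier D ⊆ S) (h : IsH1 D v g)
    (hp : IsL2 D p s) (hps : ∀ φ, IsTest D φ → green D p s φ = 0) :
    ∫ x in D, ((∑ i, p x i * (starRingEnd ℂ) (g x i)) + s x * (starRingEnd ℂ) (v x)) = 0 := by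
  set μ := volume.restrict D
  have hconj : ∀ {b : E d → ℂ}, MemLp b 2 μ → MemLp (fun x => (starRingEnd ℂ) (b x)) 2 μ :=
    fun hb => hb.of_le (Complex.continuous_conj.comp_aestronglyMeasurable hb.1)
      (.of_forall fun x => by simp)
  have hint : ∀ {a b : E d → ℂ}, MemLp a 2 μ → MemLp b 2 μ →
      Integrable (fun x => a x * (starRingEnd ℂ) (b x)) μ := fun ha hb =>
    ha.integrable_mul (hconj hb)
  set C : ℝ≥0∞ := (∑ i, eLpNorm (fun x => p x i) 2 μ) + eLpNorm s 2 μ with hC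
  have hCfin : C ≠ ⊤ := by
    refine ENNReal.add_ne_top.2 ⟨ENNReal.sum_ne_top.2 fun i _ => (hp.1 i).2.ne, hp.2.2.ne⟩
  -- The approximants satisfy the identity exactly, so only the approximation error remains;
  -- Cauchy–Schwarz bounds it by `C ε`.
  have key : ∀ ε : ℝ≥0∞, 0 < ε →
      ‖∫ x in D, ((∑ i, p x i * (starRingEnd ℂ) (g x i)) + s x * (starRingEnd ℂ) (v x))‖ₑ
        ≤ C * ε := by
    intro ε hε
    obtain ⟨v', h', hH, ⟨N, hN, hSN, hNv⟩, e1, e2⟩ := hv ε hε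
    have hre := integral_green_eq_zero_of_vanishes_near hD hb hS hH hN hSN hNv hp hps Complex.reCLM
    have him := integral_green_eq_zero_of_vanishes_near hD hb hS hH hN hSN hNv hp hps Complex.imCLM
    have hI : ∀ L : ℂ →L[ℝ] ℝ, Integrable
        (fun x => (∑ i, p x i * (L (h' x i) : ℂ)) + s x * (L (v' x) : ℂ)) μ := fun L =>
      (integrable_finsetSum _ fun i _ => (hp.1 i).integrable_mul
        (L.comp_memLp' (hH.2.1 i)).ofReal).add
        (hp.2.integrable_mul (L.comp_memLp' hH.1).ofReal)
    have h0 : ∫ x in D, ((∑ i, p x i * (starRingEnd ℂ) (h' x i))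
        + s x * (starRingEnd ℂ) (v' x)) = 0 := by
      have h1 := integral_sub (hI Complex.reCLM) ((hI Complex.imCLM).const_mul Complex.I)
      rw [integral_const_mul, hre, him, mul_zero, sub_zero] at h1
      rw [← h1]
      refine integral_congr_ae (.of_forall fun x => ?_)
      have hc : ∀ z : ℂ, (starRingEnd ℂ) z = z.re - Complex.I * z.im := fun z => by
        apply Complex.ext <;> simp
      simp only [hc, mul_sub, Finset.sum_sub_distrib, Complex.reCLM_apply, Complex.imCLM_apply,
        mul_add, Finset.mul_sum, mul_left_comm Complex.I]
      ring
    have hG : ∀ {a : E d → Fin d → ℂ} {b : E d → ℂ}, (∀ i, MemLp (fun x => a x i) 2 μ) →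
        MemLp b 2 μ → Integrable (fun x => (∑ i, p x i * (starRingEnd ℂ) (a x i))
          + s x * (starRingEnd ℂ) (b x)) μ := fun ha hb =>
      (integrable_finsetSum _ fun i _ => hint (hp.1 i) (ha i)).add (hint hp.2 hb)
    have hg' : ∀ i, MemLp (fun x => g x i - h' x i) 2 μ := fun i => (h.2.1 i).sub (hH.2.1 i)
    have hv' : MemLp (fun x => v x - v' x) 2 μ := h.1.sub hH.1
    have h1 := integral_sub (hG h.2.1 h.1) (hG hH.2.1 hH.1)
    rw [h0, sub_zero] at h1
    rw [← h1]
    have h2 : ∀ x, ((∑ i, p x i * (starRingEnd ℂ) (g x i)) + s x * (starRingEnd ℂ) (v x))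
        - ((∑ i, p x i * (starRingEnd ℂ) (h' x i)) + s x * (starRingEnd ℂ) (v' x))
        = (∑ i, p x i * (starRingEnd ℂ) (g x i - h' x i))
          + s x * (starRingEnd ℂ) (v x - v' x) := fun x => by
      simp only [map_sub, mul_sub, Finset.sum_sub_distrib]; ring
    simp only [h2]
    rw [integral_add (integrable_finsetSum _ fun i _ => hint (hp.1 i) (hg' i)) (hint hp.2 hv'),
      integral_finsetSum _ fun i _ => hint (hp.1 i) (hg' i), hC, add_mul, Finset.sum_mul]
    refine (enorm_add_le _ _).trans (add_le_add ((enorm_sum_le _ _).trans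
      (Finset.sum_le_sum fun i _ => ?_)) ?_)
    · exact (enorm_integral_mul_conj_le (hp.1 i).1 (hg' i).1).trans
        (mul_le_mul_right (e2 i).le _)
    · exact (enorm_integral_mul_conj_le hp.2.1 hv'.1).trans (mul_le_mul_right e1.le _)
  have hlim : Filter.Tendsto (fun n : ℕ => C * (n : ℝ≥0∞)⁻¹) Filter.atTop (nhds (C * 0)) :=
    ENNReal.Tendsto.const_mul ENNReal.tendsto_inv_nat_nhds_zero (Or.inr hCfin)
  rw [mul_zero] at hlim
  have := ge_of_tendsto' hlim fun n => key _ (ENNReal.inv_pos.2 (ENNReal.natCast_ne_top n))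
  exact enorm_eq_zero.1 (le_antisymm this zero_le)

lemma ae_eq_zero_of_integral_mul_conj {μ : Measure (E d)} {b : E d → ℂ} (hb : MemLp b 2 μ)
    (h : ∫ x, b x * (starRingEnd ℂ) (b x) ∂μ = 0) : ∀ᵐ x ∂μ, b x = 0 := by
  have h1 : ∀ x, b x * (starRingEnd ℂ) (b x) = ((‖b x‖ ^ 2 : ℝ) : ℂ) := fun x => by
    rw [Complex.mul_conj, Complex.normSq_eq_norm_sq]
  simp only [h1] at h
  rw [integral_complex_ofReal, Complex.ofReal_eq_zero,
    integral_eq_zero_iff_of_nonneg (fun x => by positivity)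
      ((memLp_two_iff_integrable_sq_norm hb.1).1 hb)] at h
  filter_upwards [h] with x hx
  simpa using hx

/-- The Dirichlet problem for Laplace's equation in a bounded open set has only the zero
solution. -/
theorem ae_eq_zero_of_laplace {D S : Set (E d)} {v : E d → ℂ} {g : E d → Fin d → ℂ} (hd : 0 < d)
    (hD : IsOpen D) (hb : Bornology.IsBounded D) (hS : frontier D ⊆ S) (h : IsH1 D v g)
    (hg : ∀ φ, IsTest D φ → green D g 0 φ = 0) (hv : VanishesOn D S v g) :
    ∀ᵐ x ∂volume.restrict D, v x = 0 := by
  have hg0 : ∀ᵐ x ∂volume.restrict D, ∀ i, g x i = 0 := by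
    -- Energy identity: testing the equation with `v` itself gives `∫ |∇v|² = 0`.
    have h1 := hv.integral_green_conj_eq_zero hD hb hS h (p := g) (s := 0)
      ⟨h.2.1, MemLp.zero⟩ hg
    have h2 : ∀ x, (∑ i, g x i * (starRingEnd ℂ) (g x i)) + (0 : E d → ℂ) x * (starRingEnd ℂ) (v x)
        = ((∑ i, ‖g x i‖ ^ 2 : ℝ) : ℂ) := fun x => by
      simp [Complex.mul_conj, Complex.normSq_eq_norm_sq]
    simp only [h2] at h1
    rw [integral_complex_ofReal, Complex.ofReal_eq_zero, integral_eq_zero_iff_of_nonneg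
      (fun x => Finset.sum_nonneg fun i _ => by positivity)
      (integrable_finsetSum _ fun i _ =>
        (memLp_two_iff_integrable_sq_norm (h.2.1 i).1).1 (h.2.1 i))] at h1
    filter_upwards [h1] with x hx i
    have := (Finset.sum_eq_zero_iff_of_nonneg fun i _ => by positivity).1 hx i (Finset.mem_univ i)
    simpa using this
  set i₀ : Fin d := ⟨0, hd⟩
  set ζ : E d → ℝ := fun x => x i₀ with hζdef
  have hζ : ContDiff ℝ ∞ ζ := (EuclideanSpace.proj (𝕜 := ℝ) i₀).contDiff
  have hpd : ∀ x, pd i₀ ζ x = 1 := fun x => by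
    rw [pd, show ζ = EuclideanSpace.proj (𝕜 := ℝ) i₀ from rfl, ContinuousLinearMap.fderiv]
    simp
  obtain ⟨C, hC⟩ := hb.exists_norm_le
  have hζC : ∀ᵐ x ∂volume.restrict D, ‖(ζ x : ℂ)‖ ≤ C := by
    filter_upwards [ae_restrict_mem hD.measurableSet] with x hx
    rw [Complex.norm_real]
    exact (PiLp.norm_apply_le x i₀).trans (hC x hx)
  have hζm : AEStronglyMeasurable (fun x => (ζ x : ℂ)) (volume.restrict D) :=
    (Complex.continuous_ofReal.comp hζ.continuous).aestronglyMeasurable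
  -- This replaces Poincaré's inequality and needs no connectedness. The field `ζ v e_{i₀}` with `ζ
  -- = x_{i₀}` has weak divergence `v + ζ ∂_{i₀} v`; testing this relation with `v` and using `∇v =
  -- 0` leaves `∫ |v|² = 0`.
  have h1 := hv.integral_green_conj_eq_zero hD hb hS h
    (p := fun x i => ζ x * (if i = i₀ then v x else 0)) (s := fun x => v x + ζ x * g x i₀)
    ⟨fun i => bddMul_memLp hζm hζC ((h.isL2 i₀).1 i),
      h.1.add (bddMul_memLp hζm hζC (h.2.1 i₀))⟩ fun φ hφ => by
        have := h.2.2 i₀ _ (hφ.mul_left hζ)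
        rw [bdryTrace_eq_green, green_mul_test hζ hφ.1] at this
        refine Eq.trans (green_congr (.of_forall fun x => ⟨fun i => rfl, ?_⟩)) this
        simp [hpd, add_comm]
  refine ae_eq_zero_of_integral_mul_conj h.1 ?_
  rw [← h1]
  refine integral_congr_ae ?_
  filter_upwards [hg0] with x hx
  simp [hx]

end NIM

end

noncomputable section

namespace NIM

variable {d : ℕ}

/-! ### The annulus -/

lemma kelvin_eq_inversion (r : ℝ) : kelvin r = EuclideanGeometry.inversion 0 r := by
  ext x i
  simp [kelvin, EuclideanGeometry.inversion, div_pow]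

lemma norm_kelvin (r : ℝ) (x : E 2) : ‖kelvin r x‖ = r ^ 2 / ‖x‖ := by
  rw [kelvin_eq_inversion, ← dist_zero_right, EuclideanGeometry.dist_inversion_center,
    dist_zero_right]

lemma kelvin_kelvin {r : ℝ} (hr : r ≠ 0) (x : E 2) : kelvin r (kelvin r x) = x := by
  rw [kelvin_eq_inversion, EuclideanGeometry.inversion_inversion _ hr]

lemma kelvin_of_norm_eq {r : ℝ} {x : E 2} (hr : r ≠ 0) (hx : ‖x‖ = r) : kelvin r x = x := by
  rw [kelvin, hx, div_self (pow_ne_zero 2 hr), one_smul]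

/-- A composition of two inversions with the same centre is a dilation, hence smooth through the
centre, where each inversion alone is singular. -/
lemma kelvin_comp {r s : ℝ} (hr : r ≠ 0) (x : E 2) :
    kelvin s (kelvin r x) = (s ^ 2 / r ^ 2) • x := by
  by_cases hx : x = 0
  · simp [kelvin, hx]
  have hx' : ‖x‖ ≠ 0 := norm_ne_zero_iff.2 hx
  rw [kelvin, norm_kelvin, kelvin, smul_smul]
  congr 1
  field_simp

lemma isDiffeo_of_inverse {F F' : E d → E d} {D D' : Set (E d)} (hD : IsOpen D)
    (hD' : IsOpen D') (hF : MapsTo F D D') (hF' : MapsTo F' D' D) (hl : ∀ x ∈ D, F' (F x) = x)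
    (hr : ∀ y ∈ D', F (F' y) = y) (hs : ContDiffOn ℝ 1 F D) (hs' : ContDiffOn ℝ 1 F' D') :
    IsDiffeo F D D' := by
  have hb : BijOn F D D' := InvOn.bijOn ⟨hl, hr⟩ hF hF'
  refine ⟨hD, hD', hb, hs, hs'.congr fun y hy => ?_⟩
  conv_lhs => rw [← hr y hy]
  exact hb.invOn_invFunOn.1 (hF' hy)

lemma isDiffeo_kelvin {r : ℝ} (hr : r ≠ 0) {D D' : Set (E 2)} (hD : IsOpen D)
    (hD' : IsOpen D') (hF : MapsTo (kelvin r) D D') (hF' : MapsTo (kelvin r) D' D)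
    (h0 : (0 : E 2) ∉ D) (h0' : (0 : E 2) ∉ D') : IsDiffeo (kelvin r) D D' := by
  have hs : ∀ D : Set (E 2), (0 : E 2) ∉ D → ContDiffOn ℝ 1 (kelvin r) D := fun D h0 => by
    rw [kelvin_eq_inversion]
    exact contDiffOn_const.inversion contDiffOn_const contDiffOn_id
      fun x hx h => h0 (h ▸ hx)
  exact isDiffeo_of_inverse hD hD' hF hF' (fun x _ => kelvin_kelvin hr x)
    (fun x _ => kelvin_kelvin hr x) (hs D h0) (hs D' h0')

/-- The derivative of an inversion is `(r / ‖x‖)²` times a reflection, and reflections preserve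
inner products. -/
lemma jac_kelvin_transpose_mul (r : ℝ) {x : E 2} (hx : x ≠ 0) :
    (jac (kelvin r) x).transpose * jac (kelvin r) x
      = ((r / ‖x‖) ^ 2) ^ 2 • (1 : Matrix (Fin 2) (Fin 2) ℝ) := by
  have hD := EuclideanGeometry.hasFDerivAt_inversion (R := r) hx
  rw [← kelvin_eq_inversion, dist_zero_right] at hD
  ext i j
  have h1 : ((jac (kelvin r) x).transpose * jac (kelvin r) x) i j
      = inner ℝ (fderiv ℝ (kelvin r) x (EuclideanSpace.single i 1))
          (fderiv ℝ (kelvin r) x (EuclideanSpace.single j 1)) := by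
    simp [Matrix.mul_apply, jac, PiLp.inner_apply, mul_comm]
  rw [h1, hD.fderiv, smul_apply, smul_apply, real_inner_smul_left, real_inner_smul_right]
  change _ * (_ * inner ℝ ((Submodule.reflection (ℝ ∙ (x - 0))ᗮ) _)
    ((Submodule.reflection (ℝ ∙ (x - 0))ᗮ) _)) = _
  rw [LinearIsometryEquiv.inner_map_map, EuclideanSpace.inner_single_left, Matrix.smul_apply,
    Matrix.one_apply]
  simp only [PiLp.single_apply, smul_eq_mul, map_one, one_mul]
  ring

/-- In the plane, conformal maps leave the coefficient `1` invariant. -/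
lemma smul_mul_transpose_eq_one {J : Matrix (Fin 2) (Fin 2) ℝ} {c : ℝ} (hc : 0 < c)
    (hJ : J.transpose * J = c ^ 2 • (1 : Matrix (Fin 2) (Fin 2) ℝ)) :
    (|J.det|)⁻¹ • (J * 1 * J.transpose) = 1 := by
  have hdet : |J.det| = c ^ 2 := by
    -- In dimension two, and only there, `|det J|` equals the factor `c²` carried by `Jᵀ J`.
    have h1 := congrArg Matrix.det hJ
    rw [Matrix.det_mul, Matrix.det_transpose, Matrix.det_smul, Matrix.det_one, Fintype.card_fin,
      mul_one, ← sq] at h1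
    rw [← abs_of_pos (pow_pos hc 2)]
    exact (sq_eq_sq_iff_abs_eq_abs _ _).1 h1
  have hc2 : c ^ 2 ≠ 0 := by positivity
  have h2 : ((c ^ 2)⁻¹ • J.transpose) * J = 1 := by
    rw [Matrix.smul_mul, hJ, smul_smul, inv_mul_cancel₀ hc2, one_smul]
  rw [hdet, Matrix.mul_one, ← Matrix.mul_smul]
  exact mul_eq_one_comm.1 h2

lemma pushMat_kelvin {r : ℝ} (hr : r ≠ 0) {D : Set (E 2)} {B : E 2 → Matrix (Fin 2) (Fin 2) ℝ}
    {y : E 2} (h0 : Function.invFunOn (kelvin r) D y ≠ 0)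
    (hB : B (Function.invFunOn (kelvin r) D y) = 1) : pushMat (kelvin r) D B y = 1 := by
  rw [pushMat]
  simp only [hB]
  refine smul_mul_transpose_eq_one (c := (r / ‖Function.invFunOn (kelvin r) D y‖) ^ 2) ?_
    (jac_kelvin_transpose_mul r h0)
  have := norm_pos_iff.2 h0
  positivity

lemma isSmoothOpen_univ : IsSmoothOpen (univ : Set (E d)) :=
  ⟨isOpen_univ, fun x hx => by simp at hx⟩

lemma isSmoothOpen_ball {r : ℝ} (hr : 0 < r) : IsSmoothOpen (Metric.ball (0 : E d) r) := by
  refine ⟨Metric.isOpen_ball, fun x hx => ⟨univ, fun y => ‖y‖ ^ 2 - r ^ 2, isOpen_univ,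
    mem_univ x, ((contDiff_norm_sq ℝ).sub contDiff_const).contDiffOn, fun h => ?_, ?_⟩⟩
  · rw [frontier_ball _ hr.ne', mem_sphere_zero_iff_norm] at hx
    have h1 := ((hasStrictFDerivAt_norm_sq x).hasFDerivAt.sub_const (r ^ 2)).fderiv
    rw [h] at h1
    have h2 := congrArg (fun L : E d →L[ℝ] ℝ => L x) h1
    simp only [zero_apply, smul_apply, innerSL_apply_apply, real_inner_self_eq_norm_sq, hx] at h2
    simp at h2
    exact hr.ne' h2
  · ext y
    simp only [mem_inter_iff, mem_ball_zero_iff, mem_univ, and_true, true_and, sub_neg]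
    exact (pow_lt_pow_iff_left₀ (norm_nonneg y) hr.le two_ne_zero).symm

lemma isConnected_ball_zero {r : ℝ} (hr : 0 < r) : IsConnected (Metric.ball (0 : E d) r) :=
  ⟨⟨0, Metric.mem_ball_self hr⟩, (convex_ball 0 r).isPreconnected⟩

lemma fixesBoundary_kelvin {r : ℝ} (hr : 0 < r) (D : Set (E 2)) :
    FixesBoundary (kelvin r) D (frontier (Metric.ball 0 r)) := by
  have hm : MapsTo (kelvin r) {0}ᶜ {0}ᶜ := fun x hx h => by
    have h1 := norm_kelvin r x
    rw [mem_singleton_iff] at h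
    have h2 := norm_pos_iff.2 hx
    rw [h, norm_zero] at h1
    have : 0 < r ^ 2 / ‖x‖ := by positivity
    linarith
  have h : ∀ x ∈ frontier (Metric.ball (0 : E 2) r), ‖x‖ = r := fun x hx => by
    rwa [frontier_ball _ hr.ne', mem_sphere_zero_iff_norm] at hx
  refine ⟨kelvin r, {0}ᶜ, {0}ᶜ, fun x hx hx0 => ?_, isDiffeo_kelvin hr.ne' isOpen_compl_singleton
    isOpen_compl_singleton hm hm (by simp) (by simp), fun x _ => rfl,
    fun x hx => kelvin_of_norm_eq hr.ne' (h x hx)⟩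
  have := h x hx
  rw [mem_singleton_iff.1 hx0, norm_zero] at this
  exact hr.ne this

/-! ### The annulus satisfies the hypotheses. -/

section

variable {r₁ r₂ ρ : ℝ}

lemma annulus_standing (h1 : 0 < r₁) (h12 : r₁ < r₂) (h3 : r₂ ^ 2 / r₁ < ρ) :
    (annulusMedium r₁ r₂ ρ).Standing := by
  have h2 : 0 < r₂ := h1.trans h12
  have h23 : r₂ < r₂ ^ 2 / r₁ := by rw [lt_div_iff₀ h1]; nlinarith
  have h03 := h2.trans h23
  have hρ := h03.trans h3
  have hcl : ∀ {r s : ℝ}, 0 < r → r < s → closure (Metric.ball (0 : E 2) r) ⊆ Metric.ball 0 s :=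
    fun hr hrs => by
      rw [closure_ball _ hr.ne']
      exact Metric.closedBall_subset_ball hrs
  exact
    { smooth₁ := isSmoothOpen_ball h1
      smooth₂ := isSmoothOpen_ball h2
      smooth₃ := isSmoothOpen_ball h03
      smooth := isSmoothOpen_ball hρ
      conn₁ := isConnected_ball_zero h1
      conn₂ := isConnected_ball_zero h2
      conn₃ := isConnected_ball_zero h03
      conn := isConnected_ball_zero hρ
      bdd := Metric.isBounded_ball
      sub₁₂ := hcl h1 h12
      sub₂₃ := hcl h2 h23
      sub₃ := hcl h03 h3
      meas_A := fun i j => aemeasurable_const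
      bdd_A := ⟨1, .of_forall fun x i j => by
        simp only [annulusMedium, Matrix.one_apply]
        split_ifs <;> simp⟩
      elliptic := ⟨1, one_pos, .of_forall fun x ξ => by simp [annulusMedium]⟩
      meas_sig := aemeasurable_const
      bdd_sig := ⟨1, 1, one_pos, .of_forall fun x => ⟨le_rfl, le_rfl⟩⟩
      k_nonneg := le_rfl }

/-- The Kelvin transform with respect to `∂B_r` maps `B_r \ {0}` onto the exterior of `B_r`. -/
lemma isDiffeo_kelvin_punctured (hr : 0 < r₂) :
    IsDiffeo (kelvin r₂) (Metric.ball 0 r₂ \ {0}) (univ \ closure (Metric.ball 0 r₂)) := by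
  rw [closure_ball _ hr.ne']
  refine isDiffeo_kelvin hr.ne' (Metric.isOpen_ball.sdiff isClosed_singleton)
    (isOpen_univ.sdiff Metric.isClosed_closedBall) (fun x hx => ⟨mem_univ _, fun h => ?_⟩)
    (fun x hx => ?_) (by simp) (by simp [hr.le])
  · rw [mem_closedBall_zero_iff, norm_kelvin] at h
    have hx0 : 0 < ‖x‖ := norm_pos_iff.2 hx.2
    have hx1 := mem_ball_zero_iff.1 hx.1
    rw [div_le_iff₀ hx0] at h
    nlinarith
  · have hx1 : r₂ < ‖x‖ := by simpa using hx
    have hx0 := hr.trans hx1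
    refine ⟨?_, fun h => ?_⟩
    · rw [mem_ball_zero_iff, norm_kelvin, div_lt_iff₀ hx0]
      nlinarith
    · have := norm_kelvin r₂ x
      rw [mem_singleton_iff.1 h, norm_zero] at this
      have : 0 < r₂ ^ 2 / ‖x‖ := by positivity
      linarith

/-- The Kelvin transform is an involution, so this is the inverse of the preceding diffeomorphism.
-/
lemma isDiffeo_kelvin_exterior (hr : 0 < r₂) :
    IsDiffeo (kelvin r₂) (univ \ closure (Metric.ball 0 r₂)) (Metric.ball 0 r₂ \ {0}) := by
  have h := isDiffeo_kelvin_punctured hr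
  have e : ∀ y ∈ univ \ closure (Metric.ball 0 r₂),
      Function.invFunOn (kelvin r₂) (Metric.ball 0 r₂ \ {0}) y = kelvin r₂ y := fun y hy => by
    conv_rhs => rw [← h.apply_inv hy]
    exact (kelvin_kelvin hr.ne' _).symm
  exact isDiffeo_of_inverse h.2.1 h.1 (fun y hy => e y hy ▸ h.inv_mem hy) h.2.2.1.mapsTo
    (fun y _ => kelvin_kelvin hr.ne' y) (fun y _ => kelvin_kelvin hr.ne' y)
    (h.2.2.2.2.congr fun y hy => (e y hy).symm) h.2.2.2.1

lemma isDiffeo_kelvin_shell (h1 : 0 < r₁) (h12 : r₁ < r₂) :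
    IsDiffeo (kelvin r₂) (Metric.ball 0 r₂ \ closure (Metric.ball 0 r₁))
      (Metric.ball 0 (r₂ ^ 2 / r₁) \ closure (Metric.ball 0 r₂)) := by
  have h2 : 0 < r₂ := h1.trans h12
  rw [closure_ball _ h1.ne', closure_ball _ h2.ne']
  refine isDiffeo_kelvin h2.ne' (Metric.isOpen_ball.sdiff Metric.isClosed_closedBall)
    (Metric.isOpen_ball.sdiff Metric.isClosed_closedBall) (fun x hx => ?_) (fun x hx => ?_)
    (by simp [h1.le]) (by simp [h2.le])
  all_goals
    simp only [mem_sdiff, mem_ball_zero_iff, mem_closedBall_zero_iff, not_le, norm_kelvin] at hx ⊢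
  · have hx0 := h1.trans hx.2
    rw [div_lt_div_iff_of_pos_left (by positivity) hx0 h1, lt_div_iff₀ hx0]
    exact ⟨hx.2, by nlinarith⟩
  · have hx0 := h2.trans hx.2
    rw [div_lt_iff₀ hx0, lt_div_iff₀ hx0]
    rw [lt_div_iff₀ h1] at hx
    exact ⟨by nlinarith, by nlinarith⟩

lemma annulus_pushFA (h1 : 0 < r₁) (h12 : r₁ < r₂) {y : E 2}
    (hy : y ∉ closure (Metric.ball 0 r₂)) :
    pushFA (annulusMedium r₁ r₂ ρ) (annulusReflections r₁ r₂) y = 1 :=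
  pushMat_kelvin (h1.trans h12).ne'
    ((isDiffeo_kelvin_punctured (h1.trans h12)).inv_mem ⟨mem_univ y, hy⟩).2 rfl

lemma annulus_pushGFA (h1 : 0 < r₁) (h12 : r₁ < r₂) {y : E 2}
    (hy : y ∈ Metric.ball 0 (r₂ ^ 2 / r₁)) (hy0 : y ≠ 0) :
    pushGFA (annulusMedium r₁ r₂ ρ) (annulusReflections r₁ r₂) y = 1 := by
  have h2 : 0 < r₂ := h1.trans h12
  have h23 : r₂ < r₂ ^ 2 / r₁ := by rw [lt_div_iff₀ h1]; nlinarith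
  have hm := (isDiffeo_kelvin_exterior (h2.trans h23)).inv_mem (show y ∈ _ \ {0} from ⟨hy, hy0⟩)
  have hm' : Function.invFunOn (kelvin (r₂ ^ 2 / r₁))
      (univ \ closure (Metric.ball 0 (r₂ ^ 2 / r₁))) y ∉ closure (Metric.ball 0 r₂) := fun h =>
    hm.2 (closure_mono (Metric.ball_subset_ball h23.le) h)
  refine pushMat_kelvin (h2.trans h23).ne' (fun h => hm' ?_) ?_
  · exact h.symm ▸ subset_closure (Metric.mem_ball_self h2)
  · exact annulus_pushFA h1 h12 hm'

lemma annulus_hatA (h1 : 0 < r₁) (h12 : r₁ < r₂) {y : E 2} (hy0 : y ≠ 0) :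
    hatA (annulusMedium r₁ r₂ ρ) (annulusReflections r₁ r₂) y = 1 := by
  rw [hatA]
  split_ifs with h
  · exact annulus_pushGFA h1 h12 h hy0
  · rfl

lemma isDiffeo_smul {c r : ℝ} (hc : 0 < c) :
    IsDiffeo (fun x : E d => c • x) (Metric.ball 0 r) (Metric.ball 0 (c * r)) := by
  refine isDiffeo_of_inverse (F' := fun x => c⁻¹ • x) Metric.isOpen_ball Metric.isOpen_ball
    (fun x hx => ?_) (fun x hx => ?_) (fun x _ => inv_smul_smul₀ hc.ne' x)
    (fun x _ => smul_inv_smul₀ hc.ne' x) (contDiff_const_smul c).contDiffOn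
    (contDiff_const_smul c⁻¹).contDiffOn
  · rw [mem_ball_zero_iff] at hx ⊢
    rw [norm_smul, Real.norm_of_nonneg hc.le]
    exact mul_lt_mul_of_pos_left hx hc
  · rw [mem_ball_zero_iff] at hx ⊢
    rw [norm_smul, Real.norm_of_nonneg (inv_pos.2 hc).le, inv_mul_lt_iff₀ hc]
    exact hx

lemma annulus_reflectingComplementary (h1 : 0 < r₁) (h12 : r₁ < r₂) :
    ReflectingComplementary (annulusMedium r₁ r₂ ρ) (annulusReflections r₁ r₂) := by
  have h2 : 0 < r₂ := h1.trans h12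
  have h23 : r₂ < r₂ ^ 2 / r₁ := by rw [lt_div_iff₀ h1]; nlinarith
  have h03 := h2.trans h23
  refine
    { F_diffeo := isDiffeo_kelvin_shell h1 h12
      push_A := ?_
      push_sig := fun hk => absurd rfl hk
      F_fix := fixesBoundary_kelvin h2 _
      x₁_mem := Metric.mem_ball_self h1
      smooth₄ := isSmoothOpen_univ
      sub₃₄ := subset_univ _
      F_ext := isDiffeo_kelvin_punctured h2
      x₂_mem := Metric.mem_ball_self h03
      G_diffeo := isDiffeo_kelvin_exterior h03
      G_fix := fixesBoundary_kelvin h03 _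
      GF_diffeo := ?_ }
  · filter_upwards [ae_restrict_mem (isDiffeo_kelvin_shell h1 h12).2.1.measurableSet] with x hx
    exact annulus_pushFA h1 h12 hx.2
  · have e : Function.update ((annulusReflections r₁ r₂).G ∘ (annulusReflections r₁ r₂).F)
        (annulusReflections r₁ r₂).x₁ (annulusReflections r₁ r₂).x₂
        = fun x => ((r₂ ^ 2 / r₁) ^ 2 / r₂ ^ 2) • x := by
      ext1 x
      by_cases hx : x = 0
      · simp [annulusReflections, hx]
      · rw [Function.update_of_ne (show x ≠ (annulusReflections r₁ r₂).x₁ from hx)]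
        exact kelvin_comp h2.ne' x
    -- The dilation factor `r₃² / r₂²` carries `r₁` to `r₃` precisely because `r₃ = r₂² / r₁`.
    have hr : r₂ ^ 2 / r₁ = ((r₂ ^ 2 / r₁) ^ 2 / r₂ ^ 2) * r₁ := by field_simp
    have := isDiffeo_smul (d := 2) (c := (r₂ ^ 2 / r₁) ^ 2 / r₂ ^ 2) (r := r₁) (by positivity)
    rw [← hr] at this
    rw [e]
    exact this

lemma ae_eq_zero_of_isWeakSol_one {D S : Set (E d)} {B : E d → Matrix (Fin d) (Fin d) ℝ}
    {σ : E d → ℝ} {v : E d → ℂ} {g : E d → Fin d → ℂ} (hd : 0 < d) (hD : IsOpen D)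
    (hb : Bornology.IsBounded D) (hS : frontier D ⊆ S)
    (hB : ∀ᵐ x ∂volume.restrict D, B x = 1) (h : IsH1 D v g) (hs : IsWeakSol D 0 B σ 0 v g)
    (hv : VanishesOn D S v g) : ∀ᵐ x ∂volume.restrict D, v x = 0 := by
  refine ae_eq_zero_of_laplace hd hD hb hS h (fun φ hφ => ?_) hv
  rw [← hs φ hφ, bdryFlux_eq_green]
  refine green_congr ?_
  filter_upwards [hB] with x hx
  simp [hx, Matrix.one_apply, apply_ite (fun r : ℝ => (r : ℂ))]

/-- Both problems are Dirichlet problems for the Laplacian: `A = I` everywhere, and `Â = I` except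
possibly at the origin, a null set. -/
lemma annulus_wellPosed (h1 : 0 < r₁) (h12 : r₁ < r₂) :
    WellPosed (annulusMedium r₁ r₂ ρ) (annulusReflections r₁ r₂) := by
  refine ⟨fun v g h hs hv => ?_, fun v g h hs hv => ?_⟩
  · refine ae_eq_zero_of_isWeakSol_one two_pos (Metric.isOpen_ball.sdiff isClosed_closure)
      (Metric.isBounded_ball.subset sdiff_subset) ?_ (.of_forall fun _ => rfl) h hs hv
    rw [sdiff_eq]
    refine (frontier_inter_subset _ _).trans (union_subset_union inter_subset_left ?_)
    rw [frontier_compl]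
    exact inter_subset_right.trans frontier_closure_subset
  · refine ae_eq_zero_of_isWeakSol_one two_pos Metric.isOpen_ball Metric.isBounded_ball subset_rfl
      ?_ h hs hv
    filter_upwards [ae_restrict_of_ae (ReflectingComplementary.ae_ne_x₂
      (R := annulusReflections r₁ r₂) two_pos)] with x hx
    exact annulus_hatA h1 h12 hx

lemma annulus_doublyInvariant (h1 : 0 < r₁) (h12 : r₁ < r₂) :
    DoublyInvariant (annulusMedium r₁ r₂ ρ) (annulusReflections r₁ r₂) := by
  refine ⟨?_, fun hk => absurd rfl hk⟩
  filter_upwards [ae_restrict_mem (isDiffeo_kelvin_shell h1 h12).2.1.measurableSet] with x hx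
  exact annulus_pushGFA h1 h12 hx.1 fun h => hx.2
    (h ▸ subset_closure (Metric.mem_ball_self (h1.trans h12)))

end

end NIM

end

theorem corollary3p2 :
    -- the corollary
    (∀ d : ℕ, d = 2 ∨ d = 3 → ∀ (M : NIM.Medium d) (R : NIM.Reflections d),
      M.Standing → NIM.ReflectingComplementary M R → NIM.WellPosed M R →
      NIM.DoublyInvariant M R →
      ∀ f : NIM.E d → ℂ, MemLp f 2 (volume.restrict M.Ω) →
      (∀ᵐ x ∂volume.restrict M.Ω₃, f x = 0) →
      NIM.Compatible M R f ∧
      -- with `U = 0`, `W` the unique solution in `H¹₀(Ω)`, and `V = W` in `Ω₃ \ closure Ω₂`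
      ∃ W gW, NIM.IsH1 M.Ω W gW ∧ NIM.VanishesOn M.Ω (frontier M.Ω) W gW ∧
        NIM.IsWeakSol M.Ω M.k (NIM.hatA M R) (NIM.hat M R M.sig) f W gW ∧
        (∀ W' gW', NIM.IsH1 M.Ω W' gW' → NIM.VanishesOn M.Ω (frontier M.Ω) W' gW' →
          NIM.IsWeakSol M.Ω M.k (NIM.hatA M R) (NIM.hat M R M.sig) f W' gW' →
          ∀ᵐ x ∂volume.restrict M.Ω, W' x = W x) ∧
        NIM.SolvesU M R f 0 0 ∧ NIM.SolvesW M R f 0 0 W gW ∧ NIM.SolvesV M f W gW W gW) ∧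
    -- the two-dimensional annulus satisfies all the assumptions
    (∀ r₁ r₂ ρ : ℝ, 0 < r₁ → r₁ < r₂ → r₂ ^ 2 / r₁ < ρ →
      (NIM.annulusMedium r₁ r₂ ρ).Standing ∧
      NIM.ReflectingComplementary (NIM.annulusMedium r₁ r₂ ρ) (NIM.annulusReflections r₁ r₂) ∧
      NIM.WellPosed (NIM.annulusMedium r₁ r₂ ρ) (NIM.annulusReflections r₁ r₂) ∧
      NIM.DoublyInvariant (NIM.annulusMedium r₁ r₂ ρ) (NIM.annulusReflections r₁ r₂)) := by
  refine ⟨fun d hd M R hS hR hwp hD f hfL hf =>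
    NIM.compatible_of_vanishes (by omega) hS hR hwp hD hfL hf, fun r₁ r₂ ρ h1 h12 h3 =>
    ⟨NIM.annulus_standing h1 h12 h3, NIM.annulus_reflectingComplementary h1 h12,
      NIM.annulus_wellPosed h1 h12, NIM.annulus_doublyInvariant h1 h12⟩⟩
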